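/- **Setting.** Let $n\ge 1$ and let $\rho:\mathbb{R}^n\to(0,\infty)$ be a function for which there are $l_0>0$ and $C_0>1$ with $$\frac1{C_0}\Big(1+\frac{|x-y|}{\rho(x)}\Big)^{-l_0}\le\frac{\rho(y)}{\rho(x)}\le C_0\Big(1+\frac{|x-y|}{\rho(x)}\Big)^{l_0/(l_0+1)}\qquad\text{for all }x,y\in\mathbb{R}^n.$$ For a ball $B=B(x_0,r)$ put $cB=B(x_0,cr)$ and $\Psi_\theta(B)=(1+r/\rho(x_0))^\theta$, and let $$M_{\rho,\theta}g(x)=\sup_{B\ni x}\frac1{\Psi_\theta(B)|B|}\int_B|g|\,dy .$$ A weight is a nonnegative locally integrable function. For $1<s<\infty$, $A_s^{\rho,\infty}=\bigcup_{\theta\ge0}A_s^{\rho,\theta}$, where $\omega\in A_s^{\rho,\theta}$ means that $$\Big(\frac1{\Psi_\theta(B)|B|}\int_B\omega\Big)\Big(\frac1{\Psi_\theta(B)|B|}\int_B\omega^{-1/(s-1)}\Big)^{s-1}\le C$$ for all balls $B$. For $1\le s\le\infty$, $\omega\in RH_s^{loc}$ means that $\big(\frac1{|B|}\int_B\omega^s\big)^{1/s}\le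 C\,\frac1{|B|}\int_B\omega$ for all balls $B=B(x_0,r)$ with $r<\rho(x_0)$ (the essential supremum of $\omega$ over $B$ on the left if $s=\infty$; no condition if $s=1$). $L_c^\infty$ is the space of bounded functions with compact support, and functions are real- or complex-valued. **Theorem 3.2.** Let $1\le p_0<q_0\le\infty$ and $c_0>0$. Let $T:L^{p_0}(\mathbb{R}^n)\to L^{p_0}(\mathbb{R}^n)$ be sublinear, that is, $|T(f+g)|\le|Tf|+|Tg|$ and $|T(\lambda f)|=|\lambda||Tf|$ a.e., and let $A_r:L_c^\infty\to L^{p_0}(\mathbb{R}^n)$, $r>0$, be a family of operators. Assume that for every $\theta>0$ there is a constant $C_\theta<\infty$ such that, for all $f\in L_c^\infty$, $$\sup_{\substack{B=B(x_0,r)\ni x\\ r<\rho(x_0)}}\frac1{|c_0B|}\int_{c_0B}|T(I-A_{c_0r})f|^{p_0}\,dy+\sup_{\substack{B=B(x_0,r)\ni x\\ r\ge\rho(x_0)}}\frac1{\Psi_\theta(B)|B|}\int_B|Tf|^{p_0}\,dy\le C_\theta\,M_{\rho,\theta}(|f|^{p_0})(x)$$ for all $x\in\mathbb{R}^n$, and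 $$\Big(\frac1{|c_0B|}\int_{c_0B}|TA_{c_0r}f|^{q_0}\,dy\Big)^{1/q_0}\le C_\theta\Big(M_{\rho,\theta}(|Tf|^{p_0})(x)^{1/p_0}+M_{\rho,\theta}(|f|^{p_0})(x')^{1/p_0}\Big)$$ for every ball $B=B(x_0,r)$ with $r<\rho(x_0)$ and all $x,x'\in c_0B$ (the left side is the essential supremum over $c_0B$ if $q_0=\infty$). Let $p_0<p<q_0$, or $p=q_0$ if $q_0<\infty$, and let $\omega$ be a weight in $A_{p/p_0}^{\rho,\infty}\cap RH^{loc}_{(q_0/p)'}$, where $(q_0/p)'$ is the conjugate exponent of $q_0/p$ ($1'=\infty$, $\infty'=1$). Then there is a constant $C<\infty$ such that $$\|Tf\|_{L^p(\omega)}\le C\|f\|_{L^p(\omega)}\qquad\text{for all }f\in L_c^\infty,$$ where $\|g\|_{L^p(\omega)}=(\int_{\mathbb{R}^n}|g|^p\,\omega\,dx)^{1/p}$. -/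

import Mathlib

open MeasureTheory Metric
open scoped ENNReal NNReal

/-- A critical radius function: a positive function `ρ` on `ℝⁿ` with the slow variation property
`C₀⁻¹ (1 + |x-y|/ρ(x))^(-l₀) ≤ ρ(y)/ρ(x) ≤ C₀ (1 + |x-y|/ρ(x))^(l₀/(l₀+1))`. -/
def IsCriticalRadius {n : ℕ} (ρ : EuclideanSpace ℝ (Fin n) → ℝ) : Prop :=
  (∀ x, 0 < ρ x) ∧
    ∃ l₀ C₀ : ℝ, 0 < l₀ ∧ 1 < C₀ ∧ ∀ x y,
      C₀⁻¹ * (1 + dist x y / ρ x) ^ (-l₀) ≤ ρ y / ρ x ∧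
        ρ y / ρ x ≤ C₀ * (1 + dist x y / ρ x) ^ (l₀ / (l₀ + 1))

/-- `Ψ_θ(B) = (1 + r/ρ(x₀))^θ` for the ball `B = B(x₀, r)`, as an extended nonnegative real. -/
noncomputable def critPsi {n : ℕ} (ρ : EuclideanSpace ℝ (Fin n) → ℝ) (θ : ℝ)
    (x₀ : EuclideanSpace ℝ (Fin n)) (r : ℝ) : ℝ≥0∞ :=
  ENNReal.ofReal ((1 + r / ρ x₀) ^ θ)

/-- The maximal function `M_{ρ,θ} g (x) = sup_{B ∋ x} (Ψ_θ(B) |B|)⁻¹ ∫_B g` of a nonnegative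
function `g`; the supremum is over all open balls containing `x`. -/
noncomputable def critMaximal {n : ℕ} (ρ : EuclideanSpace ℝ (Fin n) → ℝ) (θ : ℝ)
    (g : EuclideanSpace ℝ (Fin n) → ℝ≥0∞) (x : EuclideanSpace ℝ (Fin n)) : ℝ≥0∞ :=
  ⨆ (x₀ : EuclideanSpace ℝ (Fin n)) (r : ℝ) (_ : 0 < r) (_ : x ∈ ball x₀ r),
    (critPsi ρ θ x₀ r)⁻¹ * ⨍⁻ y in ball x₀ r, g y ∂volume

/-- A weight: a nonnegative locally integrable function. -/
def IsWeight {n : ℕ} (ω : EuclideanSpace ℝ (Fin n) → ℝ) : Prop :=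
  (∀ x, 0 ≤ ω x) ∧ LocallyIntegrable ω volume

/-- The measure `ω dx`. -/
noncomputable def weightMeasure {n : ℕ} (ω : EuclideanSpace ℝ (Fin n) → ℝ) :
    Measure (EuclideanSpace ℝ (Fin n)) :=
  volume.withDensity fun x => ENNReal.ofReal (ω x)

/-- The class `A_p^{ρ,θ}`, for `1 < p < ∞`; the powers are taken in `[0, ∞]`, so that
`0 ^ (-1/(p-1)) = ∞`. -/
def IsApCrit {n : ℕ} (ρ : EuclideanSpace ℝ (Fin n) → ℝ) (θ p : ℝ)
    (ω : EuclideanSpace ℝ (Fin n) → ℝ) : Prop :=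
  ∃ C : ℝ≥0, ∀ (x₀ : EuclideanSpace ℝ (Fin n)) (r : ℝ), 0 < r →
    ((critPsi ρ θ x₀ r)⁻¹ * ⨍⁻ y in ball x₀ r, ENNReal.ofReal (ω y) ∂volume) *
      ((critPsi ρ θ x₀ r)⁻¹ *
        ⨍⁻ y in ball x₀ r, ENNReal.ofReal (ω y) ^ (-(1 / (p - 1))) ∂volume) ^ (p - 1) ≤ C

/-- The class `A_p^{ρ,∞} = ⋃_{θ ≥ 0} A_p^{ρ,θ}`, for `1 < p < ∞`. -/
def IsApCritInfty {n : ℕ} (ρ : EuclideanSpace ℝ (Fin n) → ℝ) (p : ℝ)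
    (ω : EuclideanSpace ℝ (Fin n) → ℝ) : Prop :=
  ∃ θ : ℝ, 0 ≤ θ ∧ IsApCrit ρ θ p ω

/-- The normalized `L^q` norm on a ball: `(|B|⁻¹ ∫_B |g|^q)^(1/q)` for `0 < q < ∞`, and the
essential supremum of `|g|` on `B` for `q = ∞`. -/
noncomputable def ballNorm {n : ℕ} {F : Type*} [NormedAddCommGroup F] (q : ℝ≥0∞)
    (x₀ : EuclideanSpace ℝ (Fin n)) (r : ℝ) (g : EuclideanSpace ℝ (Fin n) → F) : ℝ≥0∞ :=
  eLpNorm g q ((volume (ball x₀ r))⁻¹ • volume.restrict (ball x₀ r))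

/-- The local reverse Hölder class `RH_q^{loc}`, `1 ≤ q ≤ ∞`: the reverse Hölder inequality on all
balls `B(x₀, r)` with `r < ρ(x₀)`. For `q = 1` it is no condition. -/
def IsRHLoc {n : ℕ} (ρ : EuclideanSpace ℝ (Fin n) → ℝ) (q : ℝ≥0∞)
    (ω : EuclideanSpace ℝ (Fin n) → ℝ) : Prop :=
  ∃ C : ℝ≥0, ∀ (x₀ : EuclideanSpace ℝ (Fin n)) (r : ℝ), 0 < r → r < ρ x₀ →
    ballNorm q x₀ r ω ≤ C * ⨍⁻ y in ball x₀ r, ENNReal.ofReal (ω y) ∂volume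

/-- The space `L_c^∞` of (classes of) bounded functions with compact support, as a subset
of `L^p`. -/
def LcInfty (n : ℕ) (𝕜 : Type*) [RCLike 𝕜] (p : ℝ≥0∞) :
    Set (Lp 𝕜 p (volume : Measure (EuclideanSpace ℝ (Fin n)))) :=
  {f | MemLp f ∞ volume ∧
    ∃ K : Set (EuclideanSpace ℝ (Fin n)), IsCompact K ∧ ∀ᵐ x ∂volume, x ∉ K → f x = 0}

/-- A sublinear operator on `L^p`: `|T(f+g)| ≤ |Tf| + |Tg|` and `|T(cf)| = |c| |Tf|` a.e. -/
def IsSublinearOp {n : ℕ} {𝕜 : Type*} [RCLike 𝕜] {p : ℝ≥0∞}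
    (T : Lp 𝕜 p (volume : Measure (EuclideanSpace ℝ (Fin n))) →
      Lp 𝕜 p (volume : Measure (EuclideanSpace ℝ (Fin n)))) : Prop :=
  (∀ f g, ∀ᵐ x ∂volume, ‖T (f + g) x‖ ≤ ‖T f x‖ + ‖T g x‖) ∧
    ∀ (c : 𝕜) (f), ∀ᵐ x ∂volume, ‖T (c • f) x‖ = ‖c‖ * ‖T f x‖

/-! Put `P = p / p₀`, `F = |Tf|^p₀` and `G = M_{ρ,θ}(|f|^p₀)`. The theorem follows from two
estimates in `L^P(w)`, where `w` is a version of the weight that is positive and finite everywhere: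
the norm of `F` is controlled by that of `G`, and `M_{ρ,θ}` is bounded once `θ` is large compared
with the exponent in the `A_P` condition of `w`.

The second estimate (`lintegral_critMaximal_rpow_le`) needs neither reverse Hölder nor openness of
the `A_P` classes. With `σ = w^(-1/(P-1))`, the power `(M_{ρ,θ} g)^(P-1)` is bounded pointwise by
the `w`-maximal function of `(M_σ(g/σ))^(P-1) / w`. Both weighted maximal functions are bounded by
Vitali's covering lemma, because `w dx` and `σ dx` are doubling up to a power of `Ψ`, and such
powers are absorbed in the maximal function.

The first estimate is a good-`λ` argument for the maximal function over subcritical balls. On a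
Whitney ball `B` of its level set, `F ≤ g + h`, where `g` comes from `T(I - A)f` and has averages
controlled by `G`, and `h` comes from `TAf` and, by Hölder and reverse Hölder, has a controlled norm
in `L^P(w)`. The part due to `g` has small Lebesgue measure, hence small weighted measure by the
local `A_∞` property (`exists_measure_le`). The part due to `h` is critical: Chebyshev at level `2^j
l` gives `2^(-jP) w(B)`, which exactly cancels the factor `2^(jP)` of the layer-cake formula, so one
level brings no gain. But the sum over any `N` consecutive levels is still at most `K' w(B)`, with
`K'` independent of `N`; averaging over `N > K'` levels permits absorption. This covers `p = q₀`
together with `p < q₀`, without self-improvement of the reverse Hölder class.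

Absorption requires a finite quantity. The levels are therefore cut off from above and `w` is
multiplied by a polynomially decaying factor which is almost constant at the scale of `ρ`, with
constants uniform in the cut-off. Balls of at least critical radius are handled directly by the
second term of the first hypothesis on `T`. -/

abbrev Eucl (n : ℕ) := EuclideanSpace ℝ (Fin n)

/-! ### The factor `Ψ_θ`. -/

section CritPsi

variable {n : ℕ} {ρ : Eucl n → ℝ}

theorem critPsi_ne_top (θ : ℝ) (x : Eucl n) (r : ℝ) : critPsi ρ θ x r ≠ ∞ :=
  ENNReal.ofReal_ne_top

theorem one_le_base (hρ : ∀ x, 0 < ρ x) (x : Eucl n) {r : ℝ} (hr : 0 ≤ r) : 1 ≤ 1 + r / ρ x := by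
  have := div_nonneg hr (hρ x).le
  linarith

theorem one_le_critPsi (hρ : ∀ x, 0 < ρ x) {θ : ℝ} (hθ : 0 ≤ θ) (x : Eucl n) {r : ℝ}
    (hr : 0 ≤ r) : 1 ≤ critPsi ρ θ x r := by
  unfold critPsi
  rw [← ENNReal.ofReal_one]
  exact ENNReal.ofReal_le_ofReal (Real.one_le_rpow (one_le_base hρ x hr) hθ)

theorem critPsi_ne_zero (hρ : ∀ x, 0 < ρ x) (θ : ℝ) (x : Eucl n) {r : ℝ}
    (hr : 0 ≤ r) : critPsi ρ θ x r ≠ 0 := by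
  unfold critPsi
  have := one_le_base hρ x hr
  simpa using Real.rpow_pos_of_pos (by linarith) θ

theorem critPsi_inv_le_one (hρ : ∀ x, 0 < ρ x) {θ : ℝ} (hθ : 0 ≤ θ) (x : Eucl n) {r : ℝ}
    (hr : 0 ≤ r) : (critPsi ρ θ x r)⁻¹ ≤ 1 :=
  ENNReal.inv_le_one.2 (one_le_critPsi hρ hθ x hr)

theorem critPsi_le_of_le (hρ : ∀ x, 0 < ρ x) {θ : ℝ} (hθ : 0 ≤ θ) {x : Eucl n} {r K : ℝ}
    (hr : 0 ≤ r) (hK : r ≤ K * ρ x) : critPsi ρ θ x r ≤ ENNReal.ofReal ((1 + K) ^ θ) := by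
  unfold critPsi
  refine ENNReal.ofReal_le_ofReal (Real.rpow_le_rpow ?_ ?_ hθ)
  · have := one_le_base hρ x hr
    linarith
  · have : r / ρ x ≤ K := by rwa [div_le_iff₀ (hρ x)]
    linarith

theorem critPsi_mul_le (hρ : ∀ x, 0 < ρ x) {θ c : ℝ} (hθ : 0 ≤ θ) (hc : 1 ≤ c) (x : Eucl n) {r : ℝ}
    (hr : 0 ≤ r) : critPsi ρ θ x (c * r) ≤ ENNReal.ofReal (c ^ θ) * critPsi ρ θ x r := by
  unfold critPsi
  have h0 := one_le_base hρ x hr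
  rw [← ENNReal.ofReal_mul (by positivity), ← Real.mul_rpow (by linarith) (by linarith)]
  refine ENNReal.ofReal_le_ofReal (Real.rpow_le_rpow ?_ ?_ hθ)
  · have := one_le_base hρ x (mul_nonneg (by linarith : 0 ≤ c) hr)
    linarith
  · rw [mul_div_assoc]
    nlinarith

theorem critPsi_mono (hρ : ∀ x, 0 < ρ x) {θ θ' : ℝ} (hθ : θ ≤ θ') (x : Eucl n) {r : ℝ}
    (hr : 0 ≤ r) : critPsi ρ θ x r ≤ critPsi ρ θ' x r :=
  ENNReal.ofReal_le_ofReal (Real.rpow_le_rpow_of_exponent_le (one_le_base hρ x hr) hθ)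

theorem critPsi_add (hρ : ∀ x, 0 < ρ x) (θ θ' : ℝ) (x : Eucl n) {r : ℝ}
    (hr : 0 ≤ r) : critPsi ρ (θ + θ') x r = critPsi ρ θ x r * critPsi ρ θ' x r := by
  have h0 := one_le_base hρ x hr
  unfold critPsi
  rw [← ENNReal.ofReal_mul (by positivity), Real.rpow_add (by linarith)]

theorem critPsi_rpow (hρ : ∀ x, 0 < ρ x) (θ : ℝ) (x : Eucl n) {r : ℝ}
    (hr : 0 ≤ r) (s : ℝ) : critPsi ρ θ x r ^ s = critPsi ρ (θ * s) x r := by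
  have h0 := one_le_base hρ x hr
  unfold critPsi
  rw [ENNReal.ofReal_rpow_of_pos (by positivity), ← Real.rpow_mul (by linarith)]

end CritPsi

/-! ### Dyadic layer-cake sums. -/

section Dyadic

/-- The dyadic number `2 ^ k`, for `k : ℤ`. -/
noncomputable def dyad (k : ℤ) : ℝ≥0∞ := (2 : ℝ≥0∞) ^ k

theorem dyad_ne_zero (k : ℤ) : dyad k ≠ 0 := by
  unfold dyad
  exact (ENNReal.zpow_pos (by norm_num) (by norm_num) k).ne'

theorem dyad_ne_top (k : ℤ) : dyad k ≠ ∞ :=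
  (ENNReal.zpow_lt_top (by norm_num) (by norm_num) k).ne

theorem dyad_add (k l : ℤ) : dyad (k + l) = dyad k * dyad l :=
  ENNReal.zpow_add (by norm_num) (by norm_num) k l

theorem dyad_zero : dyad 0 = 1 := by simp [dyad]

theorem dyad_one : dyad 1 = 2 := by simp [dyad]

theorem dyad_natCast (k : ℕ) : dyad k = 2 ^ k := by simp [dyad]

theorem dyad_mono {k l : ℤ} (h : k ≤ l) : dyad k ≤ dyad l :=
  ENNReal.zpow_le_of_le (by norm_num) h

theorem exists_dyad_mem_Ioc {t : ℝ≥0∞} (h0 : t ≠ 0) (ht : t ≠ ∞) :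
    ∃ k : ℤ, dyad k < t ∧ t ≤ dyad (k + 1) := by
  obtain ⟨k, hk⟩ := ENNReal.exists_mem_Ioc_zpow h0 ht (y := 2) (by norm_num) (by norm_num)
  exact ⟨k, hk.1, hk.2⟩

/-- A geometric series of ratio `2^(-P)`, dominated by its top term uniformly in `L`. -/
theorem tsum_dyad_rpow_le (P : ℝ) (hP : 0 < P) :
    ∃ C : ℝ≥0, ∀ L : ℤ, (∑' k : ℤ, if k ≤ L then dyad k ^ P else 0) ≤ C * dyad L ^ P := by
  set q : ℝ≥0∞ := dyad (-1) ^ P with hq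
  have hd : dyad (-1) < 1 := by
    have : dyad (-1) = 2⁻¹ := by
      unfold dyad
      rw [ENNReal.zpow_neg, zpow_one]
    rw [this]
    exact ENNReal.inv_lt_one.2 (by norm_num)
  have hq1 : q < 1 := ENNReal.rpow_lt_one hd hP
  have hCtop : (1 - q)⁻¹ ≠ ∞ := by
    rw [ENNReal.inv_ne_top]
    exact (tsub_pos_of_lt hq1).ne'
  refine ⟨((1 - q)⁻¹).toNNReal, fun L => ?_⟩
  rw [ENNReal.coe_toNNReal hCtop]
  have hinj : Function.Injective (fun i : ℕ => L - (i : ℤ)) := by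
    intro i j h
    simpa using h
  rw [← hinj.tsum_eq]
  · have : ∀ i : ℕ, (if L - (i : ℤ) ≤ L then dyad (L - (i : ℤ)) ^ P else 0)
        = dyad L ^ P * q ^ i := by
      intro i
      rw [if_pos (by omega), sub_eq_add_neg, dyad_add, ENNReal.mul_rpow_of_nonneg _ _ hP.le]
      congr 1
      have : dyad (-(i : ℤ)) = dyad (-1) ^ i := by
        unfold dyad
        rw [ENNReal.zpow_neg, ENNReal.zpow_neg, zpow_one, zpow_natCast, ENNReal.inv_pow]
      rw [this, hq, ← ENNReal.rpow_natCast, ← ENNReal.rpow_natCast, ← ENNReal.rpow_mul,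
        ← ENNReal.rpow_mul, mul_comm]
    simp_rw [this]
    rw [ENNReal.tsum_mul_left, ENNReal.tsum_geometric, mul_comm]
  · intro k hk
    have hk' : k ≤ L := by
      by_contra h
      simp [h] at hk
    exact ⟨(L - k).toNat, by simp [Int.toNat_of_nonneg (sub_nonneg.2 hk')]⟩

theorem tsum_dyad_lt_le (P : ℝ) (hP : 0 < P) :
    ∃ C : ℝ≥0, ∀ t : ℝ≥0∞, (∑' k : ℤ, if dyad k < t then dyad k ^ P else 0) ≤ C * t ^ P := by
  obtain ⟨C, hC⟩ := tsum_dyad_rpow_le P hP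
  -- The added `1` keeps the constant nonzero, so that the right side is `∞` when `t = ∞`.
  refine ⟨C + 1, fun t => ?_⟩
  rcases eq_or_ne t ∞ with rfl | ht
  · rw [ENNReal.top_rpow_of_pos hP, ENNReal.mul_top (by simp)]
    exact le_top
  rcases eq_or_ne t 0 with rfl | h0
  · simp
  obtain ⟨k, hk, hk'⟩ := exists_dyad_mem_Ioc h0 ht
  calc (∑' j : ℤ, if dyad j < t then dyad j ^ P else 0)
      ≤ ∑' j : ℤ, if j ≤ k then dyad j ^ P else 0 := by
        refine ENNReal.tsum_le_tsum fun j => ?_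
        by_cases h : dyad j < t
        · have : j ≤ k := by
            by_contra hjk
            have : dyad (k + 1) ≤ dyad j := dyad_mono (by omega)
            exact absurd (h.trans_le (hk'.trans this)) (lt_irrefl _)
          simp [h, this]
        · simp [h]
    _ ≤ C * dyad k ^ P := hC k
    _ ≤ (C + 1 : ℝ≥0) * t ^ P := by
        gcongr
        simp

/-- For finite nonzero `t` the single term with `2^k < t ≤ 2^(k+1)` suffices, at the cost of `2^P`.
For `t = ∞` all levels occur and the sum is infinite. -/
theorem rpow_le_tsum_dyad (P : ℝ) (hP : 0 < P) (t : ℝ≥0∞) :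
    t ^ P ≤ 2 ^ P * ∑' k : ℤ, if dyad k < t then dyad k ^ P else 0 := by
  have key : ∀ k : ℤ, dyad k < t → dyad k ^ P ≤ ∑' k : ℤ, if dyad k < t then dyad k ^ P else 0 := by
    intro k hk
    refine le_trans ?_ (ENNReal.le_tsum k)
    simp [hk]
  rcases eq_or_ne t 0 with rfl | h0
  · simp [hP]
  rcases eq_or_ne t ∞ with rfl | ht
  · have : (∑' k : ℤ, if dyad k < ∞ then dyad k ^ P else 0) = ∞ := by
      refine ENNReal.eq_top_of_forall_nnreal_le fun r => ?_
      have h1 : ((r : ℝ≥0∞) ^ P⁻¹) ≠ ∞ := ENNReal.rpow_ne_top_of_nonneg (by positivity) (by simp)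
      by_cases hr : (r : ℝ≥0∞) = 0
      · rw [hr]
        exact zero_le
      obtain ⟨k, -, hk⟩ := exists_dyad_mem_Ioc (t := (r : ℝ≥0∞) ^ P⁻¹)
        (ENNReal.rpow_pos (pos_iff_ne_zero.2 hr) (by simp)).ne' h1
      refine le_trans ?_ (key (k + 1) (dyad_ne_top _).lt_top)
      calc (r : ℝ≥0∞) = ((r : ℝ≥0∞) ^ P⁻¹) ^ P := by
            rw [← ENNReal.rpow_mul, inv_mul_cancel₀ hP.ne', ENNReal.rpow_one]
        _ ≤ _ := by gcongr
    rw [this, ENNReal.mul_top]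
    · exact le_top
    · simp [ENNReal.rpow_eq_zero_iff]
  obtain ⟨k, hk, hk'⟩ := exists_dyad_mem_Ioc h0 ht
  calc t ^ P ≤ dyad (k + 1) ^ P := by gcongr
    _ = 2 ^ P * dyad k ^ P := by
        rw [add_comm, dyad_add, dyad_one, ENNReal.mul_rpow_of_nonneg _ _ hP.le]
    _ ≤ _ := by
        gcongr
        exact key k hk

variable {α : Type*} [MeasurableSpace α] {μ : Measure α}

theorem lintegral_tsum_ite_dyad {f : α → ℝ≥0∞} (hf : Measurable f) (P : ℝ) :
    ∫⁻ x, (∑' k : ℤ, if dyad k < f x then dyad k ^ P else 0) ∂μ =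
      ∑' k : ℤ, dyad k ^ P * μ {x | dyad k < f x} := by
  have hm : ∀ k : ℤ, MeasurableSet {x | dyad k < f x} := fun k => measurableSet_lt
    measurable_const hf
  rw [lintegral_tsum]
  · refine tsum_congr fun k => ?_
    rw [← lintegral_indicator_const (hm k)]
    refine lintegral_congr fun x => ?_
    simp [Set.indicator_apply]
  · intro k
    exact (Measurable.ite (hm k) measurable_const measurable_const).aemeasurable

theorem lintegral_rpow_le_tsum {f : α → ℝ≥0∞} (hf : Measurable f) {P : ℝ} (hP : 0 < P) :
    ∫⁻ x, f x ^ P ∂μ ≤ 2 ^ P * ∑' k : ℤ, dyad k ^ P * μ {x | dyad k < f x} := by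
  rw [← lintegral_tsum_ite_dyad hf, ← lintegral_const_mul']
  · exact lintegral_mono fun x => rpow_le_tsum_dyad P hP (f x)
  · exact ENNReal.rpow_ne_top_of_nonneg hP.le (by norm_num)

/-- The discrete layer cake bound, at the levels `c * 2 ^ k`. -/
theorem tsum_le_lintegral_rpow {P : ℝ} (hP : 0 < P) :
    ∃ C : ℝ≥0, ∀ {α : Type*} [MeasurableSpace α] {μ : Measure α} {f : α → ℝ≥0∞},
      Measurable f → ∀ c : ℝ≥0∞, c ≠ 0 → c ≠ ∞ →
      ∑' k : ℤ, dyad k ^ P * μ {x | c * dyad k < f x} ≤ C * (c⁻¹ ^ P * ∫⁻ x, f x ^ P ∂μ) := by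
  obtain ⟨C, hC⟩ := tsum_dyad_lt_le P hP
  refine ⟨C, fun {α} _ {μ} {f} hf c h0 ht => ?_⟩
  have h1 : ∀ k, {x | c * dyad k < f x} = {x | dyad k < c⁻¹ * f x} := by
    intro k
    ext x
    simp only [Set.mem_ofPred_eq]
    rw [mul_comm c⁻¹, ← div_eq_mul_inv, ENNReal.lt_div_iff_mul_lt (Or.inl h0) (Or.inl ht), mul_comm]
  simp_rw [h1]
  rw [← lintegral_tsum_ite_dyad (f := fun x => c⁻¹ * f x) (hf.const_mul _) P]
  calc _ ≤ ∫⁻ x, C * (c⁻¹ * f x) ^ P ∂μ := lintegral_mono fun x => hC _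
    _ = _ := by
      rw [lintegral_const_mul' _ _ ENNReal.coe_ne_top]
      congr 1
      simp_rw [ENNReal.mul_rpow_of_nonneg _ _ hP.le]
      rw [lintegral_const_mul']
      exact ENNReal.rpow_ne_top_of_nonneg hP.le (ENNReal.inv_ne_top.2 h0)

end Dyadic

/-! ### Vitali covering and volumes of balls. -/

section Covering

variable {n : ℕ}

/-- Vitali covering: a family of balls of bounded radii has a countable disjoint subfamily whose
sixfold enlargements cover. -/
theorem exists_countable_disjoint_cover (t : Set (Eucl n × ℝ)) (R : ℝ)
    (ht : ∀ a ∈ t, 0 < a.2 ∧ a.2 ≤ R) :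
    ∃ u ⊆ t, u.Countable ∧ (u.PairwiseDisjoint fun a => ball a.1 a.2) ∧
      ∀ a ∈ t, ∃ b ∈ u, ball a.1 a.2 ⊆ ball b.1 (6 * b.2) := by
  -- The covering uses the factor 5 for closed balls; passing to open balls raises it to 6.
  obtain ⟨u, hut, hdisj, hcov⟩ := Vitali.exists_disjoint_subfamily_covering_enlargement_closedBall
    t (fun a => a.1) (fun a => a.2) R (fun a ha => (ht a ha).2) 5 (by norm_num)
  have hd : u.PairwiseDisjoint fun a => ball a.1 a.2 :=
    hdisj.mono fun a => ball_subset_closedBall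
  refine ⟨u, hut, ?_, hd, fun a ha => ?_⟩
  · exact hd.countable_of_isOpen (fun a _ => isOpen_ball)
      fun a ha => nonempty_ball.2 (ht a (hut ha)).1
  · obtain ⟨b, hb, hab⟩ := hcov a ha
    refine ⟨b, hb, ball_subset_closedBall.trans (hab.trans (closedBall_subset_ball ?_))⟩
    have := (ht b (hut hb)).1
    linarith

theorem volume_ball_pos (x : Eucl n) {r : ℝ} (hr : 0 < r) : volume (ball x r) ≠ 0 :=
  (measure_ball_pos volume x hr).ne'

theorem volume_ball_ne_top (x : Eucl n) (r : ℝ) : volume (ball x r) ≠ ∞ :=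
  measure_ball_lt_top.ne

theorem volume_ball_mul (x y : Eucl n) {c : ℝ} (hc : 0 < c) (r : ℝ) :
    volume (ball x (c * r)) = ENNReal.ofReal (c ^ n) * volume (ball y r) := by
  rw [Measure.addHaar_ball_mul_of_pos volume x hc, finrank_euclideanSpace_fin,
    Measure.addHaar_ball_center volume y]

/-- Averages over a ball are controlled by averages over a larger ball. -/
theorem laverage_ball_le (F : Eucl n → ℝ≥0∞) {x z : Eucl n} {r s c : ℝ} (hr : 0 < r) (hc : 0 < c)
    (hs : s ≤ c * r) (hsub : ball x r ⊆ ball z s) :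
    ⨍⁻ y in ball x r, F y ∂volume ≤ ENNReal.ofReal (c ^ n) * ⨍⁻ y in ball z s, F y ∂volume := by
  rw [setLAverage_eq, setLAverage_eq]
  have h1 : volume (ball z s) ≤ ENNReal.ofReal (c ^ n) * volume (ball x r) := by
    rw [← volume_ball_mul z x hc r]
    exact measure_mono (ball_subset_ball hs)
  have h0 : volume (ball z s) ≠ 0 := fun h =>
    volume_ball_pos x hr (measure_mono_null hsub h)
  have ht := volume_ball_ne_top z s
  have h2 : (volume (ball x r))⁻¹ ≤ ENNReal.ofReal (c ^ n) * (volume (ball z s))⁻¹ := by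
    rw [ENNReal.inv_le_iff_inv_le, ENNReal.mul_inv (Or.inr (by simp [h0])) (Or.inr (by simp [ht])),
      inv_inv, mul_comm, ← div_eq_mul_inv]
    refine ENNReal.div_le_of_le_mul ?_
    rwa [mul_comm]
  rw [div_eq_mul_inv, div_eq_mul_inv]
  calc (∫⁻ y in ball x r, F y) * (volume (ball x r))⁻¹
      ≤ (∫⁻ y in ball z s, F y) * (ENNReal.ofReal (c ^ n) * (volume (ball z s))⁻¹) := by
        gcongr
    _ = _ := by ring

end Covering

/-! ### Maximal functions of measures that are doubling up to a power of `Ψ`. -/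

section Maximal

variable {n : ℕ} {ρ : Eucl n → ℝ}

/-- The maximal function `sup_{B ∋ x} Ψ_θ(B)⁻¹ μ(B)⁻¹ ∫_B g dμ`. -/
noncomputable def critMaximalOf (μ : Measure (Eucl n)) (ρ : Eucl n → ℝ) (θ : ℝ)
    (g : Eucl n → ℝ≥0∞) (x : Eucl n) : ℝ≥0∞ :=
  ⨆ (x₀ : Eucl n) (r : ℝ) (_ : 0 < r) (_ : x ∈ ball x₀ r),
    (critPsi ρ θ x₀ r)⁻¹ * ⨍⁻ y in ball x₀ r, g y ∂μ

variable {μ : Measure (Eucl n)}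

theorem lt_critMaximalOf {θ : ℝ} {g : Eucl n → ℝ≥0∞} {x : Eucl n} {t : ℝ≥0∞} :
    t < critMaximalOf μ ρ θ g x ↔ ∃ x₀ r, 0 < r ∧ x ∈ ball x₀ r ∧
      t < (critPsi ρ θ x₀ r)⁻¹ * ⨍⁻ y in ball x₀ r, g y ∂μ := by
  simp only [critMaximalOf, lt_iSup_iff, exists_prop]

theorem le_critMaximalOf (θ : ℝ) (g : Eucl n → ℝ≥0∞) {x x₀ : Eucl n} {r : ℝ} (hr : 0 < r)
    (hx : x ∈ ball x₀ r) :
    (critPsi ρ θ x₀ r)⁻¹ * ⨍⁻ y in ball x₀ r, g y ∂μ ≤ critMaximalOf μ ρ θ g x :=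
  le_iSup₂_of_le x₀ r (le_iSup₂_of_le hr hx le_rfl)

theorem critMaximalOf_le {θ : ℝ} {g : Eucl n → ℝ≥0∞} {x : Eucl n} {t : ℝ≥0∞}
    (h : ∀ x₀ r, 0 < r → x ∈ ball x₀ r →
      (critPsi ρ θ x₀ r)⁻¹ * ⨍⁻ y in ball x₀ r, g y ∂μ ≤ t) :
    critMaximalOf μ ρ θ g x ≤ t :=
  iSup₂_le fun x₀ r => iSup₂_le fun hr hx => h x₀ r hr hx

theorem isOpen_lt_critMaximalOf (θ : ℝ) (g : Eucl n → ℝ≥0∞) (t : ℝ≥0∞) :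
    IsOpen {x | t < critMaximalOf μ ρ θ g x} := by
  rw [isOpen_iff_forall_mem_open]
  intro x hx
  obtain ⟨x₀, r, hr, hx, h⟩ := lt_critMaximalOf.1 hx
  exact ⟨ball x₀ r, fun y hy => lt_critMaximalOf.2 ⟨x₀, r, hr, hy, h⟩, isOpen_ball, hx⟩

theorem measurable_critMaximalOf (θ : ℝ) (g : Eucl n → ℝ≥0∞) :
    Measurable (critMaximalOf μ ρ θ g) :=
  measurable_of_Ioi fun t => (isOpen_lt_critMaximalOf θ g t).measurableSet

/-- The doubling property of a measure, up to a power of `Ψ`. -/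
structure CritDoubling (μ : Measure (Eucl n)) (ρ : Eucl n → ℝ) (κ : ℝ) (D : ℝ≥0) : Prop where
  ball_ne_zero : ∀ x r, 0 < r → μ (ball x r) ≠ 0
  ball_ne_top : ∀ x r, μ (ball x r) ≠ ∞
  ball_le : ∀ x r, 0 < r → μ (ball x (6 * r)) ≤ D * critPsi ρ κ x r * μ (ball x r)

/-- Weak type (1,1) by Vitali. On a selected ball the average of `g` exceeds `t Ψ_κ`, and this `Ψ_κ`
pays exactly for the loss in the doubling inequality. Radii are first bounded by `N`, as Vitali
requires; then `N` tends to infinity. -/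
theorem CritDoubling.mul_measure_le (hρ : ∀ x, 0 < ρ x) {κ : ℝ} {D : ℝ≥0}
    (hμ : CritDoubling μ ρ κ D) (g : Eucl n → ℝ≥0∞) (t : ℝ≥0∞) :
    t * μ {x | t < critMaximalOf μ ρ κ g x} ≤ D * ∫⁻ x, g x ∂μ := by
  let S : ℕ → Set (Eucl n × ℝ) := fun N => {a | 0 < a.2 ∧ a.2 ≤ N ∧
    t < (critPsi ρ κ a.1 a.2)⁻¹ * ⨍⁻ y in ball a.1 a.2, g y ∂μ}
  let E : ℕ → Set (Eucl n) := fun N => ⋃ a ∈ S N, ball a.1 a.2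
  have hE : {x | t < critMaximalOf μ ρ κ g x} = ⋃ N, E N := by
    ext x
    simp only [Set.mem_ofPred_eq, lt_critMaximalOf, Set.mem_iUnion, E, S]
    constructor
    · rintro ⟨x₀, r, hr, hx, h⟩
      obtain ⟨N, hN⟩ := exists_nat_ge r
      exact ⟨N, (x₀, r), ⟨hr, hN, h⟩, hx⟩
    · rintro ⟨N, a, ⟨hr, -, h⟩, hx⟩
      exact ⟨a.1, a.2, hr, hx, h⟩
  have hmono : Monotone E := by
    intro N N' hN
    refine Set.biUnion_subset_biUnion_left fun a ha => ⟨ha.1, ha.2.1.trans ?_, ha.2.2⟩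
    exact_mod_cast hN
  rw [hE, hmono.measure_iUnion, ENNReal.mul_iSup]
  refine iSup_le fun N => ?_
  obtain ⟨u, hu, huc, hd, hcov⟩ := exists_countable_disjoint_cover (S N) N
    fun a ha => ⟨ha.1, ha.2.1⟩
  have hsub : E N ⊆ ⋃ b ∈ u, ball b.1 (6 * b.2) := by
    refine Set.iUnion₂_subset fun a ha => ?_
    obtain ⟨b, hb, hab⟩ := hcov a ha
    exact hab.trans (Set.subset_biUnion_of_mem (u := fun b : Eucl n × ℝ => ball b.1 (6 * b.2)) hb)
  have hone : ∀ b ∈ u, t * μ (ball b.1 (6 * b.2)) ≤ D * ∫⁻ y in ball b.1 b.2, g y ∂μ := by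
    intro b hb
    obtain ⟨hr, -, h⟩ := hu hb
    have hψ0 := critPsi_ne_zero hρ κ b.1 hr.le
    have hψt := critPsi_ne_top (ρ := ρ) κ b.1 b.2
    have hb0 := hμ.ball_ne_zero b.1 b.2 hr
    have hbt := hμ.ball_ne_top b.1 b.2
    rw [setLAverage_eq] at h
    calc t * μ (ball b.1 (6 * b.2))
        ≤ ((critPsi ρ κ b.1 b.2)⁻¹ * ((∫⁻ y in ball b.1 b.2, g y ∂μ) / μ (ball b.1 b.2))) *
          (D * critPsi ρ κ b.1 b.2 * μ (ball b.1 b.2)) := by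
          gcongr
          exact hμ.ball_le b.1 b.2 hr
      _ = D * ((critPsi ρ κ b.1 b.2)⁻¹ * critPsi ρ κ b.1 b.2) *
          ((∫⁻ y in ball b.1 b.2, g y ∂μ) / μ (ball b.1 b.2) * μ (ball b.1 b.2)) := by ring
      _ = _ := by
          rw [ENNReal.inv_mul_cancel hψ0 hψt, ENNReal.div_mul_cancel hb0 hbt, mul_one]
  calc t * μ (E N) ≤ t * ∑' b : u, μ (ball b.1.1 (6 * b.1.2)) := by
        gcongr
        exact (measure_mono hsub).trans (measure_biUnion_le μ huc _)
    _ = ∑' b : u, t * μ (ball b.1.1 (6 * b.1.2)) := by rw [ENNReal.tsum_mul_left]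
    _ ≤ ∑' b : u, D * ∫⁻ y in ball b.1.1 b.1.2, g y ∂μ := ENNReal.tsum_le_tsum fun b => hone b b.2
    _ = D * ∫⁻ y in ⋃ b ∈ u, ball b.1 b.2, g y ∂μ := by
        rw [ENNReal.tsum_mul_left, lintegral_biUnion huc (fun _ _ => measurableSet_ball) hd]
    _ ≤ _ := by
        gcongr
        exact Measure.restrict_le_self

/-- Splitting of a function at half the level. -/
theorem critMaximalOf_le_add (hρ : ∀ x, 0 < ρ x) {θ : ℝ} (hθ : 0 ≤ θ) {g : Eucl n → ℝ≥0∞}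
    (hg : Measurable g) (t : ℝ≥0∞) (x : Eucl n) :
    critMaximalOf μ ρ θ g x ≤ critMaximalOf μ ρ θ ({y | t < g y}.indicator g) x + t := by
  have hm : MeasurableSet {y | t < g y} := measurableSet_lt measurable_const hg
  refine critMaximalOf_le fun x₀ r hr hx => ?_
  have h1 : ⨍⁻ y in ball x₀ r, g y ∂μ ≤
      (⨍⁻ y in ball x₀ r, {y | t < g y}.indicator g y ∂μ) + t := by
    calc ⨍⁻ y in ball x₀ r, g y ∂μ ≤ ⨍⁻ y in ball x₀ r, ({y | t < g y}.indicator g y + t) ∂μ := by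
          refine lintegral_mono fun y => ?_
          by_cases h : t < g y
          · simp [h]
          · simp only [Set.indicator_apply, Set.mem_ofPred_eq, h, if_false, zero_add]
            exact not_lt.1 h
      _ = (⨍⁻ y in ball x₀ r, {y | t < g y}.indicator g y ∂μ) + ⨍⁻ y in ball x₀ r, t ∂μ :=
          lintegral_add_left (hg.indicator hm) _
      _ ≤ _ := by
          gcongr
          rw [setLAverage_eq, setLIntegral_const]
          exact ENNReal.div_le_of_le_mul le_rfl
  calc (critPsi ρ θ x₀ r)⁻¹ * ⨍⁻ y in ball x₀ r, g y ∂μ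
      ≤ (critPsi ρ θ x₀ r)⁻¹ * ((⨍⁻ y in ball x₀ r, {y | t < g y}.indicator g y ∂μ) + t) := by
        gcongr
    _ ≤ _ := by
        rw [mul_add]
        gcongr
        · exact le_critMaximalOf θ _ hr hx
        · exact (mul_le_mul_left (critPsi_inv_le_one hρ hθ x₀ hr.le) t).trans (one_mul t).le

/-- The maximal function of a doubling measure is bounded on `L^P`, for `1 < P < ∞`. -/
theorem CritDoubling.lintegral_rpow_le (hρ : ∀ x, 0 < ρ x) {κ : ℝ} (hκ : 0 ≤ κ) {D : ℝ≥0}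
    (hμ : CritDoubling μ ρ κ D) {P : ℝ} (hP : 1 < P) :
    ∃ C : ℝ≥0, ∀ g : Eucl n → ℝ≥0∞, Measurable g →
      ∫⁻ x, critMaximalOf μ ρ κ g x ^ P ∂μ ≤ C * ∫⁻ x, g x ^ P ∂μ := by
  have hP0 : 0 < P := by linarith
  have hP1 : 0 < P - 1 := by linarith
  obtain ⟨C, hC⟩ := tsum_dyad_lt_le (P - 1) hP1
  refine ⟨(2 ^ P * (2 * D * 2 ^ (P - 1) * C)), fun g hg => ?_⟩
  -- Marcinkiewicz interpolation at dyadic levels: the weak type bound is applied to the part of `g`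
  -- above half the level. For fixed `x` the sum over `k` is then geometric and yields `g x ^ (P -
  -- 1)`.
  have hlev : ∀ k : ℤ, dyad k ^ P * μ {x | dyad k < critMaximalOf μ ρ κ g x} ≤
      2 * D * 2 ^ (P - 1) *
        ∫⁻ x, (if dyad (k - 1) < g x then dyad (k - 1) ^ (P - 1) else 0) * g x ∂μ := by
    intro k
    have hk : dyad k = 2 * dyad (k - 1) := by
      rw [← dyad_one, ← dyad_add]
      congr 1
      ring
    have hsub : {x | dyad k < critMaximalOf μ ρ κ g x} ⊆
        {x | dyad (k - 1) < critMaximalOf μ ρ κ ({y | dyad (k - 1) < g y}.indicator g) x} := by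
      intro x hx
      rw [Set.mem_ofPred_eq] at hx
      have h1 := hx.trans_le (critMaximalOf_le_add hρ hκ hg (dyad (k - 1)) x)
      rw [hk, two_mul] at h1
      exact lt_of_add_lt_add_right h1
    have hm : MeasurableSet {y | dyad (k - 1) < g y} := measurableSet_lt measurable_const hg
    calc dyad k ^ P * μ {x | dyad k < critMaximalOf μ ρ κ g x}
        ≤ dyad k ^ P * μ {x | dyad (k - 1) < critMaximalOf μ ρ κ
          ({y | dyad (k - 1) < g y}.indicator g) x} := by gcongr
      _ = 2 * 2 ^ (P - 1) * dyad (k - 1) ^ (P - 1) * (dyad (k - 1) * μ {x | dyad (k - 1) <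
          critMaximalOf μ ρ κ ({y | dyad (k - 1) < g y}.indicator g) x}) := by
          have h2 : ∀ a : ℝ≥0∞, a ≠ 0 → a ≠ ∞ → a ^ P = a ^ (P - 1) * a := by
            intro a h0 ht
            conv_rhs => rw [← ENNReal.rpow_one a, ← ENNReal.rpow_mul, one_mul]
            rw [← ENNReal.rpow_add _ _ h0 ht, sub_add_cancel]
          rw [h2 _ (dyad_ne_zero k) (dyad_ne_top k), hk, ENNReal.mul_rpow_of_nonneg _ _ hP1.le]
          ring
      _ ≤ 2 * 2 ^ (P - 1) * dyad (k - 1) ^ (P - 1) * (D * ∫⁻ x,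
          {y | dyad (k - 1) < g y}.indicator g x ∂μ) := by
          exact mul_le_mul' le_rfl (hμ.mul_measure_le hρ _ _)
      _ = 2 * D * 2 ^ (P - 1) * (dyad (k - 1) ^ (P - 1) * ∫⁻ x,
          {y | dyad (k - 1) < g y}.indicator g x ∂μ) := by ring
      _ = _ := by
          congr 1
          rw [← lintegral_const_mul _ (hg.indicator hm)]
          refine lintegral_congr fun x => ?_
          by_cases h : dyad (k - 1) < g x <;> simp [h]
  calc ∫⁻ x, critMaximalOf μ ρ κ g x ^ P ∂μ
      ≤ 2 ^ P * ∑' k : ℤ, dyad k ^ P * μ {x | dyad k < critMaximalOf μ ρ κ g x} :=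
        lintegral_rpow_le_tsum (measurable_critMaximalOf κ g) hP0
    _ ≤ 2 ^ P * ∑' k : ℤ, 2 * D * 2 ^ (P - 1) *
        ∫⁻ x, (if dyad (k - 1) < g x then dyad (k - 1) ^ (P - 1) else 0) * g x ∂μ := by
        exact mul_le_mul' le_rfl (ENNReal.tsum_le_tsum hlev)
    _ = 2 ^ P * (2 * D * 2 ^ (P - 1) *
        ∫⁻ x, (∑' k : ℤ, if dyad k < g x then dyad k ^ (P - 1) else 0) * g x ∂μ) := by
        rw [ENNReal.tsum_mul_left]
        congr 2
        refine ((Equiv.subRight (1 : ℤ)).tsum_eq (fun k : ℤ =>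
          ∫⁻ x, (if dyad k < g x then dyad k ^ (P - 1) else 0) * g x ∂μ)).trans ?_
        rw [← lintegral_tsum]
        · simp_rw [ENNReal.tsum_mul_right]
        · intro k
          exact ((Measurable.ite (measurableSet_lt measurable_const hg) measurable_const
            measurable_const).mul hg).aemeasurable
    _ ≤ 2 ^ P * (2 * D * 2 ^ (P - 1) * ∫⁻ x, C * g x ^ P ∂μ) := by
        refine mul_le_mul' le_rfl (mul_le_mul' le_rfl (lintegral_mono fun x => ?_))
        calc (∑' k : ℤ, if dyad k < g x then dyad k ^ (P - 1) else 0) * g x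
            ≤ C * g x ^ (P - 1) * g x := by
              gcongr
              exact hC _
          _ = C * g x ^ P := by
              rcases eq_or_ne (g x) 0 with h | h
              · simp [h, hP0]
              rcases eq_or_ne (g x) ∞ with h' | h'
              · rw [h', ENNReal.top_rpow_of_pos hP1, ENNReal.top_rpow_of_pos hP0, mul_assoc,
                  ENNReal.top_mul_top]
              rw [mul_assoc]
              congr 1
              conv_lhs => rw [← ENNReal.rpow_one (g x), ← ENNReal.rpow_mul, one_mul]
              rw [← ENNReal.rpow_add _ _ h h', sub_add_cancel]
    _ = _ := by
        rw [lintegral_const_mul' _ _ ENNReal.coe_ne_top]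
        push_cast
        rw [ENNReal.coe_rpow_of_nonneg _ hP0.le, ENNReal.coe_rpow_of_nonneg _ hP1.le]
        push_cast
        ring

theorem critDoubling_volume (hρ : ∀ x, 0 < ρ x) {κ : ℝ} (hκ : 0 ≤ κ) :
    CritDoubling (volume : Measure (Eucl n)) ρ κ (6 ^ n) where
  ball_ne_zero x r hr := volume_ball_pos x hr
  ball_ne_top x r := volume_ball_ne_top x r
  ball_le x r hr := by
    rw [volume_ball_mul x x (by norm_num : (0 : ℝ) < 6)]
    gcongr
    rw [ENNReal.ofReal_pow (by norm_num)]
    have : ENNReal.ofReal 6 = 6 := by simp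
    rw [this]
    push_cast
    exact le_mul_of_one_le_right zero_le (one_le_critPsi hρ hκ x hr.le)

end Maximal

/-! ### Muckenhoupt weights and the weighted maximal theorem. -/

section Weights

variable {n : ℕ} {ρ : Eucl n → ℝ}

/-- A weight `w` and its dual weight `σ = w ^ (-1/(P-1))` satisfying the `A_P^{ρ,θ}` condition, in a
form which is symmetric in `(w, P)` and `(σ, P')`. -/
structure CritMuckenhoupt (ρ : Eucl n → ℝ) (θ P P' : ℝ) (C : ℝ≥0) (w σ : Eucl n → ℝ≥0∞) :
    Prop where
  conj : P.HolderConjugate P'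
  nonneg : 0 ≤ θ
  measurable : Measurable w
  measurable_dual : Measurable σ
  mul_eq_one : ∀ x, w x ^ (1 / P) * σ x ^ (1 / P') = 1
  lintegral_ne_top : ∀ x r, ∫⁻ y in ball x r, w y ≠ ∞
  lintegral_dual_ne_top : ∀ x r, ∫⁻ y in ball x r, σ y ≠ ∞
  le : ∀ x r, 0 < r → (∫⁻ y in ball x r, w y) ^ (1 / P) * (∫⁻ y in ball x r, σ y) ^ (1 / P') ≤
    C * critPsi ρ θ x r * volume (ball x r)

namespace CritMuckenhoupt

variable {θ P P' : ℝ} {C : ℝ≥0} {w σ : Eucl n → ℝ≥0∞}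

theorem symm (h : CritMuckenhoupt ρ θ P P' C w σ) : CritMuckenhoupt ρ θ P' P C σ w where
  conj := h.conj.symm
  nonneg := h.nonneg
  measurable := h.measurable_dual
  measurable_dual := h.measurable
  mul_eq_one x := by rw [mul_comm, h.mul_eq_one x]
  lintegral_ne_top := h.lintegral_dual_ne_top
  lintegral_dual_ne_top := h.lintegral_ne_top
  le x r hr := by rw [mul_comm]; exact h.le x r hr

theorem ne_zero (h : CritMuckenhoupt ρ θ P P' C w σ) (x : Eucl n) : w x ≠ 0 := by
  intro h0
  have := h.mul_eq_one x
  rw [h0, ENNReal.zero_rpow_of_pos (one_div_pos.2 h.conj.pos), zero_mul] at this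
  exact zero_ne_one this

theorem ne_top (h : CritMuckenhoupt ρ θ P P' C w σ) (x : Eucl n) : w x ≠ ∞ := by
  intro h0
  have := h.mul_eq_one x
  rw [h0, ENNReal.top_rpow_of_pos (one_div_pos.2 h.conj.pos), ENNReal.top_mul] at this
  · exact ENNReal.top_ne_one this
  · exact (ENNReal.rpow_pos (pos_iff_ne_zero.2 (h.symm.ne_zero x))
      (by
        intro h1
        have := h.mul_eq_one x
        rw [h0, h1, ENNReal.top_rpow_of_pos (one_div_pos.2 h.conj.pos),
          ENNReal.top_rpow_of_pos (one_div_pos.2 h.conj.symm.pos), ENNReal.top_mul_top] at this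
        exact ENNReal.top_ne_one this)).ne'

theorem mul_rpow_eq_one (h : CritMuckenhoupt ρ θ P P' C w σ) (x : Eucl n) :
    w x * σ x ^ (P - 1) = 1 := by
  have hP := h.conj.pos
  have h1 := congrArg (· ^ P) (h.mul_eq_one x)
  simp only [ENNReal.one_rpow] at h1
  rw [ENNReal.mul_rpow_of_nonneg _ _ hP.le, ← ENNReal.rpow_mul, ← ENNReal.rpow_mul,
    one_div_mul_cancel hP.ne', ENNReal.rpow_one, one_div, inv_mul_eq_div,
    h.conj.div_conj_eq_sub_one] at h1
  exact h1

theorem withDensity_ball (w : Eucl n → ℝ≥0∞) (x : Eucl n) (r : ℝ) :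
    volume.withDensity w (ball x r) = ∫⁻ y in ball x r, w y :=
  withDensity_apply _ measurableSet_ball

/-- Hölder's inequality for the factorization `1 = w^(1/P) σ^(1/P')`. -/
theorem volume_le (h : CritMuckenhoupt ρ θ P P' C w σ) {E : Set (Eucl n)} (hE : MeasurableSet E) :
    volume E ≤ volume.withDensity w E ^ (1 / P) * volume.withDensity σ E ^ (1 / P') := by
  have hP := h.conj.pos
  have hP' := h.conj.symm.pos
  rw [withDensity_apply _ hE, withDensity_apply _ hE]
  have := ENNReal.lintegral_mul_le_Lp_mul_Lq (volume.restrict E) h.conj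
    (h.measurable.pow_const (1 / P)).aemeasurable (h.measurable_dual.pow_const (1 / P')).aemeasurable
  simp only [Pi.mul_apply, h.mul_eq_one, ← ENNReal.rpow_mul, one_div_mul_cancel hP.ne',
    one_div_mul_cancel hP'.ne', ENNReal.rpow_one, lintegral_const, one_mul,
    Measure.restrict_apply_univ] at this
  exact this

theorem ball_ne_zero (h : CritMuckenhoupt ρ θ P P' C w σ) (x : Eucl n) {r : ℝ} (hr : 0 < r) :
    volume.withDensity w (ball x r) ≠ 0 := by
  intro h0
  have h1 := h.volume_le (measurableSet_ball (x := x) (ε := r))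
  rw [h0, ENNReal.zero_rpow_of_pos (one_div_pos.2 h.conj.pos), zero_mul] at h1
  exact volume_ball_pos x hr (le_antisymm h1 zero_le)

theorem ball_ne_top (h : CritMuckenhoupt ρ θ P P' C w σ) (x : Eucl n) (r : ℝ) :
    volume.withDensity w (ball x r) ≠ ∞ := by
  rw [withDensity_ball]
  exact h.lintegral_ne_top x r

/-- `volume_le` bounds `|E|` by the masses `w(E)` and `σ(B)`, and the `A_P` condition trades `σ(B)`
for `w(B)`. -/
theorem volume_rpow_mul_le (h : CritMuckenhoupt ρ θ P P' C w σ) {E : Set (Eucl n)}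
    (hE : MeasurableSet E) {x : Eucl n} {r : ℝ} (hr : 0 < r) (hEB : E ⊆ ball x r) :
    volume E ^ P * volume.withDensity w (ball x r) ≤
      (C * critPsi ρ θ x r * volume (ball x r)) ^ P * volume.withDensity w E := by
  have hP := h.conj.pos
  have hP' := h.conj.symm.pos
  have h1 : volume E * volume.withDensity w (ball x r) ^ (1 / P) ≤
      (C * critPsi ρ θ x r * volume (ball x r)) * volume.withDensity w E ^ (1 / P) := by
    calc volume E * volume.withDensity w (ball x r) ^ (1 / P)
        ≤ (volume.withDensity w E ^ (1 / P) * volume.withDensity σ (ball x r) ^ (1 / P')) *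
          volume.withDensity w (ball x r) ^ (1 / P) := by
          gcongr
          refine (h.volume_le hE).trans ?_
          gcongr
      _ = (volume.withDensity w (ball x r) ^ (1 / P) *
          volume.withDensity σ (ball x r) ^ (1 / P')) * volume.withDensity w E ^ (1 / P) := by ring
      _ ≤ _ := by
          rw [withDensity_ball, withDensity_ball]
          exact mul_le_mul' (h.le x r hr) le_rfl
  have h2 := ENNReal.rpow_le_rpow h1 hP.le
  rwa [ENNReal.mul_rpow_of_nonneg _ _ hP.le, ENNReal.mul_rpow_of_nonneg _ _ hP.le,
    ← ENNReal.rpow_mul, ← ENNReal.rpow_mul, one_div_mul_cancel hP.ne', ENNReal.rpow_one,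
    ENNReal.rpow_one] at h2

/-- The previous comparison for `B(x, r)` inside `B(x, 6r)`; its factor `Ψ_θ^P` is `Ψ_{θP}`, which
fixes the exponent. -/
theorem critDoubling (hρ : ∀ x, 0 < ρ x) (h : CritMuckenhoupt ρ θ P P' C w σ) :
    ∃ D : ℝ≥0, CritDoubling (volume.withDensity w) ρ (θ * P) D := by
  have hP := h.conj.pos
  let K : ℝ≥0∞ := (C * ENNReal.ofReal (6 ^ θ) * ENNReal.ofReal (6 ^ n)) ^ P
  have hK : K ≠ ∞ := ENNReal.rpow_ne_top_of_nonneg hP.le (by finiteness)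
  refine ⟨K.toNNReal, fun x r hr => h.ball_ne_zero x hr, fun x r => h.ball_ne_top x r,
    fun x r hr => ?_⟩
  rw [ENNReal.coe_toNNReal hK, ← critPsi_rpow hρ θ x hr.le]
  have hV0 := volume_ball_pos x hr
  have hVt := volume_ball_ne_top x r
  have h1 := h.volume_rpow_mul_le measurableSet_ball (by linarith : 0 < 6 * r)
    (ball_subset_ball (x := x) (by linarith : r ≤ 6 * r))
  have h2 : (C * critPsi ρ θ x (6 * r) * volume (ball x (6 * r))) ^ P ≤
      volume (ball x r) ^ P * (K * critPsi ρ θ x r ^ P) := by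
    rw [← ENNReal.mul_rpow_of_nonneg _ _ hP.le, ← ENNReal.mul_rpow_of_nonneg _ _ hP.le,
      volume_ball_mul x x (by norm_num : (0 : ℝ) < 6)]
    refine ENNReal.rpow_le_rpow ?_ hP.le
    calc C * critPsi ρ θ x (6 * r) * (ENNReal.ofReal (6 ^ n) * volume (ball x r))
        ≤ C * (ENNReal.ofReal (6 ^ θ) * critPsi ρ θ x r) *
          (ENNReal.ofReal (6 ^ n) * volume (ball x r)) := by
          gcongr
          exact critPsi_mul_le hρ h.nonneg (by norm_num) x hr.le
      _ = _ := by ring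
  have h3 : volume (ball x r) ^ P * volume.withDensity w (ball x (6 * r)) ≤
      volume (ball x r) ^ P * (K * critPsi ρ θ x r ^ P * volume.withDensity w (ball x r)) := by
    refine h1.trans ?_
    rw [← mul_assoc]
    gcongr
  exact (ENNReal.mul_le_mul_iff_right (ENNReal.rpow_pos (pos_iff_ne_zero.2 hV0) hVt).ne'
    (ENNReal.rpow_ne_top_of_nonneg hP.le hVt)).1 h3

/-- Since `w σ^(P-1) = 1`, the map `g ↦ g / σ` is an isometry from `L^P(w)` to `L^P(σ)`. -/
theorem div_rpow_mul (h : CritMuckenhoupt ρ θ P P' C w σ) (x : Eucl n) (a : ℝ≥0∞) :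
    σ x * (a / σ x) ^ P = w x * a ^ P := by
  have hw0 := h.symm.ne_zero x
  have hwt := h.symm.ne_top x
  have h1 := h.mul_rpow_eq_one x
  have hP := h.conj.pos
  rw [ENNReal.div_rpow_of_nonneg _ _ hP.le, div_eq_mul_inv, mul_left_comm, mul_comm (w x)]
  congr 1
  have h2 : σ x ^ P = σ x ^ (P - 1) * σ x := by
    conv_rhs => rw [← ENNReal.rpow_one (σ x), ← ENNReal.rpow_mul, one_mul]
    rw [← ENNReal.rpow_add _ _ hw0 hwt, sub_add_cancel]
  have h3 : w x * σ x ^ P = σ x := by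
    rw [h2, ← mul_assoc, h1, one_mul]
  have h4 : σ x ^ P ≠ 0 := (ENNReal.rpow_pos (pos_iff_ne_zero.2 hw0) hwt).ne'
  have h5 : σ x ^ P ≠ ∞ := ENNReal.rpow_ne_top_of_nonneg hP.le hwt
  rw [← div_eq_mul_inv]
  nth_rewrite 1 [← h3]
  exact ENNReal.mul_div_cancel_right h4 h5

/-- Dual form, by `(P - 1) P' = P`: the map `g ↦ g^(P-1) / w` carries `∫ g^P σ` to the integral of
the `P'`-th power against `w`. -/
theorem dual_rpow_mul (h : CritMuckenhoupt ρ θ P P' C w σ) (x : Eucl n) (a : ℝ≥0∞) :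
    w x * (a ^ (P - 1) / w x) ^ P' = σ x * a ^ P := by
  rw [h.symm.div_rpow_mul, ← ENNReal.rpow_mul, h.conj.sub_one_mul_conj]

theorem setLIntegral_le_mul_critMaximalOf {μ : Measure (Eucl n)} (hρ : ∀ x, 0 < ρ x) (κ : ℝ)
    (g : Eucl n → ℝ≥0∞) {x x₀ : Eucl n} {r : ℝ} (hr : 0 < r) (hx : x ∈ ball x₀ r)
    (h0 : μ (ball x₀ r) ≠ 0) (ht : μ (ball x₀ r) ≠ ∞) :
    ∫⁻ y in ball x₀ r, g y ∂μ ≤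
      critPsi ρ κ x₀ r * μ (ball x₀ r) * critMaximalOf μ ρ κ g x := by
  have h1 := le_critMaximalOf (ρ := ρ) (μ := μ) κ g hr hx
  have hψ0 := critPsi_ne_zero hρ κ x₀ hr.le
  have hψt := critPsi_ne_top (ρ := ρ) κ x₀ r
  rw [setLAverage_eq] at h1
  calc ∫⁻ y in ball x₀ r, g y ∂μ
      = (critPsi ρ κ x₀ r * (critPsi ρ κ x₀ r)⁻¹) *
        ((∫⁻ y in ball x₀ r, g y ∂μ) / μ (ball x₀ r) * μ (ball x₀ r)) := by
        rw [ENNReal.mul_inv_cancel hψ0 hψt, ENNReal.div_mul_cancel h0 ht, one_mul]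
    _ = critPsi ρ κ x₀ r * μ (ball x₀ r) *
        ((critPsi ρ κ x₀ r)⁻¹ * ((∫⁻ y in ball x₀ r, g y ∂μ) / μ (ball x₀ r))) := by ring
    _ ≤ _ := by gcongr

/-- The maximal function is dominated by a composition of the maximal functions of the measures
`w dx` and `σ dx`. -/
theorem critMaximal_rpow_le (hρ : ∀ x, 0 < ρ x) (h : CritMuckenhoupt ρ θ P P' C w σ) {θ₁ : ℝ}
    (hθ₁ : 3 * (θ * P) ≤ θ₁ * (P - 1)) {g : Eucl n → ℝ≥0∞} (hg : Measurable g) (x : Eucl n) :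
    critMaximal ρ θ₁ g x ^ (P - 1) ≤ (C : ℝ≥0∞) ^ P *
      critMaximalOf (volume.withDensity w) ρ (θ * P) (fun y =>
        critMaximalOf (volume.withDensity σ) ρ (θ * P') (fun z => g z / σ z) y ^ (P - 1) / w y)
        x := by
  have hP := h.conj.pos
  have hP1 := h.conj.sub_one_pos
  set M := critMaximalOf (volume.withDensity σ) ρ (θ * P') (fun z => g z / σ z) with hM
  set H : Eucl n → ℝ≥0∞ := fun y => M y ^ (P - 1) / w y with hH
  set N := critMaximalOf (volume.withDensity w) ρ (θ * P) H with hN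
  have hMm : Measurable M := measurable_critMaximalOf _ _
  have hHm : Measurable H := (hMm.pow_const _).div h.measurable
  suffices hs : critMaximal ρ θ₁ g x ≤ ((C : ℝ≥0∞) ^ P * N x) ^ (1 / (P - 1)) by
    have := ENNReal.rpow_le_rpow hs hP1.le
    rwa [← ENNReal.rpow_mul, one_div_mul_cancel hP1.ne', ENNReal.rpow_one] at this
  refine critMaximalOf_le fun x₀ r hr hx => ?_
  have hσ0 := h.symm.ball_ne_zero x₀ hr
  have hσt := h.symm.ball_ne_top x₀ r
  have hw0 := h.ball_ne_zero x₀ hr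
  have hwt := h.ball_ne_top x₀ r
  have hV0 := volume_ball_pos x₀ hr
  have hVt := volume_ball_ne_top x₀ r
  set B := ball x₀ r with hB
  set I := ∫⁻ y in B, g y with hI
  -- The integral of `g` over `B` is the `σ`-integral of `g / σ`, so it is bounded through `M y` at
  -- every point `y` of `B`. This permits averaging in `y`.
  have h1 : ∀ y ∈ B, I ≤ critPsi ρ (θ * P') x₀ r * volume.withDensity σ B * M y := by
    intro y hy
    have h2 := setLIntegral_le_mul_critMaximalOf hρ (θ * P') (fun z => g z / σ z) hr hy hσ0 hσt
    refine le_trans (le_of_eq ?_) h2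
    have h3 := setLIntegral_withDensity_eq_setLIntegral_mul volume h.measurable_dual
      (g := fun z => g z / σ z) (hg.div h.measurable_dual) (s := ball x₀ r) measurableSet_ball
    rw [h3]
    refine lintegral_congr fun z => ?_
    rw [Pi.mul_apply, ENNReal.mul_div_cancel (h.symm.ne_zero z) (h.symm.ne_top z)]
  -- The constant `I^(P-1)` is integrated over `B`, and Lebesgue measure is written as `w⁻¹ · w dx`,
  -- so that the average of `H` against `w` appears.
  have h2 : I ^ (P - 1) * volume B ≤ (critPsi ρ (θ * P') x₀ r * volume.withDensity σ B) ^ (P - 1) *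
      (critPsi ρ (θ * P) x₀ r * volume.withDensity w B * N x) := by
    calc I ^ (P - 1) * volume B = ∫⁻ y in B, I ^ (P - 1) := by rw [setLIntegral_const]
      _ ≤ ∫⁻ y in B, (critPsi ρ (θ * P') x₀ r * volume.withDensity σ B) ^ (P - 1) *
          (w y * H y) := by
          refine setLIntegral_mono ((h.measurable.mul hHm).const_mul _) fun y hy => ?_
          rw [hH, ENNReal.mul_div_cancel (h.ne_zero y) (h.ne_top y),
            ← ENNReal.mul_rpow_of_nonneg _ _ hP1.le]
          exact ENNReal.rpow_le_rpow (h1 y hy) hP1.le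
      _ = (critPsi ρ (θ * P') x₀ r * volume.withDensity σ B) ^ (P - 1) *
          ∫⁻ y in B, H y ∂(volume.withDensity w) := by
          rw [setLIntegral_withDensity_eq_setLIntegral_mul _ h.measurable hHm measurableSet_ball]
          exact lintegral_const_mul _ (h.measurable.mul hHm)
      _ ≤ _ := by
          gcongr
          exact setLIntegral_le_mul_critMaximalOf hρ (θ * P) H hr hx hw0 hwt
  have hAP : volume.withDensity w B * volume.withDensity σ B ^ (P - 1) ≤
      (C : ℝ≥0∞) ^ P * critPsi ρ (θ * P) x₀ r * volume B ^ P := by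
    have h3 := ENNReal.rpow_le_rpow (h.le x₀ r hr) hP.le
    rw [ENNReal.mul_rpow_of_nonneg _ _ hP.le, ENNReal.mul_rpow_of_nonneg _ _ hP.le,
      ENNReal.mul_rpow_of_nonneg _ _ hP.le, ← ENNReal.rpow_mul, ← ENNReal.rpow_mul,
      one_div_mul_cancel hP.ne', ENNReal.rpow_one, one_div, inv_mul_eq_div,
      h.conj.div_conj_eq_sub_one, critPsi_rpow hρ _ _ hr.le, ← withDensity_ball,
      ← withDensity_ball] at h3
    exact h3
  have hexp : θ * P' * (P - 1) = θ * P := by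
    rw [mul_assoc, mul_comm P', h.conj.sub_one_mul_conj]
  -- One factor `Ψ_{θP}` comes from each of `M`, `N` and the `A_P` condition. This is the origin of
  -- the 3 in `hθ₁`.
  have hΨ : critPsi ρ (θ * P) x₀ r * critPsi ρ (θ * P) x₀ r * critPsi ρ (θ * P) x₀ r ≤
      critPsi ρ θ₁ x₀ r ^ (P - 1) := by
    rw [← critPsi_add hρ _ _ _ hr.le, ← critPsi_add hρ _ _ _ hr.le, critPsi_rpow hρ _ _ hr.le]
    refine critPsi_mono hρ ?_ x₀ hr.le
    linarith
  have hψ0 := critPsi_ne_zero hρ θ₁ x₀ hr.le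
  have hψt := critPsi_ne_top (ρ := ρ) θ₁ x₀ r
  have hVP : volume B ^ P = volume B ^ (P - 1) * volume B := by
    conv_rhs => rw [← ENNReal.rpow_one (volume B), ← ENNReal.rpow_mul, one_mul]
    rw [← ENNReal.rpow_add _ _ hV0 hVt, sub_add_cancel]
  have h4 : I ^ (P - 1) * volume B ≤
      (critPsi ρ θ₁ x₀ r * volume B) ^ (P - 1) * ((C : ℝ≥0∞) ^ P * N x) * volume B := by
    refine h2.trans ?_
    rw [ENNReal.mul_rpow_of_nonneg _ _ hP1.le, critPsi_rpow hρ _ _ hr.le, hexp]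
    calc critPsi ρ (θ * P) x₀ r * volume.withDensity σ B ^ (P - 1) *
          (critPsi ρ (θ * P) x₀ r * volume.withDensity w B * N x)
        = critPsi ρ (θ * P) x₀ r * critPsi ρ (θ * P) x₀ r *
          (volume.withDensity w B * volume.withDensity σ B ^ (P - 1)) * N x := by ring
      _ ≤ critPsi ρ (θ * P) x₀ r * critPsi ρ (θ * P) x₀ r *
          ((C : ℝ≥0∞) ^ P * critPsi ρ (θ * P) x₀ r * volume B ^ P) * N x := by gcongr
      _ = (critPsi ρ (θ * P) x₀ r * critPsi ρ (θ * P) x₀ r * critPsi ρ (θ * P) x₀ r) *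
          ((C : ℝ≥0∞) ^ P * volume B ^ P) * N x := by ring
      _ ≤ critPsi ρ θ₁ x₀ r ^ (P - 1) * ((C : ℝ≥0∞) ^ P * volume B ^ P) * N x := by gcongr
      _ = _ := by
          rw [ENNReal.mul_rpow_of_nonneg _ _ hP1.le, hVP]
          ring
  have h5 := (ENNReal.mul_le_mul_iff_left hV0 hVt).1 h4
  have h6 := ENNReal.rpow_le_rpow h5 (one_div_pos.2 hP1).le
  rw [ENNReal.mul_rpow_of_nonneg _ _ (one_div_pos.2 hP1).le, ← ENNReal.rpow_mul, ← ENNReal.rpow_mul,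
    mul_one_div_cancel hP1.ne', ENNReal.rpow_one, ENNReal.rpow_one] at h6
  rw [setLAverage_eq, ← hI, mul_comm, ← div_eq_mul_inv]
  refine ENNReal.div_le_of_le_mul (ENNReal.div_le_of_le_mul ?_)
  refine h6.trans (le_of_eq ?_)
  ring

/-- The maximal function is bounded on `L^P(w)`. -/
theorem lintegral_critMaximal_rpow_le (hρ : ∀ x, 0 < ρ x) (h : CritMuckenhoupt ρ θ P P' C w σ)
    {θ₁ : ℝ} (hθ₁ : 3 * (θ * P) ≤ θ₁ * (P - 1)) :
    ∃ K : ℝ≥0, ∀ g : Eucl n → ℝ≥0∞, Measurable g →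
      ∫⁻ x, critMaximal ρ θ₁ g x ^ P ∂(volume.withDensity w) ≤
        K * ∫⁻ x, g x ^ P ∂(volume.withDensity w) := by
  have hP := h.conj.pos
  have hP' := h.conj.symm.pos
  obtain ⟨D, hD⟩ := h.critDoubling hρ
  obtain ⟨D', hD'⟩ := h.symm.critDoubling hρ
  obtain ⟨K, hK⟩ := hD.lintegral_rpow_le hρ (mul_nonneg h.nonneg hP.le) h.conj.symm.lt
  obtain ⟨K', hK'⟩ := hD'.lintegral_rpow_le hρ (mul_nonneg h.nonneg hP'.le) h.conj.lt
  refine ⟨(C ^ P) ^ P' * (K * K'), fun g hg => ?_⟩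
  set M := critMaximalOf (volume.withDensity σ) ρ (θ * P') (fun z => g z / σ z) with hM
  set H : Eucl n → ℝ≥0∞ := fun y => M y ^ (P - 1) / w y with hH
  have hMm : Measurable M := measurable_critMaximalOf _ _
  have hHm : Measurable H := (hMm.pow_const _).div h.measurable
  have hgm : Measurable fun z => g z / σ z := hg.div h.measurable_dual
  calc ∫⁻ x, critMaximal ρ θ₁ g x ^ P ∂(volume.withDensity w)
      ≤ ∫⁻ x, ((C : ℝ≥0∞) ^ P * critMaximalOf (volume.withDensity w) ρ (θ * P) H x) ^ P'
        ∂(volume.withDensity w) := by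
        refine lintegral_mono fun x => ?_
        have h1 := ENNReal.rpow_le_rpow (h.critMaximal_rpow_le hρ hθ₁ hg x) hP'.le
        rwa [← ENNReal.rpow_mul, h.conj.sub_one_mul_conj] at h1
    _ = ((C : ℝ≥0∞) ^ P) ^ P' * ∫⁻ x, critMaximalOf (volume.withDensity w) ρ (θ * P) H x ^ P'
        ∂(volume.withDensity w) := by
        simp_rw [ENNReal.mul_rpow_of_nonneg _ _ hP'.le]
        rw [lintegral_const_mul _ ((measurable_critMaximalOf _ _).pow_const _)]
    _ ≤ ((C : ℝ≥0∞) ^ P) ^ P' * (K * ∫⁻ x, H x ^ P' ∂(volume.withDensity w)) := by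
        exact mul_le_mul' le_rfl (hK H hHm)
    _ = ((C : ℝ≥0∞) ^ P) ^ P' * (K * ∫⁻ x, M x ^ P ∂(volume.withDensity σ)) := by
        rw [lintegral_withDensity_eq_lintegral_mul _ h.measurable (hHm.pow_const _),
          lintegral_withDensity_eq_lintegral_mul _ h.measurable_dual (hMm.pow_const _)]
        congr 2
        refine lintegral_congr fun x => ?_
        exact h.dual_rpow_mul x (M x)
    _ ≤ ((C : ℝ≥0∞) ^ P) ^ P' *
        (K * (K' * ∫⁻ x, (g x / σ x) ^ P ∂(volume.withDensity σ))) := by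
        exact mul_le_mul' le_rfl (mul_le_mul' le_rfl (hK' _ hgm))
    _ = ((C : ℝ≥0∞) ^ P) ^ P' * (K * (K' * ∫⁻ x, g x ^ P ∂(volume.withDensity w))) := by
        rw [lintegral_withDensity_eq_lintegral_mul _ h.measurable (hg.pow_const _),
          lintegral_withDensity_eq_lintegral_mul _ h.measurable_dual (hgm.pow_const _)]
        congr 3
        refine lintegral_congr fun x => ?_
        exact h.div_rpow_mul x (g x)
    _ = _ := by
        push_cast
        rw [ENNReal.coe_rpow_of_nonneg _ hP'.le, ENNReal.coe_rpow_of_nonneg _ hP.le]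
        ring

end CritMuckenhoupt

end Weights

/-! ### The local `A_∞` property. -/

section AInfty

variable {n : ℕ} {ρ : Eucl n → ℝ}

/-- At almost every point of a set of small measure there is a ball in which the set has
density comparable to `1`, but at most `1 / 2`. -/
theorem ae_exists_ball_density {E : Set (Eucl n)} {t : ℝ} (ht : 0 < t)
    (hEt : ∀ x : Eucl n, 2 * volume E ≤ volume (ball x t)) :
    ∀ᵐ x ∂(volume.restrict E), ∃ s, 0 < s ∧ s ≤ t ∧
      2 * volume (E ∩ ball x s) ≤ volume (ball x s) ∧
      volume (ball x s) ≤ 2 ^ (n + 1) * volume (E ∩ ball x s) := by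
  filter_upwards [Besicovitch.ae_tendsto_measure_inter_div volume E] with x hx
  have hlim : Filter.Tendsto (fun j : ℕ => t * (1 / 2 : ℝ) ^ j) Filter.atTop
      (nhdsWithin 0 (Set.Ioi 0)) := by
    refine tendsto_nhdsWithin_iff.2 ⟨?_, Filter.Eventually.of_forall fun j => ?_⟩
    · simpa using (tendsto_pow_atTop_nhds_zero_of_lt_one (by norm_num : (0 : ℝ) ≤ 1 / 2)
        (by norm_num)).const_mul t
    · exact Set.mem_Ioi.2 (by positivity)
  have h1 := (hx.comp hlim).eventually (lt_mem_nhds (show (2⁻¹ : ℝ≥0∞) < 1 by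
    exact ENNReal.inv_lt_one.2 (by norm_num)))
  have hex : ∃ j : ℕ, volume (ball x (t * (1 / 2 : ℝ) ^ j)) <
      2 * volume (E ∩ closedBall x (t * (1 / 2 : ℝ) ^ j)) := by
    obtain ⟨j, hj⟩ := h1.exists
    refine ⟨j, ?_⟩
    simp only [Function.comp] at hj
    rw [ENNReal.lt_div_iff_mul_lt
      (Or.inl (measure_closedBall_pos volume x (by positivity)).ne')
      (Or.inl measure_closedBall_lt_top.ne)] at hj
    calc volume (ball x (t * (1 / 2 : ℝ) ^ j))
        = 2 * (2⁻¹ * volume (ball x (t * (1 / 2 : ℝ) ^ j))) := by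
          rw [← mul_assoc, ENNReal.mul_inv_cancel (by norm_num) (by norm_num), one_mul]
      _ < _ := by
          rw [ENNReal.mul_lt_mul_iff_right (by norm_num) (by norm_num)]
          refine lt_of_le_of_lt ?_ hj
          gcongr
          exact ball_subset_closedBall
  classical
  -- The first radius `t 2^(-j)` at which `E` fills more than half of the ball. It is not the
  -- initial one, by `hEt`, so the preceding radius, twice as large, has density at most `1/2` and
  -- at least `2^(-(n+1))`.
  set j := Nat.find hex with hj
  have hj1 := Nat.find_spec hex
  rw [← hj] at hj1
  have hj0 : j ≠ 0 := by
    intro h0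
    rw [h0, pow_zero, mul_one] at hj1
    refine absurd (hj1.trans_le ?_) (lt_irrefl _)
    exact (mul_le_mul' le_rfl (measure_mono Set.inter_subset_left)).trans (hEt x)
  obtain ⟨i, hi⟩ := Nat.exists_eq_succ_of_ne_zero hj0
  have hj2 := Nat.find_min hex (m := i) (by omega)
  rw [hi] at hj1
  rw [not_lt] at hj2
  have hpow : (1 / 2 : ℝ) ^ i ≤ 1 := pow_le_one₀ (by norm_num) (by norm_num)
  have hs : t * (1 / 2 : ℝ) ^ i = 2 * (t * (1 / 2 : ℝ) ^ (i.succ)) := by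
    rw [pow_succ]
    ring
  have hpos : 0 < t * (1 / 2 : ℝ) ^ (i.succ) := by positivity
  refine ⟨t * (1 / 2 : ℝ) ^ i, by positivity, by nlinarith, ?_, ?_⟩
  · refine le_trans ?_ hj2
    gcongr
    exact ball_subset_closedBall
  · have : ENNReal.ofReal 2 = 2 := by simp
    rw [hs, volume_ball_mul x x (by norm_num), ENNReal.ofReal_pow (by norm_num), this,
      pow_succ (2 : ℝ≥0∞), mul_assoc]
    refine mul_le_mul' le_rfl (hj1.le.trans ?_)
    gcongr
    exact closedBall_subset_ball (by linarith)

/-- One step of the iteration: a set of small Lebesgue measure can be enlarged, keeping its Lebesgue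
measure comparable, so that it only carries a fixed proportion of the weighted measure. -/
theorem exists_enlargement {μ : Measure (Eucl n)} (hμ : μ ≪ volume) {P : ℝ}
    (hP : 0 < P) {Q : ℝ≥0} {x₀ : Eucl n} {r : ℝ}
    (hloc : ∀ x ∈ ball x₀ (2 * r), ∀ s, 0 < s → s ≤ 6 * r → ∀ E, MeasurableSet E → E ⊆ ball x s →
      volume E ^ P * μ (ball x s) ≤ Q * volume (ball x s) ^ P * μ E)
    {E : Set (Eucl n)} (hE : MeasurableSet E) {R t : ℝ} (hER : E ⊆ ball x₀ R) (hR : R ≤ 2 * r)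
    (ht : 0 < t) (htr : t ≤ r) (hEt : ∀ x : Eucl n, 2 * volume E ≤ volume (ball x t)) :
    ∃ E', MeasurableSet E' ∧ E' ⊆ ball x₀ (R + t) ∧
      volume E' ≤ (1 + 2 ^ (n + 1)) * volume E ∧
      (1 + (Q : ℝ≥0∞) * (6 ^ n) ^ P * (Q * 2 ^ P)) * μ E ≤ (Q * (6 ^ n) ^ P * (Q * 2 ^ P)) * μ E' := by
  -- The upper density bound leaves at least half of each ball outside `E`, where new mass is found;
  -- the lower bound keeps the volume of the union comparable to that of `E`.
  set S : Set (Eucl n × ℝ) := {a | a.1 ∈ E ∧ 0 < a.2 ∧ a.2 ≤ t ∧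
      2 * volume (E ∩ ball a.1 a.2) ≤ volume (ball a.1 a.2) ∧
      volume (ball a.1 a.2) ≤ 2 ^ (n + 1) * volume (E ∩ ball a.1 a.2)} with hS
  obtain ⟨u, hu, huc, hd, hcov⟩ := exists_countable_disjoint_cover S t
    fun a ha => ⟨ha.2.1, ha.2.2.1⟩
  set U : Set (Eucl n) := ⋃ b ∈ u, ball b.1 b.2 with hU
  have hUm : MeasurableSet U := MeasurableSet.biUnion huc fun _ _ => measurableSet_ball
  -- The points without a good density ball form a Lebesgue null set, hence a `μ`-null set.
  have hcover : μ E ≤ μ (⋃ b ∈ u, ball b.1 (6 * b.2)) := by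
    refine measure_mono_ae ?_
    have h1 := hμ.ae_le ((ae_restrict_iff' hE).1 (ae_exists_ball_density ht hEt))
    filter_upwards [h1] with x hx hxE
    obtain ⟨s, hs0, hst, hs1, hs2⟩ := hx hxE
    obtain ⟨b, hb, hsub⟩ := hcov (x, s) ⟨hxE, hs0, hst, hs1, hs2⟩
    exact Set.mem_biUnion hb (hsub (mem_ball_self hs0))
  -- Two uses of `hloc`: from the sixfold ball to the ball, then from the ball to its part outside
  -- `E`.
  have hone : ∀ b ∈ u, μ (ball b.1 (6 * b.2)) ≤
      Q * (6 ^ n) ^ P * (Q * 2 ^ P) * μ (ball b.1 b.2 \ E) := by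
    intro b hb
    obtain ⟨hbE, hb0, hbt, hb1, hb2⟩ := hu hb
    have hbm := ball_subset_ball hR (hER hbE)
    have hV0 := volume_ball_pos b.1 hb0
    have hVt := volume_ball_ne_top b.1 b.2
    have hVP0 : volume (ball b.1 b.2) ^ P ≠ 0 :=
      (ENNReal.rpow_pos (pos_iff_ne_zero.2 hV0) hVt).ne'
    have hVPt : volume (ball b.1 b.2) ^ P ≠ ∞ := ENNReal.rpow_ne_top_of_nonneg hP.le hVt
    have h6 : μ (ball b.1 (6 * b.2)) ≤ Q * (6 ^ n) ^ P * μ (ball b.1 b.2) := by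
      have h := hloc b.1 hbm (6 * b.2) (by linarith) (by linarith) (ball b.1 b.2)
        measurableSet_ball (ball_subset_ball (by linarith))
      rw [volume_ball_mul b.1 b.1 (by norm_num), ENNReal.ofReal_pow (by norm_num),
        ENNReal.mul_rpow_of_nonneg _ _ hP.le] at h
      have h6' : ENNReal.ofReal 6 = 6 := by simp
      rw [h6'] at h
      refine (ENNReal.mul_le_mul_iff_right hVP0 hVPt).1 (h.trans (le_of_eq ?_))
      ring
    have hhalf : volume (ball b.1 b.2) ≤ 2 * volume (ball b.1 b.2 \ E) := by
      have h := measure_inter_add_sdiff (μ := volume) (ball b.1 b.2) hE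
      rw [Set.inter_comm] at h
      have h3 : 2 * volume (E ∩ ball b.1 b.2) + 2 * volume (ball b.1 b.2 \ E) =
          volume (ball b.1 b.2) + volume (ball b.1 b.2) := by
        rw [← mul_add, h, two_mul]
      by_contra hlt
      rw [not_le] at hlt
      exact absurd h3 (ENNReal.add_lt_add_of_le_of_lt
        (ne_top_of_le_ne_top hVt hb1) hb1 hlt).ne
    have h2 : μ (ball b.1 b.2) ≤ Q * 2 ^ P * μ (ball b.1 b.2 \ E) := by
      have h := hloc b.1 hbm b.2 hb0 (by linarith) (ball b.1 b.2 \ E)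
        (measurableSet_ball.diff hE) Set.sdiff_subset
      refine (ENNReal.mul_le_mul_iff_right hVP0 hVPt).1 ?_
      calc volume (ball b.1 b.2) ^ P * μ (ball b.1 b.2)
          ≤ (2 * volume (ball b.1 b.2 \ E)) ^ P * μ (ball b.1 b.2) := by gcongr
        _ = 2 ^ P * (volume (ball b.1 b.2 \ E) ^ P * μ (ball b.1 b.2)) := by
            rw [ENNReal.mul_rpow_of_nonneg _ _ hP.le, mul_assoc]
        _ ≤ 2 ^ P * (Q * volume (ball b.1 b.2) ^ P * μ (ball b.1 b.2 \ E)) := by gcongr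
        _ = _ := by ring
    calc _ ≤ Q * (6 ^ n) ^ P * μ (ball b.1 b.2) := h6
      _ ≤ Q * (6 ^ n) ^ P * (Q * 2 ^ P * μ (ball b.1 b.2 \ E)) := by gcongr
      _ = _ := by ring
  have hmain : μ E ≤ Q * (6 ^ n) ^ P * (Q * 2 ^ P) * μ (U \ E) := by
    calc μ E ≤ ∑' b : u, μ (ball b.1.1 (6 * b.1.2)) :=
          hcover.trans (measure_biUnion_le μ huc _)
      _ ≤ ∑' b : u, Q * (6 ^ n) ^ P * (Q * 2 ^ P) * μ (ball b.1.1 b.1.2 \ E) :=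
          ENNReal.tsum_le_tsum fun b => hone b b.2
      _ = Q * (6 ^ n) ^ P * (Q * 2 ^ P) * μ (⋃ b ∈ u, (ball b.1 b.2 \ E)) := by
          rw [ENNReal.tsum_mul_left, measure_biUnion huc (hd.mono fun a => Set.sdiff_subset)
            fun _ _ => measurableSet_ball.diff hE]
      _ ≤ _ := by
          gcongr
          simp only [Set.iUnion_subset_iff]
          exact fun b hb => Set.sdiff_subset_sdiff_left
            (Set.subset_biUnion_of_mem (u := fun b : Eucl n × ℝ => ball b.1 b.2) hb)
  refine ⟨E ∪ U, hE.union hUm, ?_, ?_, ?_⟩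
  · refine Set.union_subset (hER.trans (ball_subset_ball (by linarith)))
      (Set.iUnion₂_subset fun b hb => ?_)
    obtain ⟨hbE, hb0, hbt, -, -⟩ := hu hb
    refine ball_subset_ball' ?_
    have := mem_ball.1 (hER hbE)
    linarith
  · refine (measure_union_le _ _).trans ?_
    rw [add_mul, one_mul]
    gcongr
    calc volume U ≤ ∑' b : u, volume (ball b.1.1 b.1.2) := measure_biUnion_le _ huc _
      _ ≤ ∑' b : u, 2 ^ (n + 1) * volume (E ∩ ball b.1.1 b.1.2) :=
          ENNReal.tsum_le_tsum fun b => (hu b.2).2.2.2.2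
      _ = 2 ^ (n + 1) * volume (⋃ b ∈ u, E ∩ ball b.1 b.2) := by
          rw [ENNReal.tsum_mul_left, measure_biUnion huc (hd.mono fun a => Set.inter_subset_right)
            fun _ _ => hE.inter measurableSet_ball]
      _ ≤ _ := by
          gcongr
          simp
  -- If `D` is the constant in `μ E ≤ D μ(U \ E)`, adding `D μ E` to both sides gives the proportion
  -- `D / (1 + D)`.
  · rw [add_mul, one_mul]
    calc μ E + Q * (6 ^ n) ^ P * (Q * 2 ^ P) * μ E
        ≤ Q * (6 ^ n) ^ P * (Q * 2 ^ P) * μ (U \ E) + Q * (6 ^ n) ^ P * (Q * 2 ^ P) * μ E := by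
          gcongr
      _ = Q * (6 ^ n) ^ P * (Q * 2 ^ P) * μ (E ∪ U) := by
          rw [← mul_add, ← Set.union_sdiff_self, measure_union disjoint_sdiff_self_right
            (hUm.diff hE), add_comm]

/-- Iteration of `exists_enlargement`. Each step gains `D / (1 + D)`, multiplies the volume by at
most `1 + 2^(n+1)` and adds `t` to the radius. Hence the volume must be small, and room must remain
in the ball, for all `k` steps in advance. -/
theorem measure_le_pow_mul {μ : Measure (Eucl n)} (hμ : μ ≪ volume) {P : ℝ}
    (hP : 0 < P) {Q : ℝ≥0} {x₀ : Eucl n} {r : ℝ}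
    (hloc : ∀ x ∈ ball x₀ (2 * r), ∀ s, 0 < s → s ≤ 6 * r → ∀ E, MeasurableSet E → E ⊆ ball x s →
      volume E ^ P * μ (ball x s) ≤ Q * volume (ball x s) ^ P * μ E)
    {t : ℝ} (ht : 0 < t) (htr : t ≤ r) (k : ℕ) :
    ∀ {R : ℝ} {E : Set (Eucl n)}, MeasurableSet E → E ⊆ ball x₀ R → R + k * t ≤ 2 * r →
      (∀ x : Eucl n, (1 + 2 ^ (n + 1)) ^ k * (2 * volume E) ≤ volume (ball x t)) →
      (1 + (Q : ℝ≥0∞) * (6 ^ n) ^ P * (Q * 2 ^ P)) ^ k * μ E ≤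
        (Q * (6 ^ n) ^ P * (Q * 2 ^ P)) ^ k * μ (ball x₀ (2 * r)) := by
  induction k with
  | zero =>
    intro R E hE hER hR _
    simp only [pow_zero, one_mul]
    exact measure_mono (hER.trans (ball_subset_ball (by simpa using hR)))
  | succ k ih =>
    intro R E hE hER hR hEt
    push_cast at hR
    have hk : 0 ≤ (k : ℝ) * t := by positivity
    have h1 : ∀ x : Eucl n, 2 * volume E ≤ volume (ball x t) := fun x => by
      refine le_trans (le_mul_of_one_le_left zero_le ?_) (hEt x)
      exact one_le_pow₀ le_self_add
    obtain ⟨E', hE', hE'R, hvol, hμE⟩ := exists_enlargement hμ hP hloc hE hER (by linarith) ht htr h1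
    have h2 := ih hE' hE'R (by linarith) fun x => by
      refine le_trans ?_ (hEt x)
      calc (1 + 2 ^ (n + 1)) ^ k * (2 * volume E')
          ≤ (1 + 2 ^ (n + 1)) ^ k * (2 * ((1 + 2 ^ (n + 1)) * volume E)) := by gcongr
        _ = _ := by ring
    set D : ℝ≥0∞ := (Q : ℝ≥0∞) * (6 ^ n) ^ P * (Q * 2 ^ P)
    calc (1 + D) ^ (k + 1) * μ E = (1 + D) ^ k * ((1 + D) * μ E) := by ring
      _ ≤ (1 + D) ^ k * (D * μ E') := by gcongr
      _ = D * ((1 + D) ^ k * μ E') := by ring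
      _ ≤ D * (D ^ k * μ (ball x₀ (2 * r))) := by gcongr
      _ = _ := by ring

namespace CritMuckenhoupt

variable {θ P P' : ℝ} {C : ℝ≥0} {w σ : Eucl n → ℝ≥0∞}

/-- The `A_P` inequality on balls of radius at most a multiple of the critical radius. -/
theorem exists_local (hρ : ∀ x, 0 < ρ x) (h : CritMuckenhoupt ρ θ P P' C w σ) (K : ℝ) :
    ∃ Q : ℝ≥0, ∀ x s, 0 < s → s ≤ K * ρ x → ∀ E, MeasurableSet E → E ⊆ ball x s →
      volume E ^ P * volume.withDensity w (ball x s) ≤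
        Q * volume (ball x s) ^ P * volume.withDensity w E := by
  have hP := h.conj.pos
  let Q : ℝ≥0∞ := (C * ENNReal.ofReal ((1 + K) ^ θ)) ^ P
  have hQ : Q ≠ ∞ := ENNReal.rpow_ne_top_of_nonneg hP.le (by finiteness)
  refine ⟨Q.toNNReal, fun x s hs hsK E hE hEs => ?_⟩
  rw [ENNReal.coe_toNNReal hQ, ← ENNReal.mul_rpow_of_nonneg _ _ hP.le]
  refine (h.volume_rpow_mul_le hE hs hEs).trans ?_
  gcongr
  exact critPsi_le_of_le hρ h.nonneg hs.le hsK

theorem exists_local_doubling (hρ : ∀ x, 0 < ρ x) (h : CritMuckenhoupt ρ θ P P' C w σ) (K : ℝ)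
    {c : ℝ} (hc : 1 ≤ c) :
    ∃ D : ℝ≥0, ∀ x s, 0 < s → c * s ≤ K * ρ x →
      volume.withDensity w (ball x (c * s)) ≤ D * volume.withDensity w (ball x s) := by
  have hP := h.conj.pos
  have hc0 : 0 < c := by linarith
  obtain ⟨Q, hQ⟩ := h.exists_local hρ K
  let D : ℝ≥0∞ := Q * ENNReal.ofReal (c ^ n) ^ P
  have hD : D ≠ ∞ := ENNReal.mul_ne_top ENNReal.coe_ne_top
    (ENNReal.rpow_ne_top_of_nonneg hP.le (by finiteness))
  refine ⟨D.toNNReal, fun x s hs hsK => ?_⟩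
  rw [ENNReal.coe_toNNReal hD]
  have h1 := hQ x (c * s) (by positivity) hsK (ball x s) measurableSet_ball
    (ball_subset_ball (by nlinarith))
  have hV0 := volume_ball_pos x hs
  have hVt := volume_ball_ne_top x s
  rw [volume_ball_mul x x hc0, ENNReal.mul_rpow_of_nonneg _ _ hP.le] at h1
  refine (ENNReal.mul_le_mul_iff_right (ENNReal.rpow_pos (pos_iff_ne_zero.2 hV0) hVt).ne'
    (ENNReal.rpow_ne_top_of_nonneg hP.le hVt)).1 (h1.trans (le_of_eq ?_))
  ring

/-- The local `A_∞` property: on balls of radius at most a small multiple of the critical radius,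
sets of small Lebesgue measure have small weighted measure. -/
theorem exists_measure_le (hρ : ∀ x, 0 < ρ x) {C₀ : ℝ} (hC₀ : 1 ≤ C₀)
    (hρC : ∀ x y, ρ y ≤ C₀ * (ρ x + dist x y)) (h : CritMuckenhoupt ρ θ P P' C w σ)
    {δ : ℝ≥0∞} (hδ : δ ≠ 0) :
    ∃ ε : ℝ≥0, ε ≠ 0 ∧ ∀ x r, 0 < r → 4 * C₀ * r ≤ ρ x → ∀ E, MeasurableSet E → E ⊆ ball x r →
      volume E ≤ ε * volume (ball x r) →
      volume.withDensity w E ≤ δ * volume.withDensity w (ball x r) := by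
  have hP := h.conj.pos
  obtain ⟨Q, hQ⟩ := h.exists_local hρ 3
  obtain ⟨D₂, hD₂⟩ := h.exists_local_doubling hρ 1 (c := 2) (by norm_num)
  set D : ℝ≥0∞ := (Q : ℝ≥0∞) * (6 ^ n) ^ P * (Q * 2 ^ P) with hDdef
  have hDt : D ≠ ∞ := by
    have h1 : ((6 : ℝ≥0∞) ^ n) ^ P ≠ ∞ := ENNReal.rpow_ne_top_of_nonneg hP.le (by finiteness)
    have h2 : (2 : ℝ≥0∞) ^ P ≠ ∞ := ENNReal.rpow_ne_top_of_nonneg hP.le (by finiteness)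
    finiteness
  have hβ : D / (1 + D) < 1 := by
    rw [ENNReal.div_lt_iff (Or.inl (by simp)) (Or.inl (by finiteness)), one_mul, add_comm]
    exact ENNReal.lt_add_right hDt one_ne_zero
  -- Enough enlargements to bring the factor below `δ`, including the doubling constant `D₂` for the
  -- return from radius `2r` to `r`.
  obtain ⟨k, hk⟩ : ∃ k : ℕ, (D / (1 + D)) ^ k * D₂ < δ := by
    have h1 : Filter.Tendsto (fun k : ℕ => (D / (1 + D)) ^ k * D₂) Filter.atTop (nhds (0 * D₂)) :=
      ENNReal.Tendsto.mul_const (ENNReal.tendsto_pow_atTop_nhds_zero_of_lt_one hβ)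
        (Or.inr ENNReal.coe_ne_top)
    rw [zero_mul] at h1
    exact (h1.eventually (gt_mem_nhds (pos_iff_ne_zero.2 hδ))).exists
  -- Each step may extend the radius by `c r`; since `k c ≤ 1`, all sets stay in `B(x, 2r)`. With `ε
  -- = c^n / A` the volume condition at radius `c r` holds for all `k` steps.
  set c : ℝ := 1 / (k + 1) with hc
  have hc0 : 0 < c := by positivity
  have hc1 : c ≤ 1 := by
    rw [hc, div_le_one (by positivity)]
    linarith [(Nat.cast_nonneg k : (0 : ℝ) ≤ k)]
  have hkc : k * c ≤ 1 := by
    rw [hc, mul_one_div, div_le_one (by positivity)]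
    linarith
  set A : ℝ≥0∞ := (1 + 2 ^ (n + 1)) ^ k * 2 with hA
  have hA0 : A ≠ 0 := by simp [hA]
  have hAt : A ≠ ∞ := by finiteness
  have hεt : ENNReal.ofReal (c ^ n) / A ≠ ∞ := ENNReal.div_ne_top (by finiteness) hA0
  refine ⟨(ENNReal.ofReal (c ^ n) / A).toNNReal, ?_, fun x r hr hrρ E hE hEr hEV => ?_⟩
  · have : ENNReal.ofReal (c ^ n) / A ≠ 0 := by
      rw [Ne, ENNReal.div_eq_zero_iff, not_or]
      exact ⟨by simpa using pow_pos hc0 n, hAt⟩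
    simp only [ne_eq, ENNReal.toNNReal_eq_zero_iff, not_or]
    exact ⟨this, hεt⟩
  rw [ENNReal.coe_toNNReal hεt] at hEV
  -- Slow variation gives `2r ≤ ρ y` for `y` in `B(x, 2r)`, so radii up to `6r` are at most `3 ρ y`;
  -- hence the 3 in `hQ`.
  have hloc : ∀ y ∈ ball x (2 * r), ∀ s, 0 < s → s ≤ 6 * r → ∀ E, MeasurableSet E →
      E ⊆ ball y s → volume E ^ P * volume.withDensity w (ball y s) ≤
        Q * volume (ball y s) ^ P * volume.withDensity w E := by
    intro y hy s hs hs6 E hE hEs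
    refine hQ y s hs ?_ E hE hEs
    have h1 := hρC y x
    have h2 := mem_ball.1 hy
    have h3 : C₀ * dist y x ≤ C₀ * (2 * r) := by gcongr
    have h4 : C₀ * (2 * r) ≤ C₀ * ρ y := by linarith
    have h5 := le_of_mul_le_mul_left h4 (by linarith)
    linarith
  have h1 := measure_le_pow_mul (withDensity_absolutelyContinuous volume w) hP hloc (t := c * r)
    (by positivity) (by nlinarith) k hE hEr (by nlinarith) fun y => by
      rw [volume_ball_mul y x hc0, ← mul_assoc, ← hA]
      calc A * volume E ≤ A * (ENNReal.ofReal (c ^ n) / A * volume (ball x r)) := by gcongr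
        _ = _ := by rw [← mul_assoc, ENNReal.mul_div_cancel hA0 hAt]
  rw [← hDdef] at h1
  have h2 : volume.withDensity w (ball x (2 * r)) ≤ D₂ * volume.withDensity w (ball x r) := by
    refine hD₂ x r hr ?_
    nlinarith
  have h10 : (1 + D) ^ k ≠ 0 := pow_ne_zero _ (by simp)
  have h1t : (1 + D) ^ k ≠ ∞ := by finiteness
  calc volume.withDensity w E
      = ((1 + D) ^ k)⁻¹ * ((1 + D) ^ k * volume.withDensity w E) := by
        rw [← mul_assoc, ENNReal.inv_mul_cancel h10 h1t, one_mul]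
    _ ≤ ((1 + D) ^ k)⁻¹ * (D ^ k * (D₂ * volume.withDensity w (ball x r))) :=
        mul_le_mul' le_rfl (h1.trans (mul_le_mul' le_rfl h2))
    _ = (D / (1 + D)) ^ k * D₂ * volume.withDensity w (ball x r) := by
        rw [div_eq_mul_inv, mul_pow, ENNReal.inv_pow]
        ring
    _ ≤ _ := by gcongr

end CritMuckenhoupt

end AInfty

/-! ### The local maximal function and Whitney balls. -/

section LocalMaximal

variable {n : ℕ} {ρ : Eucl n → ℝ}

/-- The maximal function over balls of radius less than the critical radius. -/
noncomputable def locMaximal (ρ : Eucl n → ℝ) (F : Eucl n → ℝ≥0∞) (x : Eucl n) : ℝ≥0∞ :=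
  ⨆ (x₀ : Eucl n) (r : ℝ) (_ : 0 < r) (_ : x ∈ ball x₀ r) (_ : r < ρ x₀),
    ⨍⁻ y in ball x₀ r, F y ∂volume

theorem lt_locMaximal {F : Eucl n → ℝ≥0∞} {x : Eucl n} {t : ℝ≥0∞} :
    t < locMaximal ρ F x ↔ ∃ x₀ r, 0 < r ∧ x ∈ ball x₀ r ∧ r < ρ x₀ ∧
      t < ⨍⁻ y in ball x₀ r, F y ∂volume := by
  simp only [locMaximal, lt_iSup_iff, exists_prop]

theorem le_locMaximal (F : Eucl n → ℝ≥0∞) {x x₀ : Eucl n} {r : ℝ} (hr : 0 < r)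
    (hx : x ∈ ball x₀ r) (hrρ : r < ρ x₀) :
    ⨍⁻ y in ball x₀ r, F y ∂volume ≤ locMaximal ρ F x :=
  le_iSup₂_of_le x₀ r (le_iSup₂_of_le hr hx (le_iSup_of_le hrρ le_rfl))

theorem isOpen_lt_locMaximal (F : Eucl n → ℝ≥0∞) (t : ℝ≥0∞) :
    IsOpen {x | t < locMaximal ρ F x} := by
  rw [isOpen_iff_forall_mem_open]
  intro x hx
  obtain ⟨x₀, r, hr, hx, h⟩ := lt_locMaximal.1 hx
  exact ⟨ball x₀ r, fun y hy => lt_locMaximal.2 ⟨x₀, r, hr, hy, h⟩, isOpen_ball, hx⟩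

theorem measurable_locMaximal (F : Eucl n → ℝ≥0∞) : Measurable (locMaximal ρ F) :=
  measurable_of_Ioi fun t => (isOpen_lt_locMaximal F t).measurableSet

theorem ball_ae_eq_closedBall (x : Eucl n) {r : ℝ} (hr : 0 < r) :
    (ball x r : Set (Eucl n)) =ᵐ[volume] closedBall x r := by
  refine ae_eq_of_subset_of_measure_ge ball_subset_closedBall (le_of_eq ?_)
    measurableSet_ball.nullMeasurableSet measure_closedBall_lt_top.ne
  rw [Measure.addHaar_closedBall _ _ hr.le, Measure.addHaar_ball_of_pos _ _ hr]

/-- Lebesgue differentiation: centred balls of radius below `ρ x` are admissible at `x`. -/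
theorem ae_le_locMaximal (hρ : ∀ x, 0 < ρ x) {F : Eucl n → ℝ≥0∞} (hF : Measurable F)
    (hFt : ∫⁻ x, F x ≠ ∞) : ∀ᵐ x, F x ≤ locMaximal ρ F x := by
  filter_upwards [(Besicovitch.vitaliFamily (volume : Measure (Eucl n))).ae_tendsto_lintegral_div'
    hF hFt] with x hx
  have h1 := hx.comp (Besicovitch.tendsto_filterAt volume x)
  refine le_of_tendsto h1 ?_
  filter_upwards [Ioo_mem_nhdsGT (hρ x)] with r hr
  have h2 := ball_ae_eq_closedBall x hr.1
  simp only [Function.comp]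
  rw [← setLIntegral_congr h2, ← measure_congr h2, ← setLAverage_eq]
  exact le_locMaximal F hr.1 (mem_ball_self hr.1) hr.2

/-- A Whitney ball of an open set, of radius at most `R`. -/
theorem exists_whitney_radius {U : Set (Eucl n)} (hU : IsOpen U) {x : Eucl n} (hx : x ∈ U) {R : ℝ}
    (hR : 0 < R) : ∃ r, 0 < r ∧ r ≤ R ∧ ball x r ⊆ U ∧ (r = R ∨ ∃ u ∈ ball x (2 * r), u ∉ U) := by
  have hex : ∃ j : ℕ, ball x (R * (1 / 2 : ℝ) ^ j) ⊆ U := by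
    obtain ⟨ε, hε, hεU⟩ := Metric.isOpen_iff.1 hU x hx
    obtain ⟨j, hj⟩ := exists_pow_lt_of_lt_one (div_pos hε hR) (by norm_num : (1 / 2 : ℝ) < 1)
    refine ⟨j, (ball_subset_ball ?_).trans hεU⟩
    rw [lt_div_iff₀ hR] at hj
    linarith
  classical
  -- The largest of the radii `R 2^(-j)` whose ball lies in `U`: either it is `R`, or the ball of
  -- twice the radius leaves `U`.
  obtain ⟨j, hj⟩ : ∃ j, j = Nat.find hex := ⟨_, rfl⟩
  have hj1 := Nat.find_spec hex
  rw [← hj] at hj1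
  refine ⟨R * (1 / 2 : ℝ) ^ j, by positivity, ?_, hj1, ?_⟩
  · exact mul_le_of_le_one_right hR.le (pow_le_one₀ (by norm_num) (by norm_num))
  · rcases Nat.eq_zero_or_eq_succ_pred j with h0 | h0
    · left
      simp [h0]
    · right
      have hj2 := Nat.find_min hex (m := j.pred) (by omega)
      obtain ⟨u, hu, huU⟩ := Set.not_subset.1 hj2
      refine ⟨u, ?_, huU⟩
      have : 2 * (R * (1 / 2 : ℝ) ^ j) = R * (1 / 2 : ℝ) ^ j.pred := by
        rw [h0, pow_succ, Nat.pred_succ]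
        ring
      rwa [this]

end LocalMaximal

/-! ### The local splitting and its first consequences. -/

section GoodLambda

variable {n : ℕ} {ρ : Eucl n → ℝ}

/-- The local decomposition hypotheses on a pair `F`, `G`: the averages of `F` over balls larger
than the critical radius are controlled by `G`, and on smaller balls `F` splits into a part with
averages controlled by `G` and a part with a good `L^P(w)` bound. -/
structure LocalSplitting (ρ : Eucl n → ℝ) (θ P τ b : ℝ) (w : Eucl n → ℝ≥0∞) (K : ℝ≥0)
    (F G : Eucl n → ℝ≥0∞) : Prop where
  measurable : Measurable F
  measurable' : Measurable G
  large : ∀ z s y, 0 < s → y ∈ ball z s → ρ z ≤ s →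
    (critPsi ρ θ z s)⁻¹ * ⨍⁻ y in ball z s, F y ∂volume ≤ K * G y
  -- The radius `6r` is that of the Vitali enlargement of a Whitney ball of radius `r`. The point
  -- `u`, within `2r`, will be one where the local maximal function is below the level, while `y` is
  -- a point where `G` is small; they need not coincide.
  split : ∀ x r, 0 < r → r ≤ b * ρ x → ∃ g h : Eucl n → ℝ≥0∞, Measurable g ∧ Measurable h ∧
    (∀ᵐ y ∂(volume.restrict (ball x (τ * r))), F y ≤ g y + h y) ∧
    (∀ y ∈ ball x (6 * r), ⨍⁻ y in ball x (τ * r), g y ∂volume ≤ K * G y) ∧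
    ∀ u ∈ ball x (2 * r), ∀ y ∈ ball x (6 * r),
      ∫⁻ y in ball x (τ * r), h y ^ P ∂(volume.withDensity w) ≤
        K * ((critMaximal ρ θ F u + G y) ^ P * volume.withDensity w (ball x (τ * r)))

namespace LocalSplitting

variable {θ P τ b : ℝ} {w : Eucl n → ℝ≥0∞} {K : ℝ≥0} {F G : Eucl n → ℝ≥0∞}

/-- A ball whose radius is between `a ρ z` and `ρ z` is enlarged to radius `ρ z`. This costs
`a^(-n)` in volume, and there `Ψ_θ = 2^θ`. -/
theorem laverage_le (hρ : ∀ x, 0 < ρ x) (hθ : 0 ≤ θ) (hFG : LocalSplitting ρ θ P τ b w K F G)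
    {a : ℝ} (ha : 0 < a) (ha1 : a ≤ 1) {z y : Eucl n} {s : ℝ} (hs : 0 < s) (hy : y ∈ ball z s)
    (has : a * ρ z ≤ s) :
    ⨍⁻ y in ball z s, F y ∂volume ≤ critPsi ρ θ z s *
      (ENNReal.ofReal ((1 / a) ^ n) * ENNReal.ofReal (2 ^ θ) * K * G y) := by
  have h1a : 1 ≤ ENNReal.ofReal ((1 / a) ^ n) := by
    rw [← ENNReal.ofReal_one]
    exact ENNReal.ofReal_le_ofReal (one_le_pow₀ (by rwa [le_div_iff₀ ha, one_mul]))
  have h12 : 1 ≤ ENNReal.ofReal (2 ^ θ) := by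
    rw [← ENNReal.ofReal_one]
    exact ENNReal.ofReal_le_ofReal (Real.one_le_rpow (by norm_num) hθ)
  have key : ∀ s, 0 < s → y ∈ ball z s → ρ z ≤ s →
      ⨍⁻ y in ball z s, F y ∂volume ≤ critPsi ρ θ z s * (K * G y) := by
    intro s hs hy hzs
    have h := hFG.large z s y hs hy hzs
    rw [mul_comm, ← div_eq_mul_inv] at h
    rw [mul_comm]
    exact (ENNReal.div_le_iff (critPsi_ne_zero hρ θ z hs.le) (critPsi_ne_top θ z s)).1 h
  rcases le_or_gt (ρ z) s with hzs | hzs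
  · refine (key s hs hy hzs).trans ?_
    gcongr
    calc (K : ℝ≥0∞) = 1 * 1 * K := by simp
      _ ≤ _ := by gcongr
  · have hsub := ball_subset_ball (x := z) hzs.le
    calc ⨍⁻ y in ball z s, F y ∂volume
        ≤ ENNReal.ofReal ((1 / a) ^ n) * ⨍⁻ y in ball z (ρ z), F y ∂volume := by
          refine laverage_ball_le F hs (one_div_pos.2 ha) ?_ hsub
          rw [one_div, ← div_eq_inv_mul, le_div_iff₀ ha, mul_comm]
          exact has
      _ ≤ ENNReal.ofReal ((1 / a) ^ n) * (ENNReal.ofReal (2 ^ θ) * (K * G y)) := by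
          gcongr
          refine (key _ (hρ z) (hsub hy) le_rfl).trans ?_
          gcongr
          have := critPsi_le_of_le hρ hθ (x := z) (K := 1) (hρ z).le (by simp)
          norm_num at this
          exact this
      _ = 1 * (ENNReal.ofReal ((1 / a) ^ n) * ENNReal.ofReal (2 ^ θ) * K * G y) := by ring
      _ ≤ _ := by
          gcongr
          exact one_le_critPsi hρ hθ z hs.le

/-- At nearby points, the maximal function of `F` is controlled by its local version and `G`. -/
theorem critMaximal_le (hρ : ∀ x, 0 < ρ x) (hθ : 0 ≤ θ) (hFG : LocalSplitting ρ θ P τ b w K F G)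
    {C₀ : ℝ} (hC₀ : 1 ≤ C₀) (hρC : ∀ x y, ρ y ≤ C₀ * (ρ x + dist x y)) {u y : Eucl n}
    (huy : 2 * C₀ * dist u y ≤ ρ u) :
    critMaximal ρ θ F u ≤ locMaximal ρ F u +
      ENNReal.ofReal (2 ^ n) * ENNReal.ofReal (2 ^ θ) * (ENNReal.ofReal (2 ^ θ) * K * G y) := by
  refine critMaximalOf_le fun z s hs hu => ?_
  -- Subcritical balls count in `locMaximal`. For the others `ρ u ≤ 2 C₀ s`, so `y` is within `s` of
  -- `u` and the doubled ball contains `y`.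
  rcases lt_or_ge s (ρ z) with hzs | hzs
  · refine le_add_right (le_trans ?_ (le_locMaximal F hs hu hzs))
    exact mul_le_of_le_one_left zero_le (critPsi_inv_le_one hρ hθ z hs.le)
  · refine le_add_left ?_
    have h1 := hρC z u
    have h2 := mem_ball'.1 hu
    have h3 : ρ u ≤ 2 * C₀ * s := by nlinarith
    have h4 : dist u y ≤ s := le_of_mul_le_mul_left (huy.trans h3) (by linarith)
    have hy : y ∈ ball z (2 * s) := by
      rw [mem_ball, dist_comm]
      calc dist z y ≤ dist z u + dist u y := dist_triangle _ _ _
        _ < 2 * s := by linarith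
    have h5 := hFG.laverage_le hρ hθ zero_lt_one le_rfl (by linarith : 0 < 2 * s) hy (by linarith)
    simp only [div_one, one_pow, ENNReal.ofReal_one, one_mul] at h5
    have hψ0 := critPsi_ne_zero hρ θ z hs.le
    have hψt := critPsi_ne_top (ρ := ρ) θ z s
    calc (critPsi ρ θ z s)⁻¹ * ⨍⁻ y in ball z s, F y ∂volume
        ≤ (critPsi ρ θ z s)⁻¹ * (ENNReal.ofReal (2 ^ n) * ((ENNReal.ofReal (2 ^ θ) *
          critPsi ρ θ z s) * (ENNReal.ofReal (2 ^ θ) * K * G y))) := by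
          gcongr
          refine (laverage_ball_le F hs (by norm_num : (0 : ℝ) < 2) le_rfl
            (ball_subset_ball (by linarith))).trans ?_
          gcongr
          refine h5.trans ?_
          gcongr
          exact critPsi_mul_le hρ hθ (by norm_num) z hs.le
      _ = ((critPsi ρ θ z s)⁻¹ * critPsi ρ θ z s) * (ENNReal.ofReal (2 ^ n) *
          ENNReal.ofReal (2 ^ θ) * (ENNReal.ofReal (2 ^ θ) * K * G y)) := by ring
      _ = _ := by rw [ENNReal.inv_mul_cancel hψ0 hψt, one_mul]

end LocalSplitting

end GoodLambda

/-! ### The averaged good-`λ` inequality on one Whitney ball. -/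

section GoodLambdaBall

variable {n : ℕ} {ρ : Eucl n → ℝ}

theorem ENNReal.one_le_ofReal_rpow {c θ : ℝ} (hc : 1 ≤ c) (hθ : 0 ≤ θ) :
    1 ≤ ENNReal.ofReal (c ^ θ) := by
  rw [← ENNReal.ofReal_one]
  exact ENNReal.ofReal_le_ofReal (Real.one_le_rpow hc hθ)

theorem ENNReal.one_le_ofReal_pow {c : ℝ} (hc : 1 ≤ c) (n : ℕ) : 1 ≤ ENNReal.ofReal (c ^ n) := by
  rw [← ENNReal.ofReal_one]
  exact ENNReal.ofReal_le_ofReal (one_le_pow₀ hc)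

namespace LocalSplitting

variable {θ P τ b : ℝ} {w : Eucl n → ℝ≥0∞} {K : ℝ≥0} {F G : Eucl n → ℝ≥0∞}

/-- Where `G` is small, large values of the local maximal function come from small balls. -/
theorem exists_small_ball (hρ : ∀ x, 0 < ρ x) (hθ : 0 ≤ θ)
    (hFG : LocalSplitting ρ θ P τ b w K F G) {C₀ : ℝ} (hC₀ : 1 ≤ C₀)
    (hρC : ∀ x y, ρ y ≤ C₀ * (ρ x + dist x y)) (hb : 0 < b) (hbC : 32 * b * C₀ ^ 2 ≤ 1)
    {l t : ℝ≥0∞} {x y : Eucl n} {r : ℝ} (hr : 0 < r) (hrb : r ≤ b * ρ x)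
    (hcase : r = b * ρ x ∨ ∃ u ∈ ball x (2 * r), locMaximal ρ F u ≤ l)
    (hy : y ∈ ball x (6 * r)) (hlt : ENNReal.ofReal (9 ^ n) * l ≤ t)
    (hG : ENNReal.ofReal (9 ^ n) * (ENNReal.ofReal (10 ^ θ) *
      (ENNReal.ofReal ((C₀ * (2 * C₀ / b + 1)) ^ n) * ENNReal.ofReal (2 ^ θ) * K * G y)) ≤ l)
    (hyt : t < locMaximal ρ F y) :
    ∃ z s, 0 < s ∧ s < r ∧ s < ρ z ∧ y ∈ ball z s ∧ t < ⨍⁻ y in ball z s, F y ∂volume := by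
  obtain ⟨z, s, hs, hyz, hsρ, h⟩ := lt_locMaximal.1 hyt
  refine ⟨z, s, hs, ?_, hsρ, hyz, h⟩
  by_contra hrs
  rw [not_lt] at hrs
  refine absurd h (not_lt.2 ?_)
  have h9 : 1 ≤ ENNReal.ofReal ((9 : ℝ) ^ n) := ENNReal.one_le_ofReal_pow (by norm_num) n
  have hlt' : l ≤ t := (le_mul_of_one_le_left zero_le h9).trans hlt
  have hc1 : 1 ≤ C₀ * (2 * C₀ / b + 1) := by
    have : 0 ≤ 2 * C₀ / b := by positivity
    nlinarith
  -- If `r = b ρ x`, then `s ≥ r` is bounded below by a multiple of `ρ z` and `G y` controls the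
  -- average. Otherwise `B(z, 9s)` contains `u`, since `2r + 6r + s ≤ 9s`; its average is at most
  -- `l` if it is subcritical and is controlled by `G y` if not.
  rcases hcase with hcase | ⟨u, hu, hul⟩
  · have ha : 1 / (C₀ * (2 * C₀ / b + 1)) * ρ z ≤ s := by
      rw [one_div, ← div_eq_inv_mul, div_le_iff₀ (by linarith)]
      have h1 := hρC y z
      have h2 := hρC x y
      have h3 := mem_ball.1 hyz
      have h4 := mem_ball'.1 hy
      have hC2 : 1 ≤ C₀ ^ 2 := one_le_pow₀ hC₀
      have hb1 : b ≤ 1 / 32 := by nlinarith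
      have h5 : dist x y ≤ ρ x := by nlinarith [hρ x]
      have h6 : ρ y ≤ 2 * C₀ * ρ x := by nlinarith
      have h7 : ρ x ≤ s / b := by
        rw [le_div_iff₀ hb]
        linarith
      have h8 : ρ y ≤ 2 * C₀ * (s / b) := h6.trans (by gcongr)
      calc ρ z ≤ C₀ * (ρ y + dist y z) := h1
        _ ≤ C₀ * (2 * C₀ * (s / b) + s) := by gcongr
        _ = s * (C₀ * (2 * C₀ / b + 1)) := by ring
    have h1 := hFG.laverage_le hρ hθ (one_div_pos.2 (by linarith))
      (div_le_one_of_le₀ hc1 (by linarith)) hs hyz ha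
    rw [one_div_one_div] at h1
    refine h1.trans (le_trans ?_ (hG.trans hlt'))
    refine le_trans ?_ (le_mul_of_one_le_left zero_le h9)
    gcongr
    have := critPsi_le_of_le hρ hθ (x := z) (K := 9) hs.le (by linarith)
    norm_num at this
    exact this
  · have hsub : ball z s ⊆ ball z (9 * s) := ball_subset_ball (by linarith)
    have h1 := laverage_ball_le F hs (by norm_num : (0 : ℝ) < 9) le_rfl hsub
    refine h1.trans ?_
    rcases lt_or_ge (9 * s) (ρ z) with h9s | h9s
    · have hu9 : u ∈ ball z (9 * s) := by
        have h2 := mem_ball.1 hu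
        have h3 := mem_ball'.1 hy
        have h4 := mem_ball.1 hyz
        have h5 := dist_triangle4 u x y z
        rw [mem_ball]
        linarith
      refine le_trans ?_ hlt
      gcongr
      exact (le_locMaximal F (by linarith) hu9 h9s).trans hul
    · have h2 := hFG.laverage_le hρ hθ (one_div_pos.2 (by linarith))
        (div_le_one_of_le₀ hc1 (by linarith)) (by linarith : 0 < 9 * s) (hsub hyz)
        (le_trans (mul_le_of_le_one_left (hρ z).le (div_le_one_of_le₀ hc1 (by linarith))) h9s)
      rw [one_div_one_div] at h2
      refine le_trans ?_ (hG.trans hlt')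
      gcongr
      refine h2.trans ?_
      gcongr
      have := critPsi_le_of_le hρ hθ (x := z) (K := 9) (by linarith : 0 ≤ 9 * s) (by linarith)
      norm_num at this
      exact this

/-- The splitting of `F` on a Whitney ball, at a point where `G` is small. -/
theorem exists_split (hρ : ∀ x, 0 < ρ x) (hθ : 0 ≤ θ)
    (hFG : LocalSplitting ρ θ P τ b w K F G) (hP : 0 < P) {C₀ : ℝ} (hC₀ : 1 ≤ C₀)
    (hρC : ∀ x y, ρ y ≤ C₀ * (ρ x + dist x y)) (hb : 0 < b) (hbC : 32 * b * C₀ ^ 2 ≤ 1)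
    (hτ : 8 ≤ τ) (hτb : τ * b ≤ 1)
    {l : ℝ≥0∞} {x y : Eucl n} {r : ℝ} (hr : 0 < r) (hrb : r ≤ b * ρ x)
    (hcase : r = b * ρ x ∨ ∃ u ∈ ball x (2 * r), locMaximal ρ F u ≤ l)
    (hy : y ∈ ball x (6 * r))
    (hG : ENNReal.ofReal (2 ^ n) * ENNReal.ofReal (2 ^ θ) * (ENNReal.ofReal (2 ^ θ) * K * G y) +
      G y ≤ l) :
    ∃ g h : Eucl n → ℝ≥0∞, Measurable g ∧ Measurable h ∧
      (∀ᵐ y ∂(volume.restrict (ball x (τ * r))), F y ≤ g y + h y) ∧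
      ∫⁻ y in ball x (τ * r), g y ≤ ENNReal.ofReal (2 ^ θ) * (ENNReal.ofReal ((1 / b) ^ n) *
        ENNReal.ofReal (2 ^ θ) * K * G y) * volume (ball x (τ * r)) ∧
      ∫⁻ y in ball x (τ * r), h y ^ P ∂(volume.withDensity w) ≤
        K * ((2 * l) ^ P * volume.withDensity w (ball x (τ * r))) := by
  have hb1 : b ≤ 1 := by nlinarith
  have hτr : 0 < τ * r := by positivity
  have hτρ : τ * r ≤ ρ x := by
    have := hρ x
    calc τ * r ≤ τ * (b * ρ x) := by gcongr
      _ = (τ * b) * ρ x := by ring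
      _ ≤ 1 * ρ x := by gcongr
      _ = ρ x := one_mul _
  have hV0 := volume_ball_pos x hτr
  have hVt := volume_ball_ne_top x (τ * r)
  rcases hcase with hcase | ⟨u, hu, hul⟩
  -- At radius `b ρ x` the averages of `F` itself are controlled by `G`, so no second part is
  -- needed.
  · refine ⟨F, 0, hFG.measurable, measurable_const, Filter.Eventually.of_forall fun y => by simp,
      ?_, by simp [hP]⟩
    have hyτ : y ∈ ball x (τ * r) := ball_subset_ball (by nlinarith) hy
    have h1 := hFG.laverage_le hρ hθ hb hb1 hτr hyτ (by nlinarith)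
    rw [setLAverage_eq, ENNReal.div_le_iff hV0 hVt] at h1
    refine h1.trans ?_
    gcongr
    have := critPsi_le_of_le hρ hθ (x := x) (K := 1) hτr.le (by linarith)
    norm_num at this
    exact this
  · obtain ⟨g, h, hg, hh, hle, hgG, hhG⟩ := hFG.split x r hr hrb
    refine ⟨g, h, hg, hh, hle, ?_, ?_⟩
    · have h1 := hgG y hy
      rw [setLAverage_eq, ENNReal.div_le_iff hV0 hVt] at h1
      refine h1.trans ?_
      have h2 : 1 ≤ ENNReal.ofReal ((2 : ℝ) ^ θ) := ENNReal.one_le_ofReal_rpow (by norm_num) hθ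
      have h3 : 1 ≤ ENNReal.ofReal ((1 / b) ^ n) := ENNReal.one_le_ofReal_pow
        (by rwa [le_div_iff₀ hb, one_mul]) n
      refine mul_le_mul' ?_ le_rfl
      calc K * G y = 1 * (1 * 1 * K * G y) := by simp
        _ ≤ _ := by gcongr
    · refine (hhG u hu y hy).trans ?_
      gcongr
      -- Here `dist u y ≤ 8 b ρ x` and `ρ x ≤ 2 C₀ ρ u`, which explains the condition `32 b C₀² ≤
      -- 1`.
      have huy : 2 * C₀ * dist u y ≤ ρ u := by
        have h2 := mem_ball.1 hu
        have h3 := mem_ball'.1 hy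
        have h5 := dist_triangle u x y
        have h6 := hρC u x
        have h7 : dist u y ≤ 8 * b * ρ x := by linarith
        have h8 : ρ x ≤ C₀ * (ρ u + 2 * (b * ρ x)) := h6.trans (by gcongr; linarith)
        have h9 : ρ x ≤ 2 * C₀ * ρ u := by nlinarith [hρ x, hρ u]
        calc 2 * C₀ * dist u y ≤ 2 * C₀ * (8 * b * (2 * C₀ * ρ u)) := by
              gcongr
              exact h7.trans (by gcongr)
          _ = (32 * b * C₀ ^ 2) * ρ u := by ring
          _ ≤ 1 * ρ u := by
              have := hρ u
              gcongr
          _ = ρ u := one_mul _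
      calc critMaximal ρ θ F u + G y ≤ (locMaximal ρ F u + ENNReal.ofReal (2 ^ n) *
            ENNReal.ofReal (2 ^ θ) * (ENNReal.ofReal (2 ^ θ) * K * G y)) + G y := by
            gcongr
            exact hFG.critMaximal_le hρ hθ hC₀ hρC huy
        _ ≤ l + l := by
            rw [add_assoc]
            exact add_le_add hul hG
        _ = 2 * l := (two_mul l).symm

end LocalSplitting

/-- If `F ≤ g + h` on a ball containing `B(z, s)`, a large average of `F` over `B(z, s)` makes one
of the maximal functions of `g` and `h` large. -/
theorem lt_critMaximal_or_lt {θ : ℝ} (hρ : ∀ x, 0 < ρ x) (hθ : 0 ≤ θ) {F g h : Eucl n → ℝ≥0∞}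
    (hg : Measurable g) {B : Set (Eucl n)} (hB : MeasurableSet B)
    (hF : ∀ᵐ y ∂(volume.restrict B), F y ≤ g y + h y) {z y : Eucl n} {s : ℝ} (hs : 0 < s)
    (hsρ : s < ρ z) (hsub : ball z s ⊆ B) (hy : y ∈ ball z s) {t : ℝ≥0∞}
    (ht : t < ⨍⁻ y in ball z s, F y ∂volume) :
    (2 * ENNReal.ofReal (2 ^ θ))⁻¹ * t < critMaximal ρ θ (B.indicator g) y ∨
      (2 * ENNReal.ofReal (2 ^ θ))⁻¹ * t < critMaximal ρ θ (B.indicator h) y := by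
  by_contra! hcon
  obtain ⟨h1, h2⟩ := hcon
  have hψ : critPsi ρ θ z s ≤ ENNReal.ofReal (2 ^ θ) := by
    have := critPsi_le_of_le hρ hθ (x := z) (K := 1) hs.le (by linarith)
    norm_num at this
    exact this
  have hψ0 := critPsi_ne_zero hρ θ z hs.le
  have hψt := critPsi_ne_top (ρ := ρ) θ z s
  have hone : ∀ f : Eucl n → ℝ≥0∞, ⨍⁻ y in ball z s, f y ∂volume ≤
      ENNReal.ofReal (2 ^ θ) * critMaximal ρ θ f y := by
    intro f
    have h3 := le_critMaximalOf (ρ := ρ) (μ := volume) θ f hs hy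
    calc ⨍⁻ y in ball z s, f y ∂volume
        = critPsi ρ θ z s * ((critPsi ρ θ z s)⁻¹ * ⨍⁻ y in ball z s, f y ∂volume) := by
          rw [← mul_assoc, ENNReal.mul_inv_cancel hψ0 hψt, one_mul]
      _ ≤ _ := mul_le_mul' hψ h3
  have h20 : 2 * ENNReal.ofReal (2 ^ θ) ≠ 0 := by
    have : (0 : ℝ) < 2 ^ θ := by positivity
    simp [this]
  refine absurd ht (not_lt.2 ?_)
  calc ⨍⁻ y in ball z s, F y ∂volume
      ≤ ⨍⁻ y in ball z s, (B.indicator g y + B.indicator h y) ∂volume := by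
        rw [setLAverage_eq, setLAverage_eq]
        gcongr ?_ / _
        refine lintegral_mono_ae ?_
        filter_upwards [ae_restrict_of_ae_restrict_of_subset hsub hF,
          ae_restrict_mem measurableSet_ball] with v hv hvs
        rwa [Set.indicator_of_mem (hsub hvs), Set.indicator_of_mem (hsub hvs)]
    _ = (⨍⁻ y in ball z s, B.indicator g y ∂volume) + ⨍⁻ y in ball z s, B.indicator h y ∂volume :=
        lintegral_add_left (hg.indicator hB) _
    _ ≤ ENNReal.ofReal (2 ^ θ) * ((2 * ENNReal.ofReal (2 ^ θ))⁻¹ * t) +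
        ENNReal.ofReal (2 ^ θ) * ((2 * ENNReal.ofReal (2 ^ θ))⁻¹ * t) := by
        refine add_le_add ((hone _).trans ?_) ((hone _).trans ?_)
        · exact mul_le_mul' le_rfl h1
        · exact mul_le_mul' le_rfl h2
    _ = (2 * ENNReal.ofReal (2 ^ θ)) * (2 * ENNReal.ofReal (2 ^ θ))⁻¹ * t := by ring
    _ = t := by rw [ENNReal.mul_inv_cancel h20 (by finiteness), one_mul]

/-- The averaged good-`λ` inequality on a Whitney ball. -/
theorem CritMuckenhoupt.exists_sum_measure_ball_le {θ₀ θ P P' τ b C₀ : ℝ} {C : ℝ≥0}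
    {w σ : Eucl n → ℝ≥0∞} (hρ : ∀ x, 0 < ρ x) (hC₀ : 1 ≤ C₀)
    (hρC : ∀ x y, ρ y ≤ C₀ * (ρ x + dist x y)) (hw : CritMuckenhoupt ρ θ₀ P P' C w σ)
    (hθ : 0 ≤ θ) (hb : 0 < b) (hbC : 32 * b * C₀ ^ 2 ≤ 1) (hτ : 8 ≤ τ) (hτb : 4 * C₀ * τ * b ≤ 1)
    (hM : ∃ K : ℝ≥0, ∀ g : Eucl n → ℝ≥0∞, Measurable g →
      ∫⁻ x, critMaximal ρ θ g x ^ P ∂(volume.withDensity w) ≤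
        K * ∫⁻ x, g x ^ P ∂(volume.withDensity w)) (K : ℝ≥0) :
    ∃ (j₀ : ℕ) (K' : ℝ≥0), ∀ N : ℕ, ∃ γ : ℝ≥0, γ ≠ 0 ∧ ∀ F G : Eucl n → ℝ≥0∞,
      LocalSplitting ρ θ P τ b w K F G → ∀ l : ℝ≥0∞, l ≠ 0 → l ≠ ∞ → ∀ x r, 0 < r → r ≤ b * ρ x →
      (r = b * ρ x ∨ ∃ u ∈ ball x (2 * r), locMaximal ρ F u ≤ l) →
      ∑ j ∈ Finset.range N, dyad (j₀ + j : ℕ) ^ P * volume.withDensity w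
        (ball x (6 * r) ∩ {y | dyad (j₀ + j : ℕ) * l < locMaximal ρ F y ∧ G y ≤ γ * l}) ≤
      K' * volume.withDensity w (ball x r) := by
  have hP := hw.conj.pos
  have hPn : ∀ k : ℤ, dyad k ^ P ≠ ∞ := fun k =>
    ENNReal.rpow_ne_top_of_nonneg hP.le (dyad_ne_top k)
  obtain ⟨KM, hKM⟩ := hM
  obtain ⟨CP, hCP⟩ := tsum_le_lintegral_rpow hP
  obtain ⟨D, hD⟩ := hw.exists_local_doubling hρ 1 (c := τ) (by linarith)
  have hτb1 : τ * b ≤ 1 := by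
    have : 0 ≤ τ * b := by positivity
    nlinarith
  -- The levels start at `2^j₀ ≥ 9^n`, as `exists_small_ball` requires.
  obtain ⟨j₀, hj₀⟩ : ∃ j₀ : ℕ, (ENNReal.ofReal (9 ^ n)) ≤ dyad j₀ := by
    obtain ⟨j, hj⟩ := pow_unbounded_of_one_lt ((9 : ℝ) ^ n) (by norm_num : (1 : ℝ) < 2)
    refine ⟨j, ?_⟩
    rw [dyad_natCast]
    have h2 : (2 : ℝ≥0∞) = ENNReal.ofReal 2 := by simp
    rw [h2, ← ENNReal.ofReal_pow (by norm_num)]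
    exact ENNReal.ofReal_le_ofReal hj.le
  set c : ℝ≥0∞ := (2 * ENNReal.ofReal (2 ^ θ))⁻¹ with hc
  have hc0 : c ≠ 0 := ENNReal.inv_ne_zero.2 (by finiteness)
  have hct : c ≠ ∞ := by
    refine ENNReal.inv_ne_top.2 ?_
    have : (0 : ℝ) < 2 ^ θ := by positivity
    simp [this]
  -- The 1 is for the part of `g`, the rest for that of `h` over all levels together. Nothing here
  -- depends on `N`, which is what makes absorption possible.
  set K₁ : ℝ≥0∞ := 1 + CP * (c⁻¹ ^ P * (KM * (K * 2 ^ P))) with hK₁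
  have hK₁t : K₁ ≠ ∞ := by
    have h1 : c⁻¹ ^ P ≠ ∞ := ENNReal.rpow_ne_top_of_nonneg hP.le (ENNReal.inv_ne_top.2 hc0)
    have h2 : (2 : ℝ≥0∞) ^ P ≠ ∞ := ENNReal.rpow_ne_top_of_nonneg hP.le (by finiteness)
    finiteness
  refine ⟨j₀, (K₁ * D).toNNReal, fun N => ?_⟩
  -- Inverse of the total weight of the `N` levels, so that the part of `g` contributes at most
  -- `w(B)` altogether. Thus `ε` and `γ` depend on `N`, but the final constant does not.
  set δ : ℝ≥0∞ := (∑ j ∈ Finset.range N, dyad (j₀ + j : ℕ) ^ P)⁻¹ with hδ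
  have hδ0 : δ ≠ 0 := ENNReal.inv_ne_zero.2 (ENNReal.sum_ne_top.2 fun j _ => hPn _)
  obtain ⟨ε, hε0, hε⟩ := hw.exists_measure_le hρ hC₀ hρC hδ0
  set Z₁ : ℝ≥0∞ := ENNReal.ofReal (9 ^ n) * (ENNReal.ofReal (10 ^ θ) *
      (ENNReal.ofReal ((C₀ * (2 * C₀ / b + 1)) ^ n) * ENNReal.ofReal (2 ^ θ) * K)) with hZ₁
  set Z₂ : ℝ≥0∞ := ENNReal.ofReal (2 ^ n) * ENNReal.ofReal (2 ^ θ) * (ENNReal.ofReal (2 ^ θ) * K)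
    with hZ₂
  set Z₃ : ℝ≥0∞ := ENNReal.ofReal (2 ^ θ) * (ENNReal.ofReal ((1 / b) ^ n) *
        ENNReal.ofReal (2 ^ θ) * K) with hZ₃
  set Z : ℝ≥0∞ := Z₁ + (Z₂ + 1) + 6 ^ n * Z₃ with hZ
  have hZ0 : Z ≠ 0 := by simp [hZ]
  have hZt : Z ≠ ∞ := by finiteness
  -- Small enough for three purposes: the hypotheses on `G` in `exists_small_ball` (`Z₁`) and in
  -- `exists_split` (`Z₂ + 1`), and the weak type bound that places `|E ∩ B|` below `ε |B|` (`6^n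
  -- Z₃`).
  set γ : ℝ≥0∞ := min 1 (c * ε) / Z with hγ
  have hγt : γ ≠ ∞ := ENNReal.div_ne_top (ne_top_of_le_ne_top ENNReal.one_ne_top (min_le_left _ _)) hZ0
  have hmin0 : min 1 (c * (ε : ℝ≥0∞)) ≠ 0 := by
    have : c * (ε : ℝ≥0∞) ≠ 0 := mul_ne_zero hc0 (by exact_mod_cast hε0)
    exact (lt_min one_pos (pos_iff_ne_zero.2 this)).ne'
  have hγ0 : γ ≠ 0 := by
    rw [hγ, Ne, ENNReal.div_eq_zero_iff, not_or]
    exact ⟨hmin0, hZt⟩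
  have hZγ : Z * γ = min 1 (c * ε) := by rw [hγ, ENNReal.mul_div_cancel hZ0 hZt]
  refine ⟨γ.toNNReal, ?_, fun F G hFG l hl0 hlt x r hr hrb hcase => ?_⟩
  · rw [ne_eq, ENNReal.toNNReal_eq_zero_iff, not_or]
    exact ⟨hγ0, hγt⟩
  rw [ENNReal.coe_toNNReal hγt, ENNReal.coe_toNNReal (by finiteness)]
  by_cases hex : ∃ y ∈ ball x (6 * r), G y ≤ γ * l
  swap
  · refine le_trans (le_of_eq (Finset.sum_eq_zero fun j _ => ?_)) zero_le
    have : ball x (6 * r) ∩ {y | dyad (j₀ + j : ℕ) * l < locMaximal ρ F y ∧ G y ≤ γ * l} = ∅ := by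
      refine Set.eq_empty_iff_forall_notMem.2 fun y hy => hex ⟨y, hy.1, hy.2.2⟩
    rw [this, measure_empty, mul_zero]
  have hsmall : ∀ z : ℝ≥0∞, z ≤ Z → ∀ y, G y ≤ γ * l → z * G y ≤ l := by
    intro z hz y hy
    calc z * G y ≤ Z * (γ * l) := mul_le_mul' hz hy
      _ = min 1 (c * ε) * l := by rw [← mul_assoc, hZγ]
      _ ≤ 1 * l := by gcongr; exact min_le_left _ _
      _ = l := one_mul l
  obtain ⟨y₀, hy₀, hGy₀⟩ := hex
  have hG₂ := hsmall (Z₂ + 1) (by rw [hZ]; exact le_add_right le_add_self) y₀ hGy₀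
  obtain ⟨g, h, hg, hh, hle, hgG, hhG⟩ := hFG.exists_split hρ hθ hP hC₀ hρC hb hbC hτ hτb1 hr hrb
    hcase hy₀ (by
      refine le_trans (le_of_eq ?_) hG₂
      rw [hZ₂]
      ring)
  set B := ball x (τ * r) with hB
  have hτr : 0 < τ * r := by positivity
  have hτρ : 4 * C₀ * (τ * r) ≤ ρ x := by
    have := hρ x
    calc 4 * C₀ * (τ * r) ≤ 4 * C₀ * (τ * (b * ρ x)) := by gcongr
      _ = (4 * C₀ * τ * b) * ρ x := by ring
      _ ≤ 1 * ρ x := by gcongr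
      _ = ρ x := one_mul _
  have hτρ1 : τ * r ≤ 1 * ρ x := by nlinarith
  set E : Set (Eucl n) := {y | c * l < critMaximal ρ θ (B.indicator g) y} with hE
  have hEm : MeasurableSet E :=
    (isOpen_lt_critMaximalOf (μ := volume) θ (B.indicator g) (c * l)).measurableSet
  have hEvol : volume (E ∩ B) ≤ ε * volume B := by
    have h1 := (critDoubling_volume hρ hθ).mul_measure_le hρ (B.indicator g) (c * l)
    have hcl0 : c * l ≠ 0 := mul_ne_zero hc0 hl0
    have hclt : c * l ≠ ∞ := ENNReal.mul_ne_top hct hlt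
    refine (measure_mono Set.inter_subset_left).trans ?_
    refine (ENNReal.mul_le_mul_iff_right hcl0 hclt).1 (h1.trans ?_)
    rw [lintegral_indicator measurableSet_ball]
    push_cast
    calc 6 ^ n * ∫⁻ y in B, g y ≤ 6 ^ n * (ENNReal.ofReal (2 ^ θ) * (ENNReal.ofReal ((1 / b) ^ n) *
        ENNReal.ofReal (2 ^ θ) * K * G y₀) * volume B) := by gcongr
      _ = (6 ^ n * Z₃) * G y₀ * volume B := by
          rw [hZ₃]
          ring
      _ ≤ Z * (γ * l) * volume B := by
          gcongr
          rw [hZ]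
          exact le_add_self
      _ = (Z * γ) * l * volume B := by ring
      _ ≤ c * ε * l * volume B := by
          rw [hZγ]
          gcongr
          exact min_le_right _ _
      _ = _ := by ring
  have hEw : volume.withDensity w (E ∩ B) ≤ δ * volume.withDensity w B :=
    hε x (τ * r) hτr hτρ (E ∩ B) (hEm.inter measurableSet_ball) Set.inter_subset_right hEvol
  have hsub : ∀ j : ℕ, ball x (6 * r) ∩ {y | dyad (j₀ + j : ℕ) * l < locMaximal ρ F y ∧
      G y ≤ γ * l} ⊆ (E ∩ B) ∪
        {y | (c * l) * dyad (j₀ + j : ℕ) < critMaximal ρ θ (B.indicator h) y} := by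
    rintro j y ⟨hy, hyl, hyG⟩
    have hdj : dyad j₀ ≤ dyad (j₀ + j : ℕ) := dyad_mono (by push_cast; omega)
    have hG₁ := hsmall Z₁ (by rw [hZ]; exact le_add_right le_self_add) y hyG
    obtain ⟨z, s, hs, hsr, hsρ, hyz, hav⟩ := hFG.exists_small_ball hρ hθ hC₀ hρC hb hbC hr hrb hcase
      hy (t := dyad (j₀ + j : ℕ) * l) (mul_le_mul' (hj₀.trans hdj) le_rfl) (by
        refine le_trans (le_of_eq ?_) hG₁
        rw [hZ₁]
        ring) hyl
    have hzB : ball z s ⊆ B := by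
      refine ball_subset_ball' ?_
      have h1 := mem_ball'.1 hyz
      have h2 := mem_ball.1 hy
      have h3 := dist_triangle z y x
      nlinarith
    rcases lt_critMaximal_or_lt hρ hθ hg measurableSet_ball hle hs hsρ hzB hyz hav with h1 | h1
    · left
      refine ⟨lt_of_le_of_lt ?_ h1, hzB hyz⟩
      refine mul_le_mul' le_rfl (le_mul_of_one_le_left zero_le ?_)
      rw [← dyad_zero]
      exact dyad_mono (by positivity)
    · right
      rw [Set.mem_ofPred_eq, mul_assoc, mul_comm l]
      exact h1
  -- The key point: the levels are summed before estimating, so the layer cake and the bound for the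
  -- maximal function on `L^P(w)` replace `N` separate Chebyshev inequalities, without a factor `N`.
  have hH : ∑ j ∈ Finset.range N, dyad (j₀ + j : ℕ) ^ P * volume.withDensity w
      {y | (c * l) * dyad (j₀ + j : ℕ) < critMaximal ρ θ (B.indicator h) y} ≤
      CP * (c⁻¹ ^ P * (KM * (K * 2 ^ P))) * volume.withDensity w B := by
    have hcl0 : c * l ≠ 0 := mul_ne_zero hc0 hl0
    have hclt : c * l ≠ ∞ := ENNReal.mul_ne_top hct hlt
    have hinj : Function.Injective fun j : ℕ => ((j₀ + j : ℕ) : ℤ) := by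
      intro i j hij
      simpa using hij
    calc ∑ j ∈ Finset.range N, dyad (j₀ + j : ℕ) ^ P * volume.withDensity w
          {y | (c * l) * dyad (j₀ + j : ℕ) < critMaximal ρ θ (B.indicator h) y}
        ≤ ∑' j : ℕ, dyad (j₀ + j : ℕ) ^ P * volume.withDensity w
          {y | (c * l) * dyad (j₀ + j : ℕ) < critMaximal ρ θ (B.indicator h) y} :=
          ENNReal.sum_le_tsum _
      _ ≤ ∑' k : ℤ, dyad k ^ P * volume.withDensity w
          {y | (c * l) * dyad k < critMaximal ρ θ (B.indicator h) y} :=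
          ENNReal.tsum_comp_le_tsum_of_injective hinj (fun k : ℤ => dyad k ^ P *
            volume.withDensity w {y | (c * l) * dyad k < critMaximal ρ θ (B.indicator h) y})
      _ ≤ CP * ((c * l)⁻¹ ^ P * ∫⁻ y, critMaximal ρ θ (B.indicator h) y ^ P
          ∂(volume.withDensity w)) :=
          hCP (measurable_critMaximalOf (μ := volume) θ _) (c * l) hcl0 hclt
      _ ≤ CP * ((c * l)⁻¹ ^ P * (KM * ∫⁻ y, B.indicator h y ^ P ∂(volume.withDensity w))) := by
          gcongr
          exact hKM _ (hh.indicator measurableSet_ball)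
      _ = CP * ((c * l)⁻¹ ^ P * (KM * ∫⁻ y in B, h y ^ P ∂(volume.withDensity w))) := by
          rw [← lintegral_indicator measurableSet_ball]
          congr 3
          refine lintegral_congr fun y => ?_
          by_cases hy : y ∈ ball x (τ * r) <;> simp [hB, hy, hP]
      _ ≤ CP * ((c * l)⁻¹ ^ P * (KM * (K * ((2 * l) ^ P * volume.withDensity w B)))) := by
          gcongr
      _ = CP * (c⁻¹ ^ P * (KM * (K * 2 ^ P))) * (l⁻¹ ^ P * l ^ P) * volume.withDensity w B := by
          rw [ENNReal.mul_inv (Or.inl hc0) (Or.inl hct), ENNReal.mul_rpow_of_nonneg _ _ hP.le,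
            ENNReal.mul_rpow_of_nonneg _ _ hP.le]
          ring
      _ = _ := by
          rw [← ENNReal.mul_rpow_of_nonneg _ _ hP.le, ENNReal.inv_mul_cancel hl0 hlt,
            ENNReal.one_rpow, mul_one]
  calc _ ≤ ∑ j ∈ Finset.range N, (dyad (j₀ + j : ℕ) ^ P * (δ * volume.withDensity w B) +
        dyad (j₀ + j : ℕ) ^ P * volume.withDensity w
          {y | (c * l) * dyad (j₀ + j : ℕ) < critMaximal ρ θ (B.indicator h) y}) := by
        refine Finset.sum_le_sum fun j _ => ?_
        rw [← mul_add]
        refine mul_le_mul' le_rfl ((measure_mono (hsub j)).trans ((measure_union_le _ _).trans ?_))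
        gcongr
    _ ≤ 1 * volume.withDensity w B +
        CP * (c⁻¹ ^ P * (KM * (K * 2 ^ P))) * volume.withDensity w B := by
        rw [Finset.sum_add_distrib]
        refine add_le_add ?_ hH
        rw [← Finset.sum_mul, ← mul_assoc]
        gcongr
        exact ENNReal.mul_inv_le_one _
    _ = K₁ * volume.withDensity w B := by
        rw [hK₁]
        ring
    _ ≤ K₁ * (D * volume.withDensity w (ball x r)) := by
        gcongr
        exact hD x r hr hτρ1
    _ = _ := by ring

end GoodLambdaBall

/-! ### The global good-`λ` inequality and absorption. -/

section GoodLambdaGlobal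

variable {n : ℕ} {ρ : Eucl n → ℝ}

/-- A function which is almost constant on balls of radius comparable to the critical radius. -/
def SlowlyVarying (ρ : Eucl n → ℝ) (C₀ : ℝ) (Λ : ℝ≥0) (η : Eucl n → ℝ≥0∞) : Prop :=
  ∀ x y, 2 * C₀ * dist x y ≤ ρ x → η y ≤ Λ * η x ∧ η x ≤ Λ * η y

theorem SlowlyVarying.withDensity_le {C₀ : ℝ} {Λ : ℝ≥0} {η : Eucl n → ℝ≥0∞}
    (h : SlowlyVarying ρ C₀ Λ η) (hC₀ : 1 ≤ C₀) (μ : Measure (Eucl n)) {x : Eucl n} {r : ℝ}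
    (hr : 2 * C₀ * r ≤ ρ x)
    {S : Set (Eucl n)} (hS : MeasurableSet S) (hSr : S ⊆ ball x r) :
    μ.withDensity η S ≤ Λ * η x * μ S := by
  rw [withDensity_apply _ hS, ← setLIntegral_const]
  refine setLIntegral_mono measurable_const fun y hy => (h x y (le_trans ?_ hr)).1
  have := (mem_ball'.1 (hSr hy)).le
  gcongr

theorem SlowlyVarying.le_withDensity {C₀ : ℝ} {Λ : ℝ≥0} {η : Eucl n → ℝ≥0∞}
    (hη : Measurable η) (h : SlowlyVarying ρ C₀ Λ η) (hC₀ : 1 ≤ C₀) (μ : Measure (Eucl n))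
    {x : Eucl n} {r : ℝ} (hr : 2 * C₀ * r ≤ ρ x) :
    η x * μ (ball x r) ≤ Λ * μ.withDensity η (ball x r) := by
  rw [withDensity_apply _ measurableSet_ball, ← setLIntegral_const, ← lintegral_const_mul _ hη]
  refine setLIntegral_mono (hη.const_mul _) fun y hy => (h x y (le_trans ?_ hr)).2
  have := (mem_ball'.1 hy).le
  gcongr

/-- The averaged good-`λ` inequality. -/
theorem CritMuckenhoupt.exists_sum_measure_le {θ₀ θ P P' τ b C₀ : ℝ} {C : ℝ≥0}
    {w σ : Eucl n → ℝ≥0∞} (hρ : ∀ x, 0 < ρ x) (hC₀ : 1 ≤ C₀)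
    (hρC : ∀ x y, ρ y ≤ C₀ * (ρ x + dist x y)) (hw : CritMuckenhoupt ρ θ₀ P P' C w σ)
    (hθ : 0 ≤ θ) (hb : 0 < b) (hbC : 32 * b * C₀ ^ 2 ≤ 1) (hτ : 8 ≤ τ) (hτb : 4 * C₀ * τ * b ≤ 1)
    (hM : ∃ K : ℝ≥0, ∀ g : Eucl n → ℝ≥0∞, Measurable g →
      ∫⁻ x, critMaximal ρ θ g x ^ P ∂(volume.withDensity w) ≤
        K * ∫⁻ x, g x ^ P ∂(volume.withDensity w)) (K Λ : ℝ≥0) :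
    ∃ (j₀ : ℕ) (K' : ℝ≥0), ∀ N : ℕ, ∃ γ : ℝ≥0, γ ≠ 0 ∧ ∀ F G : Eucl n → ℝ≥0∞,
      LocalSplitting ρ θ P τ b w K F G → ∀ η : Eucl n → ℝ≥0∞, Measurable η →
      SlowlyVarying ρ C₀ Λ η → ∀ l : ℝ≥0∞, l ≠ 0 → l ≠ ∞ →
      ∑ j ∈ Finset.range N, dyad (j₀ + j : ℕ) ^ P * (volume.withDensity w).withDensity η
        {y | dyad (j₀ + j : ℕ) * l < locMaximal ρ F y ∧ G y ≤ γ * l} ≤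
      K' * (volume.withDensity w).withDensity η {y | l < locMaximal ρ F y} := by
  have hP := hw.conj.pos
  obtain ⟨j₀, K₁, h₁⟩ := hw.exists_sum_measure_ball_le hρ hC₀ hρC hθ hb hbC hτ hτb hM K
  refine ⟨j₀, Λ * K₁ * Λ, fun N => ?_⟩
  obtain ⟨γ, hγ0, hγ⟩ := h₁ N
  refine ⟨γ, hγ0, fun F G hFG η hηm hη l hl0 hlt => ?_⟩
  set μ := volume.withDensity w with hμ
  set v := μ.withDensity η with hv
  set A : ℕ → Set (Eucl n) := fun j =>
    {y | dyad (j₀ + j : ℕ) * l < locMaximal ρ F y ∧ G y ≤ γ * l} with hA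
  set U : Set (Eucl n) := {y | l < locMaximal ρ F y} with hU
  have hUo : IsOpen U := isOpen_lt_locMaximal F l
  have hAm : ∀ j, MeasurableSet (A j) := fun j =>
    ((isOpen_lt_locMaximal F _).measurableSet).inter
      (measurableSet_le hFG.measurable' measurable_const)
  have hAU : ∀ j, A j ⊆ U := by
    intro j y hy
    refine lt_of_le_of_lt (le_mul_of_one_le_left zero_le ?_) hy.1
    rw [← dyad_zero]
    exact dyad_mono (by positivity)
  have hC2 : 1 ≤ C₀ ^ 2 := one_le_pow₀ hC₀
  have hbC1 : 12 * C₀ * b ≤ 1 := by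
    have : C₀ ≤ C₀ ^ 2 := by nlinarith
    have : C₀ * b ≤ C₀ ^ 2 * b := by gcongr
    nlinarith
  -- Centres are restricted to `B(0, R)` so that the Whitney radii, at most `b ρ`, are bounded, as
  -- Vitali requires; `R` tends to infinity at the end.
  have key : ∀ R : ℕ, ∑ j ∈ Finset.range N, dyad (j₀ + j : ℕ) ^ P * v (A j ∩ ball 0 R) ≤
      (Λ * K₁ * Λ : ℝ≥0) * v U := by
    intro R
    set S : Set (Eucl n × ℝ) := {a | a.1 ∈ ball (0 : Eucl n) R ∧ 0 < a.2 ∧ a.2 ≤ b * ρ a.1 ∧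
      ball a.1 a.2 ⊆ U ∧ (a.2 = b * ρ a.1 ∨ ∃ u ∈ ball a.1 (2 * a.2), locMaximal ρ F u ≤ l)} with hS
    obtain ⟨u, hu, huc, hd, hcov⟩ := exists_countable_disjoint_cover S (b * (C₀ * (ρ 0 + R))) (by
      rintro a ⟨ha, ha0, hab, -, -⟩
      refine ⟨ha0, hab.trans ?_⟩
      have h2 := hρC 0 a.1
      have h3 := (mem_ball'.1 ha).le
      gcongr
      exact h2.trans (by gcongr))
    have hsub : ∀ j, A j ∩ ball 0 R ⊆ ⋃ a ∈ u, ball a.1 (6 * a.2) ∩ A j := by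
      rintro j x ⟨hxA, hxR⟩
      obtain ⟨r, hr, hrb, hrU, hcase⟩ := exists_whitney_radius hUo (hAU j hxA)
        (mul_pos hb (hρ x))
      obtain ⟨a, ha, hsub⟩ := hcov (x, r) ⟨hxR, hr, hrb, hrU, hcase.imp_right fun ⟨z, hz, hzU⟩ =>
        ⟨z, hz, not_lt.1 hzU⟩⟩
      exact Set.mem_biUnion ha ⟨hsub (mem_ball_self hr), hxA⟩
    have hrad : ∀ a ∈ u, 2 * C₀ * (6 * a.2) ≤ ρ a.1 := by
      intro a ha
      obtain ⟨-, -, hab, -, -⟩ := hu ha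
      calc 2 * C₀ * (6 * a.2) ≤ 2 * C₀ * (6 * (b * ρ a.1)) := by gcongr
        _ = (12 * C₀ * b) * ρ a.1 := by ring
        _ ≤ 1 * ρ a.1 := by
            have := hρ a.1
            gcongr
        _ = ρ a.1 := one_mul _
    -- On each ball `η` is replaced by its value at the centre and later restored, at the cost of
    -- `Λ` each time. The selected balls are disjoint and contained in `U`, so the right side sums.
    calc ∑ j ∈ Finset.range N, dyad (j₀ + j : ℕ) ^ P * v (A j ∩ ball 0 R)
        ≤ ∑ j ∈ Finset.range N, dyad (j₀ + j : ℕ) ^ P *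
          ∑' a : u, (Λ * η a.1.1 * μ (ball a.1.1 (6 * a.1.2) ∩ A j)) := by
          refine Finset.sum_le_sum fun j _ => mul_le_mul' le_rfl ?_
          refine ((measure_mono (hsub j)).trans (measure_biUnion_le v huc _)).trans ?_
          exact ENNReal.tsum_le_tsum fun a => hη.withDensity_le hC₀ μ (hrad a.1 a.2)
            (measurableSet_ball.inter (hAm j)) Set.inter_subset_left
      _ = ∑' a : u, Λ * η a.1.1 * ∑ j ∈ Finset.range N, dyad (j₀ + j : ℕ) ^ P *
          μ (ball a.1.1 (6 * a.1.2) ∩ A j) := by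
          simp_rw [← ENNReal.tsum_mul_left]
          rw [← Summable.tsum_finsetSum fun _ _ => ENNReal.summable]
          refine tsum_congr fun a => ?_
          rw [Finset.mul_sum]
          refine Finset.sum_congr rfl fun j _ => ?_
          ring
      _ ≤ ∑' a : u, Λ * η a.1.1 * (K₁ * μ (ball a.1.1 a.1.2)) := by
          refine ENNReal.tsum_le_tsum fun a => mul_le_mul' le_rfl ?_
          obtain ⟨-, ha0, hab, -, hcase⟩ := hu a.2
          exact hγ F G hFG l hl0 hlt a.1.1 a.1.2 ha0 hab hcase
      _ ≤ ∑' a : u, (Λ * K₁ * Λ : ℝ≥0) * v (ball a.1.1 a.1.2) := by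
          refine ENNReal.tsum_le_tsum fun a => ?_
          obtain ⟨-, ha0, -, -, -⟩ := hu a.2
          have h1 := hη.le_withDensity hηm hC₀ μ (x := a.1.1) (r := a.1.2) (by
            have := hrad a.1 a.2
            nlinarith)
          calc Λ * η a.1.1 * (K₁ * μ (ball a.1.1 a.1.2))
              = Λ * K₁ * (η a.1.1 * μ (ball a.1.1 a.1.2)) := by ring
            _ ≤ Λ * K₁ * (Λ * v (ball a.1.1 a.1.2)) := by gcongr
            _ = _ := by
                push_cast
                ring
      _ = (Λ * K₁ * Λ : ℝ≥0) * v (⋃ a ∈ u, ball a.1 a.2) := by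
          rw [ENNReal.tsum_mul_left, measure_biUnion huc hd fun _ _ => measurableSet_ball]
      _ ≤ _ := by
          gcongr
          exact Set.iUnion₂_subset fun a ha => (hu ha).2.2.2.1
  have hlim : ∀ j, Filter.Tendsto (fun R : ℕ => v (A j ∩ ball 0 R)) Filter.atTop (nhds (v (A j))) := by
    intro j
    have h1 : Monotone fun R : ℕ => A j ∩ ball 0 R := fun R R' hR =>
      Set.inter_subset_inter_right _ (ball_subset_ball (by exact_mod_cast hR))
    have h2 := tendsto_measure_iUnion_atTop (μ := v) h1
    rwa [← Set.inter_iUnion, iUnion_ball_nat, Set.inter_univ] at h2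
  refine le_of_tendsto' (tendsto_finsetSum _ fun j _ => ENNReal.Tendsto.const_mul (hlim j)
    (Or.inr ?_)) key
  exact ENNReal.rpow_ne_top_of_nonneg hP.le (dyad_ne_top _)

/-- Absorption. Let `s` be the layer-cake sum of `locMaximal ρ F` over the levels up to `2^L`.
Summing the good-`λ` inequality over these levels gives `N s ≤ K₁ s + A ∑ g`. Finite total mass
makes `s` finite, so `N ≥ K₁ + 1` leaves `s ≤ A ∑ g`, uniformly in `L`. -/
theorem CritMuckenhoupt.exists_lintegral_rpow_le_of_finite {θ₀ θ P P' τ b C₀ : ℝ} {C : ℝ≥0}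
    {w σ : Eucl n → ℝ≥0∞} (hρ : ∀ x, 0 < ρ x) (hC₀ : 1 ≤ C₀)
    (hρC : ∀ x y, ρ y ≤ C₀ * (ρ x + dist x y)) (hw : CritMuckenhoupt ρ θ₀ P P' C w σ)
    (hθ : 0 ≤ θ) (hb : 0 < b) (hbC : 32 * b * C₀ ^ 2 ≤ 1) (hτ : 8 ≤ τ) (hτb : 4 * C₀ * τ * b ≤ 1)
    (hM : ∃ K : ℝ≥0, ∀ g : Eucl n → ℝ≥0∞, Measurable g →
      ∫⁻ x, critMaximal ρ θ g x ^ P ∂(volume.withDensity w) ≤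
        K * ∫⁻ x, g x ^ P ∂(volume.withDensity w)) (K Λ : ℝ≥0) :
    ∃ K' : ℝ≥0, ∀ F G : Eucl n → ℝ≥0∞,
      LocalSplitting ρ θ P τ b w K F G → ∫⁻ x, F x ≠ ∞ → ∀ η : Eucl n → ℝ≥0∞, Measurable η →
      SlowlyVarying ρ C₀ Λ η → (volume.withDensity w).withDensity η Set.univ ≠ ∞ →
      ∫⁻ x, F x ^ P ∂((volume.withDensity w).withDensity η) ≤
        K' * ∫⁻ x, G x ^ P ∂((volume.withDensity w).withDensity η) := by
  have hP := hw.conj.pos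
  have h2P : (2 : ℝ≥0∞) ^ P ≠ ∞ := ENNReal.rpow_ne_top_of_nonneg hP.le (by finiteness)
  obtain ⟨CP, hCP⟩ := tsum_le_lintegral_rpow hP
  obtain ⟨CL, hCL⟩ := tsum_dyad_rpow_le P hP
  obtain ⟨j₀, K₁, h₁⟩ := hw.exists_sum_measure_le hρ hC₀ hρC hθ hb hbC hτ hτb hM K Λ
  obtain ⟨N, hN⟩ : ∃ N : ℕ, K₁ + 1 ≤ (N : ℝ≥0) := exists_nat_ge _
  obtain ⟨γ, hγ0, hγ⟩ := h₁ N
  set A : ℝ≥0∞ := ∑ j ∈ Finset.range N, dyad (j₀ + j : ℕ) ^ P with hA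
  have hAt : A ≠ ∞ := ENNReal.sum_ne_top.2 fun j _ =>
    ENNReal.rpow_ne_top_of_nonneg hP.le (dyad_ne_top _)
  have hγe : (γ : ℝ≥0∞) ≠ 0 := by exact_mod_cast hγ0
  have hγi : (γ : ℝ≥0∞)⁻¹ ^ P ≠ ∞ :=
    ENNReal.rpow_ne_top_of_nonneg hP.le (ENNReal.inv_ne_top.2 hγe)
  set K' : ℝ≥0∞ := 2 ^ P * (A * (CP * (γ : ℝ≥0∞)⁻¹ ^ P)) with hK'
  have hK't : K' ≠ ∞ := by finiteness
  refine ⟨K'.toNNReal, fun F G hFG hFt η hηm hη hfin => ?_⟩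
  rw [ENNReal.coe_toNNReal hK't]
  set v := (volume.withDensity w).withDensity η with hv
  set a : ℤ → ℝ≥0∞ := fun k => dyad k ^ P * v {y | dyad k < locMaximal ρ F y} with ha
  set g : ℤ → ℝ≥0∞ := fun k => dyad k ^ P * v {y | γ * dyad k < G y} with hg
  have hgood : ∀ k : ℤ, ∑ j ∈ Finset.range N, a (k + (j₀ + j : ℕ)) ≤ K₁ * a k + A * g k := by
    intro k
    have h2 := hγ F G hFG η hηm hη (dyad k) (dyad_ne_zero k) (dyad_ne_top k)
    calc ∑ j ∈ Finset.range N, a (k + (j₀ + j : ℕ))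
        ≤ ∑ j ∈ Finset.range N, (dyad k ^ P * (dyad (j₀ + j : ℕ) ^ P *
          v {y | dyad (j₀ + j : ℕ) * dyad k < locMaximal ρ F y ∧ G y ≤ γ * dyad k}) +
          dyad (j₀ + j : ℕ) ^ P * g k) := by
          refine Finset.sum_le_sum fun j _ => ?_
          have hsub : {y | dyad (k + (j₀ + j : ℕ)) < locMaximal ρ F y} ⊆
              {y | dyad (j₀ + j : ℕ) * dyad k < locMaximal ρ F y ∧ G y ≤ γ * dyad k} ∪
              {y | γ * dyad k < G y} := by
            intro y hy
            rw [Set.mem_ofPred_eq, dyad_add, mul_comm] at hy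
            rcases le_or_gt (G y) (γ * dyad k) with h | h
            · exact Or.inl ⟨hy, h⟩
            · exact Or.inr h
          calc a (k + (j₀ + j : ℕ)) ≤ (dyad k * dyad (j₀ + j : ℕ)) ^ P *
              (v {y | dyad (j₀ + j : ℕ) * dyad k < locMaximal ρ F y ∧ G y ≤ γ * dyad k} +
              v {y | γ * dyad k < G y}) := by
                rw [← dyad_add]
                exact mul_le_mul' le_rfl ((measure_mono hsub).trans (measure_union_le _ _))
            _ = _ := by
                rw [ENNReal.mul_rpow_of_nonneg _ _ hP.le]
                simp only [hg]
                ring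
      _ = dyad k ^ P * (∑ j ∈ Finset.range N, dyad (j₀ + j : ℕ) ^ P *
          v {y | dyad (j₀ + j : ℕ) * dyad k < locMaximal ρ F y ∧ G y ≤ γ * dyad k}) + A * g k := by
          rw [Finset.sum_add_distrib, ← Finset.mul_sum, ← Finset.sum_mul]
      _ ≤ dyad k ^ P * (K₁ * v {y | dyad k < locMaximal ρ F y}) + A * g k := by gcongr
      _ = _ := by
          simp only [ha]
          ring
  have hgG : ∑' k, g k ≤ CP * ((γ : ℝ≥0∞)⁻¹ ^ P * ∫⁻ x, G x ^ P ∂v) :=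
    hCP hFG.measurable' γ hγe ENNReal.coe_ne_top
  have habs : ∀ L : ℤ, (∑' k : ℤ, if k ≤ L then a k else 0) ≤ A * ∑' k, g k := by
    intro L
    set s : ℝ≥0∞ := ∑' k : ℤ, if k ≤ L then a k else 0 with hs
    have hst : s ≠ ∞ := by
      have h1 : s ≤ (CL * dyad L ^ P) * v Set.univ := by
        refine le_trans ?_ (mul_le_mul' (hCL L) le_rfl)
        rw [← ENNReal.tsum_mul_right]
        refine ENNReal.tsum_le_tsum fun k => ?_
        split_ifs
        · exact mul_le_mul' le_rfl (measure_mono (Set.subset_univ _))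
        · exact zero_le
      refine ne_top_of_le_ne_top ?_ h1
      have : dyad L ^ P ≠ ∞ := ENNReal.rpow_ne_top_of_nonneg hP.le (dyad_ne_top L)
      finiteness
    have h2 : N * s ≤ K₁ * s + A * ∑' k, g k := by
      calc N * s = ∑ j ∈ Finset.range N, s := by simp
        -- The shifts `j₀ + j` are nonnegative, so `k + j₀ + j ≤ L` implies `k ≤ L`: each shifted
        -- sum still contains all of `s`.
        _ ≤ ∑ j ∈ Finset.range N, ∑' k : ℤ, if k ≤ L then a (k + (j₀ + j : ℕ)) else 0 := by
            refine Finset.sum_le_sum fun j _ => ?_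
            refine (le_of_eq ((Equiv.addRight ((j₀ + j : ℕ) : ℤ)).tsum_eq
              fun k => if k ≤ L then a k else 0).symm).trans (ENNReal.tsum_le_tsum fun k => ?_)
            change (if k + ((j₀ + j : ℕ) : ℤ) ≤ L then a (k + ((j₀ + j : ℕ) : ℤ)) else 0) ≤ _
            by_cases h3 : k + ((j₀ + j : ℕ) : ℤ) ≤ L
            · rw [if_pos h3, if_pos (by omega)]
            · rw [if_neg h3]
              exact zero_le
        _ = ∑' k : ℤ, ∑ j ∈ Finset.range N, if k ≤ L then a (k + (j₀ + j : ℕ)) else 0 :=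
            (Summable.tsum_finsetSum fun _ _ => ENNReal.summable).symm
        _ ≤ ∑' k : ℤ, (K₁ * (if k ≤ L then a k else 0) + A * g k) := by
            refine ENNReal.tsum_le_tsum fun k => ?_
            split_ifs
            · exact hgood k
            · simp
        _ = K₁ * s + A * ∑' k, g k := by
            rw [ENNReal.tsum_add, ENNReal.tsum_mul_left, ENNReal.tsum_mul_left]
    have h3 : K₁ * s + s ≤ K₁ * s + A * ∑' k, g k := by
      refine le_trans ?_ h2
      have h4 : (K₁ : ℝ≥0∞) + 1 ≤ N := by exact_mod_cast hN
      calc (K₁ : ℝ≥0∞) * s + s = (K₁ + 1) * s := by ring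
        _ ≤ N * s := by gcongr
    exact (ENNReal.add_le_add_iff_left (ENNReal.mul_ne_top ENNReal.coe_ne_top hst)).1 h3
  have hsum : ∑' k, a k ≤ A * ∑' k, g k := by
    rw [ENNReal.tsum_eq_iSup_sum]
    refine iSup_le fun t => ?_
    obtain ⟨L, hL⟩ := t.bddAbove
    refine le_trans ?_ (habs L)
    calc ∑ k ∈ t, a k = ∑ k ∈ t, if k ≤ L then a k else 0 := by
          refine Finset.sum_congr rfl fun k hk => ?_
          rw [if_pos (hL hk)]
      _ ≤ _ := ENNReal.sum_le_tsum t
  have hac : v ≪ volume :=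
    (withDensity_absolutelyContinuous _ _).trans (withDensity_absolutelyContinuous _ _)
  calc ∫⁻ x, F x ^ P ∂v ≤ ∫⁻ x, locMaximal ρ F x ^ P ∂v := by
        refine lintegral_mono_ae ?_
        filter_upwards [hac.ae_le (ae_le_locMaximal hρ hFG.measurable hFt)] with x hx
        exact ENNReal.rpow_le_rpow hx hP.le
    _ ≤ 2 ^ P * ∑' k, a k := lintegral_rpow_le_tsum (measurable_locMaximal F) hP
    _ ≤ 2 ^ P * (A * (CP * ((γ : ℝ≥0∞)⁻¹ ^ P * ∫⁻ x, G x ^ P ∂v))) := by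
        refine mul_le_mul' le_rfl (hsum.trans ?_)
        gcongr
    _ = _ := by
        rw [hK']
        ring

end GoodLambdaGlobal

/-! ### Removal of the finiteness assumption by polynomial cut-offs. -/

section PolynomialWeight

variable {n : ℕ} {ρ : Eucl n → ℝ}

/-- The polynomially decaying cut-off `(1 + |x| / (N + 1)) ^ (-m)`. -/
noncomputable def polyCutoff (m N : ℕ) (x : Eucl n) : ℝ≥0∞ :=
  ENNReal.ofReal (((1 + ‖x‖ / (N + 1)) ^ m)⁻¹)

theorem measurable_polyCutoff (m N : ℕ) : Measurable (polyCutoff m N : Eucl n → ℝ≥0∞) := by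
  unfold polyCutoff
  fun_prop

theorem polyCutoff_le_one (m N : ℕ) (x : Eucl n) : polyCutoff m N x ≤ 1 := by
  unfold polyCutoff
  rw [← ENNReal.ofReal_one]
  refine ENNReal.ofReal_le_ofReal (inv_le_one_of_one_le₀ (one_le_pow₀ ?_))
  have : 0 ≤ ‖x‖ / (N + 1) := by positivity
  linarith

/-- As `ρ` grows at most linearly, `2 C₀ |x - y| ≤ ρ x` makes `1 + |x|` and `1 + |y|` comparable.
Dividing the norms by `N + 1 ≥ 1` does no harm, so the constant is independent of `N`. -/
theorem slowlyVarying_polyCutoff {C₀ : ℝ} (hρ : ∀ x, 0 < ρ x) (hC₀ : 1 ≤ C₀)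
    (hρC : ∀ x y, ρ y ≤ C₀ * (ρ x + dist x y)) (m N : ℕ) :
    SlowlyVarying ρ C₀ (Real.toNNReal ((2 + ρ 0) ^ m)) (polyCutoff m N : Eucl n → ℝ≥0∞) := by
  have key : ∀ x y : Eucl n, ‖x‖ ≤ ρ 0 + 2 * ‖y‖ → polyCutoff m N y ≤
      ((Real.toNNReal ((2 + ρ 0) ^ m) : ℝ≥0) : ℝ≥0∞) * polyCutoff m N x := by
    intro x y hxy
    have h0 := hρ 0
    have hN : (1 : ℝ) ≤ N + 1 := by linarith [(Nat.cast_nonneg N : (0 : ℝ) ≤ N)]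
    have h1 : 1 + ‖x‖ / (N + 1) ≤ (2 + ρ 0) * (1 + ‖y‖ / (N + 1)) := by
      have h2 : ‖x‖ / (N + 1) ≤ (ρ 0 + 2 * ‖y‖) / (N + 1) := by gcongr
      have h3 : ρ 0 / (N + 1) ≤ ρ 0 := div_le_self h0.le hN
      have h4 : 0 ≤ ‖y‖ / (N + 1) := by positivity
      rw [add_div, mul_div_assoc] at h2
      nlinarith
    unfold polyCutoff
    rw [← ENNReal.ofReal, ← ENNReal.ofReal_mul (by positivity)]
    refine ENNReal.ofReal_le_ofReal ?_
    rw [← div_eq_mul_inv, inv_le_iff_one_le_mul₀ (by positivity), div_mul_eq_mul_div, ← mul_pow,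
      one_le_div (by positivity)]
    gcongr
  intro x y hxy
  have h1 : dist x y ≤ (ρ 0 + ‖x‖) / 2 := by
    have h2 := hρC 0 x
    rw [dist_zero_left] at h2
    have h3 : C₀ * (2 * dist x y) ≤ C₀ * (ρ 0 + ‖x‖) := by linarith
    have h4 := le_of_mul_le_mul_left h3 (by linarith)
    linarith
  have h2 : ‖x‖ ≤ ‖y‖ + dist x y := by
    rw [dist_eq_norm]
    linarith [norm_sub_norm_le x y]
  have h3 : ‖y‖ ≤ ‖x‖ + dist x y := by
    rw [dist_comm, dist_eq_norm]
    linarith [norm_sub_norm_le y x]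
  have h0 := hρ 0
  exact ⟨key x y (by linarith [norm_nonneg y]), key y x (by linarith [norm_nonneg x])⟩

/-- Polynomial growth of the weighted measure. -/
theorem CritMuckenhoupt.exists_growth {θ P P' : ℝ} {C : ℝ≥0} {w σ : Eucl n → ℝ≥0∞}
    (hρ : ∀ x, 0 < ρ x) (hw : CritMuckenhoupt ρ θ P P' C w σ) :
    ∃ (M : ℕ) (A : ℝ≥0), ∀ k : ℕ,
      volume.withDensity w (ball (0 : Eucl n) (k + 1)) ≤ A * ENNReal.ofReal ((k + 1) ^ M) := by
  have hP := hw.conj.pos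
  have hθ := hw.nonneg
  have h0 := hρ 0
  obtain ⟨M, hM⟩ := exists_nat_ge ((θ + n) * P)
  set V := volume (ball (0 : Eucl n) 1) with hV
  have hV0 : V ≠ 0 := volume_ball_pos 0 one_pos
  have hVt : V ≠ ∞ := volume_ball_ne_top 0 1
  set A : ℝ≥0∞ := (C * ENNReal.ofReal ((1 + 1 / ρ 0) ^ θ)) ^ P *
    volume.withDensity w (ball (0 : Eucl n) 1) with hA
  have hAt : A ≠ ∞ := ENNReal.mul_ne_top (ENNReal.rpow_ne_top_of_nonneg hP.le (by finiteness))
    (hw.ball_ne_top 0 1)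
  refine ⟨M, A.toNNReal, fun k => ?_⟩
  rw [ENNReal.coe_toNNReal hAt]
  have hk : (1 : ℝ) ≤ k + 1 := by linarith [(Nat.cast_nonneg k : (0 : ℝ) ≤ k)]
  -- The unit ball is compared with `B(0, k + 1)`; the factors `Ψ_θ^P` and `|B|^P` give growth of
  -- order `(θ + n) P`.
  have h1 := hw.volume_rpow_mul_le measurableSet_ball (x := 0) (by linarith : (0 : ℝ) < k + 1)
    (ball_subset_ball (x := (0 : Eucl n)) hk)
  have hball : volume (ball (0 : Eucl n) (k + 1)) = ENNReal.ofReal ((k + 1) ^ n) * V := by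
    rw [hV, ← volume_ball_mul 0 0 (by linarith), mul_one]
  have hψ : critPsi ρ θ 0 (k + 1) ≤
      ENNReal.ofReal ((1 + 1 / ρ 0) ^ θ) * ENNReal.ofReal ((k + 1) ^ θ) := by
    unfold critPsi
    rw [← ENNReal.ofReal_mul (by positivity), ← Real.mul_rpow (by positivity) (by positivity)]
    refine ENNReal.ofReal_le_ofReal (Real.rpow_le_rpow (by positivity) ?_ hθ)
    rw [add_mul, one_mul, one_div_mul_eq_div]
    gcongr
  have h2 : ENNReal.ofReal (((k : ℝ) + 1) ^ θ) ^ P * ENNReal.ofReal (((k : ℝ) + 1) ^ n) ^ P ≤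
      ENNReal.ofReal (((k : ℝ) + 1) ^ M) := by
    rw [← ENNReal.mul_rpow_of_nonneg _ _ hP.le, ← ENNReal.ofReal_mul (by positivity),
      ENNReal.ofReal_rpow_of_nonneg (by positivity) hP.le]
    refine ENNReal.ofReal_le_ofReal ?_
    rw [← Real.rpow_natCast _ n, ← Real.rpow_natCast _ M, ← Real.rpow_add (by positivity),
      ← Real.rpow_mul (by positivity)]
    exact Real.rpow_le_rpow_of_exponent_le hk hM
  refine (ENNReal.mul_le_mul_iff_right (ENNReal.rpow_pos (pos_iff_ne_zero.2 hV0) hVt).ne'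
    (ENNReal.rpow_ne_top_of_nonneg hP.le hVt)).1 (h1.trans ?_)
  rw [hball]
  calc (C * critPsi ρ θ 0 (k + 1) * (ENNReal.ofReal ((k + 1) ^ n) * V)) ^ P *
        volume.withDensity w (ball 0 1)
      ≤ (C * (ENNReal.ofReal ((1 + 1 / ρ 0) ^ θ) * ENNReal.ofReal ((k + 1) ^ θ)) *
        (ENNReal.ofReal ((k + 1) ^ n) * V)) ^ P * volume.withDensity w (ball 0 1) := by gcongr
    _ = V ^ P * (A * (ENNReal.ofReal (((k : ℝ) + 1) ^ θ) ^ P *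
        ENNReal.ofReal (((k : ℝ) + 1) ^ n) ^ P)) := by
        rw [hA]
        simp only [ENNReal.mul_rpow_of_nonneg _ _ hP.le]
        ring
    _ ≤ _ := by gcongr

/-- The exponent `M + 2` beats the growth `(k + 1)^M` and leaves the convergent series of `(k +
1)^(-2)`. -/
theorem withDensity_polyCutoff_ne_top {μ : Measure (Eucl n)} {M : ℕ} {A : ℝ≥0}
    (hμ : ∀ k : ℕ, μ (ball (0 : Eucl n) (k + 1)) ≤ A * ENNReal.ofReal ((k + 1) ^ M)) (N : ℕ) :
    μ.withDensity (polyCutoff (M + 2) N) Set.univ ≠ ∞ := by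
  rw [withDensity_apply _ MeasurableSet.univ, Measure.restrict_univ]
  have hN : (1 : ℝ) ≤ N + 1 := by linarith [(Nat.cast_nonneg N : (0 : ℝ) ≤ N)]
  have hpt : ∀ x : Eucl n, polyCutoff (M + 2) N x ≤ ∑' k : ℕ, (ball (0 : Eucl n) (k + 1)).indicator
      (fun _ => ENNReal.ofReal (((N + 1) / (k + 1)) ^ (M + 2))) x := by
    intro x
    refine le_trans ?_ (ENNReal.le_tsum ⌊‖x‖⌋₊)
    rw [Set.indicator_of_mem (by simpa using Nat.lt_floor_add_one ‖x‖)]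
    unfold polyCutoff
    refine ENNReal.ofReal_le_ofReal ?_
    rw [← inv_pow]
    have h1 : (⌊‖x‖⌋₊ : ℝ) ≤ ‖x‖ := Nat.floor_le (norm_nonneg x)
    gcongr
    rw [inv_le_comm₀ (by positivity) (by positivity), inv_div, div_le_iff₀ (by positivity), add_mul,
      div_mul_cancel₀ _ (by positivity)]
    linarith
  have hterm : ∀ k : ℕ, ∫⁻ x, (ball (0 : Eucl n) (k + 1)).indicator
      (fun _ => ENNReal.ofReal (((N + 1) / (k + 1)) ^ (M + 2))) x ∂μ ≤
      A * ENNReal.ofReal ((N + 1) ^ (M + 2)) * ENNReal.ofReal (1 / ((k : ℝ) + 1) ^ 2) := by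
    intro k
    rw [lintegral_indicator_const measurableSet_ball]
    calc ENNReal.ofReal (((N + 1) / (k + 1)) ^ (M + 2)) * μ (ball 0 (k + 1))
        ≤ ENNReal.ofReal (((N + 1) / (k + 1)) ^ (M + 2)) * (A * ENNReal.ofReal ((k + 1) ^ M)) := by
          gcongr
          exact hμ k
      _ = A * (ENNReal.ofReal (((N + 1) / (k + 1)) ^ (M + 2)) * ENNReal.ofReal ((k + 1) ^ M)) := by
          ring
      _ = _ := by
          rw [mul_assoc, ← ENNReal.ofReal_mul (by positivity), ← ENNReal.ofReal_mul (by positivity)]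
          congr 2
          have : (k : ℝ) + 1 ≠ 0 := by positivity
          rw [div_pow, pow_add ((k : ℝ) + 1)]
          field_simp
  refine ne_top_of_le_ne_top ?_ ((lintegral_mono hpt).trans
    (le_of_eq (lintegral_tsum fun k => (measurable_const.indicator measurableSet_ball).aemeasurable)))
  refine ne_top_of_le_ne_top ?_ (ENNReal.tsum_le_tsum hterm)
  rw [ENNReal.tsum_mul_left]
  have hs : Summable fun k : ℕ => 1 / ((k : ℝ) + 1) ^ 2 := by
    have := (summable_nat_add_iff 1).2 (Real.summable_one_div_nat_pow.2 (by norm_num : 1 < 2))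
    simpa using this
  have := hs.tsum_ofReal_ne_top
  finiteness

/-- The global estimate: if `F` and `G` satisfy the local splitting hypotheses then the `L^P(w)` norm
of `F` is controlled by that of `G`. -/
theorem CritMuckenhoupt.exists_lintegral_rpow_le {θ₀ θ P P' τ b C₀ : ℝ} {C : ℝ≥0}
    {w σ : Eucl n → ℝ≥0∞} (hρ : ∀ x, 0 < ρ x) (hC₀ : 1 ≤ C₀)
    (hρC : ∀ x y, ρ y ≤ C₀ * (ρ x + dist x y)) (hw : CritMuckenhoupt ρ θ₀ P P' C w σ)
    (hθ : 0 ≤ θ) (hb : 0 < b) (hbC : 32 * b * C₀ ^ 2 ≤ 1) (hτ : 8 ≤ τ) (hτb : 4 * C₀ * τ * b ≤ 1)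
    (hM : ∃ K : ℝ≥0, ∀ g : Eucl n → ℝ≥0∞, Measurable g →
      ∫⁻ x, critMaximal ρ θ g x ^ P ∂(volume.withDensity w) ≤
        K * ∫⁻ x, g x ^ P ∂(volume.withDensity w)) (K : ℝ≥0) :
    ∃ K' : ℝ≥0, ∀ F G : Eucl n → ℝ≥0∞,
      LocalSplitting ρ θ P τ b w K F G → ∫⁻ x, F x ≠ ∞ →
      ∫⁻ x, F x ^ P ∂(volume.withDensity w) ≤ K' * ∫⁻ x, G x ^ P ∂(volume.withDensity w) := by
  have hP := hw.conj.pos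
  obtain ⟨M, A, hA⟩ := hw.exists_growth hρ
  obtain ⟨K₁, hK₁⟩ := hw.exists_lintegral_rpow_le_of_finite hρ hC₀ hρC hθ hb hbC hτ hτb hM K
    (Real.toNNReal ((2 + ρ 0) ^ (M + 2)))
  refine ⟨2 ^ (M + 2) * K₁, fun F G hFG hFt => ?_⟩
  set μ := volume.withDensity w with hμ
  have hFm := hFG.measurable.pow_const P
  have hGm := hFG.measurable'.pow_const P
  -- The cut-off is at most 1 everywhere and at least `2^(-(M+2))` on `B(0, N)`, while `K₁` does not
  -- depend on `N`; hence the bound passes to the limit.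
  have key : ∀ N : ℕ, ∫⁻ x in ball (0 : Eucl n) N, F x ^ P ∂μ ≤
      (2 ^ (M + 2) * K₁ : ℝ≥0) * ∫⁻ x, G x ^ P ∂μ := by
    intro N
    have hηm := measurable_polyCutoff (n := n) (M + 2) N
    have h1 := hK₁ F G hFG hFt (polyCutoff (M + 2) N) hηm
      (slowlyVarying_polyCutoff hρ hC₀ hρC _ N) (withDensity_polyCutoff_ne_top hA N)
    rw [lintegral_withDensity_eq_lintegral_mul _ hηm hFm,
      lintegral_withDensity_eq_lintegral_mul _ hηm hGm] at h1
    simp only [Pi.mul_apply] at h1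
    have h2 : ∀ x ∈ ball (0 : Eucl n) N, F x ^ P ≤
        2 ^ (M + 2) * (polyCutoff (M + 2) N x * F x ^ P) := by
      intro x hx
      rw [← mul_assoc]
      refine le_mul_of_one_le_left zero_le ?_
      have h3 : (2 : ℝ≥0∞) ^ (M + 2) = ENNReal.ofReal (2 ^ (M + 2)) := by
        rw [ENNReal.ofReal_pow (by norm_num)]
        simp
      unfold polyCutoff
      rw [h3, ← ENNReal.ofReal_mul (by positivity), ← ENNReal.ofReal_one]
      refine ENNReal.ofReal_le_ofReal ?_
      rw [← div_eq_mul_inv, one_le_div (by positivity)]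
      gcongr
      have h4 : ‖x‖ / (N + 1) ≤ 1 := by
        rw [div_le_one (by positivity)]
        have := mem_ball_zero_iff.1 hx
        linarith
      linarith
    calc ∫⁻ x in ball (0 : Eucl n) N, F x ^ P ∂μ
        ≤ ∫⁻ x in ball (0 : Eucl n) N, 2 ^ (M + 2) *
          (polyCutoff (M + 2) N x * F x ^ P) ∂μ :=
          setLIntegral_mono ((hηm.mul hFm).const_mul _) h2
      _ ≤ ∫⁻ x, 2 ^ (M + 2) * (polyCutoff (M + 2) N x * F x ^ P) ∂μ :=
          setLIntegral_le_lintegral _ _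
      _ = 2 ^ (M + 2) * ∫⁻ x, (polyCutoff (M + 2) N x * F x ^ P) ∂μ :=
          lintegral_const_mul _ (hηm.mul hFm)
      _ ≤ 2 ^ (M + 2) * (K₁ * ∫⁻ x, (polyCutoff (M + 2) N x * G x ^ P) ∂μ) := by gcongr
      _ ≤ 2 ^ (M + 2) * (K₁ * ∫⁻ x, G x ^ P ∂μ) := by
          gcongr with x
          exact mul_le_of_le_one_left zero_le (polyCutoff_le_one _ _ x)
      _ = _ := by
          push_cast
          ring
  have hdir : Monotone fun N : ℕ => ball (0 : Eucl n) N := fun N N' h =>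
    ball_subset_ball (by exact_mod_cast h)
  rw [← setLIntegral_univ, ← iUnion_ball_nat (0 : Eucl n),
    setLIntegral_iUnion_of_directed _ hdir.directed_le]
  exact iSup_le key

end PolynomialWeight

/-! ### From the hypotheses on `ρ` and `ω` to their working forms. -/

section Hypotheses

variable {n : ℕ} {ρ : Eucl n → ℝ}

/-- The base is at least 1 and the exponent `l₀ / (l₀ + 1)` below 1, so the power may be dropped.
This linear form suffices for every comparison of critical radii. -/
theorem IsCriticalRadius.exists_le (h : IsCriticalRadius ρ) :
    ∃ C₀ : ℝ, 1 ≤ C₀ ∧ ∀ x y, ρ y ≤ C₀ * (ρ x + dist x y) := by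
  obtain ⟨hρ, l₀, C₀, hl₀, hC₀, h⟩ := h
  refine ⟨C₀, hC₀.le, fun x y => ?_⟩
  have h1 := (h x y).2
  have hx := hρ x
  have hbase : 1 ≤ 1 + dist x y / ρ x := one_le_base hρ x dist_nonneg
  have h2 : (1 + dist x y / ρ x) ^ (l₀ / (l₀ + 1)) ≤ 1 + dist x y / ρ x := by
    calc (1 + dist x y / ρ x) ^ (l₀ / (l₀ + 1)) ≤ (1 + dist x y / ρ x) ^ (1 : ℝ) :=
          Real.rpow_le_rpow_of_exponent_le hbase
            ((div_le_one (by linarith)).2 (by linarith))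
      _ = _ := Real.rpow_one _
  rw [div_le_iff₀ hx] at h1
  calc ρ y ≤ C₀ * (1 + dist x y / ρ x) ^ (l₀ / (l₀ + 1)) * ρ x := h1
    _ ≤ C₀ * (1 + dist x y / ρ x) * ρ x := by gcongr
    _ = C₀ * (ρ x + dist x y) := by
        field_simp

theorem IsWeight.lintegral_ball_ne_top {ω : Eucl n → ℝ} (hω : IsWeight ω) (x : Eucl n) (r : ℝ) :
    ∫⁻ y in ball x r, ENNReal.ofReal (ω y) ≠ ∞ :=
  ((hω.2.integrableOn_isCompact (isCompact_closedBall x r)).mono_set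
    ball_subset_closedBall).setLIntegral_lt_top.ne

theorem IsWeight.aemeasurable {ω : Eucl n → ℝ} (hω : IsWeight ω) : AEMeasurable ω volume :=
  hω.2.aestronglyMeasurable.aemeasurable

/-- For a nontrivial `A_P` weight, the dual weight is locally integrable. -/
theorem IsApCrit.lintegral_dual_ne_top (hρ : ∀ x, 0 < ρ x) {θ P : ℝ} (hP : 1 < P) {ω : Eucl n → ℝ}
    (hω : IsWeight ω) (hA : IsApCrit ρ θ P ω) (h0 : ¬ ∀ᵐ x, ω x = 0) (x : Eucl n) (r : ℝ) :
    ∫⁻ y in ball x r, ENNReal.ofReal (ω y) ^ (-(1 / (P - 1))) ≠ ∞ := by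
  have hP1 : 0 < P - 1 := by linarith
  obtain ⟨C, hC⟩ := hA
  obtain ⟨R, hR⟩ : ∃ R : ℕ, ∫⁻ y in ball x R, ENNReal.ofReal (ω y) ≠ 0 := by
    by_contra! hcon
    refine h0 ?_
    have h1 : ∀ᵐ y ∂(volume.restrict (⋃ R : ℕ, ball x R)), ENNReal.ofReal (ω y) = 0 := by
      rw [ae_restrict_iUnion_iff]
      intro R
      exact (lintegral_eq_zero_iff' hω.aemeasurable.ennreal_ofReal.restrict).1 (hcon R)
    rw [iUnion_ball_nat, Measure.restrict_univ] at h1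
    filter_upwards [h1] with y hy
    exact le_antisymm (ENNReal.ofReal_eq_zero.1 hy) (hω.1 y)
  -- A ball large enough to carry positive mass of `ω`: otherwise the convention `0 · ∞ = 0` would
  -- hide an infinite dual integral in the `A_P` condition.
  set s : ℝ := max (max r R) 1 with hs
  have hs0 : 0 < s := lt_of_lt_of_le one_pos (le_max_right _ _)
  have hrs : r ≤ s := (le_max_left _ _).trans (le_max_left _ _)
  have hRs : (R : ℝ) ≤ s := (le_max_right _ _).trans (le_max_left _ _)
  have hw : ∫⁻ y in ball x s, ENNReal.ofReal (ω y) ≠ 0 := by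
    intro h
    exact hR (le_antisymm (h ▸ lintegral_mono_set (ball_subset_ball hRs)) zero_le)
  have hb := hC x s hs0
  have hψ0 := critPsi_ne_zero hρ θ x hs0.le
  have hψt := critPsi_ne_top (ρ := ρ) θ x s
  have hV0 := volume_ball_pos x hs0
  have hVt := volume_ball_ne_top x s
  suffices h : ∫⁻ y in ball x s, ENNReal.ofReal (ω y) ^ (-(1 / (P - 1))) ≠ ∞ from
    ne_top_of_le_ne_top h (lintegral_mono_set (ball_subset_ball hrs))
  intro htop
  rw [setLAverage_eq, setLAverage_eq, htop, ENNReal.top_div_of_ne_top hVt,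
    ENNReal.mul_top (ENNReal.inv_ne_zero.2 hψt), ENNReal.top_rpow_of_pos hP1, ENNReal.mul_top] at hb
  · exact absurd hb (not_le.2 ENNReal.coe_lt_top)
  · exact mul_ne_zero (ENNReal.inv_ne_zero.2 hψt) (ENNReal.div_ne_zero.2 ⟨hw, hVt⟩)

/-- Where `ω` vanishes the dual weight is `∞`, which its local integrability permits only on a null
set. -/
theorem IsApCrit.ae_pos (hρ : ∀ x, 0 < ρ x) {θ P : ℝ} (hP : 1 < P) {ω : Eucl n → ℝ}
    (hω : IsWeight ω) (hA : IsApCrit ρ θ P ω) (h0 : ¬ ∀ᵐ x, ω x = 0) : ∀ᵐ x, 0 < ω x := by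
  have hP1 : 0 < P - 1 := by linarith
  have h1 : ∀ᵐ y ∂(volume.restrict (⋃ R : ℕ, ball (0 : Eucl n) R)),
      ENNReal.ofReal (ω y) ^ (-(1 / (P - 1))) < ∞ := by
    rw [ae_restrict_iUnion_iff]
    intro R
    exact ae_lt_top' (hω.aemeasurable.ennreal_ofReal.pow_const _).restrict
      (hA.lintegral_dual_ne_top hρ hP hω h0 0 R)
  rw [iUnion_ball_nat, Measure.restrict_univ] at h1
  filter_upwards [h1] with y hy
  by_contra hcon
  rw [ENNReal.ofReal_of_nonpos (not_lt.1 hcon), ENNReal.zero_rpow_of_neg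
    (neg_neg_of_pos (one_div_pos.2 hP1))] at hy
  exact lt_irrefl _ hy

/-- A nontrivial weight of class `A_P^{ρ,θ}` agrees almost everywhere with a weight with values in
`(0, ∞)` satisfying the symmetric form of the Muckenhoupt condition. -/
theorem IsApCrit.exists_critMuckenhoupt (hρ : ∀ x, 0 < ρ x) {θ P : ℝ} (hθ : 0 ≤ θ) (hP : 1 < P)
    {ω : Eucl n → ℝ} (hω : IsWeight ω) (hA : IsApCrit ρ θ P ω) (h0 : ¬ ∀ᵐ x, ω x = 0) :
    ∃ (C : ℝ≥0) (w σ : Eucl n → ℝ≥0∞), CritMuckenhoupt ρ θ P (P / (P - 1)) C w σ ∧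
      w =ᵐ[volume] fun x => ENNReal.ofReal (ω x) := by
  have hP0 : 0 < P := by linarith
  have hP1 : 0 < P - 1 := by linarith
  have hconj : P.HolderConjugate (P / (P - 1)) := Real.HolderConjugate.conjExponent hP
  have hP' := hconj.symm.pos
  set ω₀ := hω.aemeasurable.mk ω with hω₀
  have hω₀m : Measurable ω₀ := hω.aemeasurable.measurable_mk
  -- The value 1 on the exceptional null set makes `w` and `σ` positive and finite everywhere.
  set w : Eucl n → ℝ≥0∞ := fun x => if 0 < ω₀ x then ENNReal.ofReal (ω₀ x) else 1 with hw
  set σ : Eucl n → ℝ≥0∞ := fun x => w x ^ (-(1 / (P - 1))) with hσ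
  have hwm : Measurable w := Measurable.ite (measurableSet_lt measurable_const hω₀m)
    hω₀m.ennreal_ofReal measurable_const
  have hσm : Measurable σ := hwm.pow_const _
  have hwω : w =ᵐ[volume] fun x => ENNReal.ofReal (ω x) := by
    filter_upwards [hω.aemeasurable.ae_eq_mk, hA.ae_pos hρ hP hω h0] with x hx hx0
    simp only [hw]
    rw [← hω₀] at hx
    rw [← hx, if_pos hx0]
  have hσω : σ =ᵐ[volume] fun x => ENNReal.ofReal (ω x) ^ (-(1 / (P - 1))) := by
    filter_upwards [hwω] with x hx
    simp only [hσ]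
    rw [hx]
  have hw0 : ∀ x, w x ≠ 0 := by
    intro x
    simp only [hw]
    split_ifs with h
    · simpa using h
    · exact one_ne_zero
  have hwt : ∀ x, w x ≠ ∞ := by
    intro x
    simp only [hw]
    split_ifs with h
    · exact ENNReal.ofReal_ne_top
    · exact ENNReal.one_ne_top
  have hIw : ∀ x r, ∫⁻ y in ball x r, w y = ∫⁻ y in ball x r, ENNReal.ofReal (ω y) :=
    fun x r => lintegral_congr_ae (ae_restrict_of_ae hwω)
  have hIσ : ∀ x r, ∫⁻ y in ball x r, σ y =
      ∫⁻ y in ball x r, ENNReal.ofReal (ω y) ^ (-(1 / (P - 1))) :=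
    fun x r => lintegral_congr_ae (ae_restrict_of_ae hσω)
  have hC := hA
  obtain ⟨C, hC⟩ := hC
  refine ⟨C ^ (1 / P), w, σ, ⟨hconj, hθ, hwm, hσm, fun x => ?_, fun x r => ?_, fun x r => ?_,
    fun x r hr => ?_⟩, hwω⟩
  · simp only [hσ]
    rw [← ENNReal.rpow_mul, ← ENNReal.rpow_add _ _ (hw0 x) (hwt x)]
    have : 1 / P + -(1 / (P - 1)) * (1 / (P / (P - 1))) = 0 := by
      field_simp
      ring
    rw [this, ENNReal.rpow_zero]
  · rw [hIw]
    exact hω.lintegral_ball_ne_top x r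
  · rw [hIσ]
    exact hA.lintegral_dual_ne_top hρ hP hω h0 x r
  · have hψ0 := critPsi_ne_zero hρ θ x hr.le
    have hψt := critPsi_ne_top (ρ := ρ) θ x r
    have hV0 := volume_ball_pos x hr
    have hVt := volume_ball_ne_top x r
    have h1 := hC x r hr
    rw [setLAverage_eq, setLAverage_eq, ← hIw, ← hIσ] at h1
    set X := ∫⁻ y in ball x r, w y
    set Y := ∫⁻ y in ball x r, σ y
    set T := critPsi ρ θ x r * volume (ball x r) with hT
    have hT0 : T ≠ 0 := mul_ne_zero hψ0 hV0
    have hTt : T ≠ ∞ := ENNReal.mul_ne_top hψt hVt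
    have hdiv : ∀ Z : ℝ≥0∞, (critPsi ρ θ x r)⁻¹ * (Z / volume (ball x r)) = Z / T := by
      intro Z
      rw [hT, div_eq_mul_inv, div_eq_mul_inv, ENNReal.mul_inv (Or.inl hψ0) (Or.inl hψt)]
      ring
    rw [hdiv, hdiv] at h1
    have h2 := ENNReal.rpow_le_rpow h1 (one_div_pos.2 hP0).le
    rw [ENNReal.mul_rpow_of_nonneg _ _ (one_div_pos.2 hP0).le, ← ENNReal.rpow_mul] at h2
    have hexp : (P - 1) * (1 / P) = 1 / (P / (P - 1)) := by
      rw [one_div_div, mul_one_div]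
    rw [hexp] at h2
    have hsum : 1 / P + 1 / (P / (P - 1)) = 1 := by
      field_simp
      ring
    calc X ^ (1 / P) * Y ^ (1 / (P / (P - 1)))
        = (T * (X / T)) ^ (1 / P) * (T * (Y / T)) ^ (1 / (P / (P - 1))) := by
          rw [ENNReal.mul_div_cancel hT0 hTt, ENNReal.mul_div_cancel hT0 hTt]
      _ = (T ^ (1 / P) * T ^ (1 / (P / (P - 1)))) *
          ((X / T) ^ (1 / P) * (Y / T) ^ (1 / (P / (P - 1)))) := by
          rw [ENNReal.mul_rpow_of_nonneg _ _ (one_div_pos.2 hP0).le,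
            ENNReal.mul_rpow_of_nonneg _ _ (one_div_pos.2 hP').le]
          ring
      _ ≤ T * (C : ℝ≥0∞) ^ (1 / P) := by
          rw [← ENNReal.rpow_add _ _ hT0 hTt, hsum, ENNReal.rpow_one]
          gcongr
      _ = _ := by
          rw [hT, ENNReal.coe_rpow_of_nonneg _ (one_div_pos.2 hP0).le]
          ring

/-- Hölder's inequality on a ball combined with the reverse Hölder property. -/
theorem IsRHLoc.exists_setLIntegral_le {F : Type*} [NormedAddCommGroup F] {p : ℝ} (hp : 0 < p)
    {q₀ : ℝ≥0∞} (hpq : ENNReal.ofReal p ≤ q₀) {ω : Eucl n → ℝ} (hω : IsWeight ω)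
    (hR : IsRHLoc ρ (ENNReal.conjExponent (q₀ / ENNReal.ofReal p)) ω)
    {w : Eucl n → ℝ≥0∞} (hwm : Measurable w) (hw : w =ᵐ[volume] fun x => ENNReal.ofReal (ω x)) :
    ∃ K : ℝ≥0, ∀ h : Eucl n → F, StronglyMeasurable h → ∀ x r, 0 < r → r < ρ x →
      ∫⁻ y in ball x r, ‖h y‖ₑ ^ p ∂(volume.withDensity w) ≤
        K * (ballNorm q₀ x r h ^ p * volume.withDensity w (ball x r)) := by
  obtain ⟨K, hK⟩ := hR
  refine ⟨K, fun h hh x r hr hrρ => ?_⟩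
  have hp0 : ENNReal.ofReal p ≠ 0 := by simpa using hp
  have hV0 := volume_ball_pos x hr
  have hVt := volume_ball_ne_top x r
  have hRH := hK x r hr hrρ
  rw [setLAverage_eq] at hRH
  unfold ballNorm at hRH ⊢
  set B := ball x r with hB
  set ν : Measure (Eucl n) := (volume B)⁻¹ • volume.restrict B with hν
  have hνac : ν ≪ volume :=
    (Measure.smul_absolutelyContinuous).trans Measure.restrict_le_self.absolutelyContinuous
  set s := q₀ / ENNReal.ofReal p with hs
  have hs1 : 1 ≤ s := by
    rw [hs, ENNReal.le_div_iff_mul_le (Or.inl hp0) (Or.inl ENNReal.ofReal_ne_top), one_mul]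
    exact hpq
  have : s.HolderConjugate s.conjExponent := ENNReal.HolderConjugate.conjExponent hs1
  have hhp : AEStronglyMeasurable (fun y => ‖h y‖ ^ p) ν :=
    (hh.norm.measurable.pow_const p).aestronglyMeasurable
  -- Hölder with exponents `q₀ / p` and its conjugate for normalized measure. It includes `q₀ = ∞`
  -- and `p = q₀`, where one of the two exponents is `∞`.
  have hHolder := eLpNorm_smul_le_mul_eLpNorm (p := s) (q := s.conjExponent) (r := 1) (μ := ν)
    (hω.2.aestronglyMeasurable.mono_ac hνac) hhp
  rw [eLpNorm_norm_rpow _ hp, hs, ENNReal.div_mul_cancel hp0 ENNReal.ofReal_ne_top, ← hs,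
    eLpNorm_one_eq_lintegral_enorm, hν, lintegral_smul_measure, ← hν, smul_eq_mul] at hHolder
  have hleft : ∫⁻ y in B, ‖((fun y => ‖h y‖ ^ p) • ω) y‖ₑ =
      ∫⁻ y in B, ‖h y‖ₑ ^ p ∂(volume.withDensity w) := by
    rw [setLIntegral_withDensity_eq_setLIntegral_mul _ hwm (hh.enorm.pow_const p)
      measurableSet_ball]
    refine lintegral_congr_ae (ae_restrict_of_ae ?_)
    filter_upwards [hw] with y hy
    rw [Pi.smul_apply', smul_eq_mul, enorm_mul, Real.enorm_rpow_of_nonneg (norm_nonneg _) hp.le,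
      enorm_norm, Real.enorm_of_nonneg (hω.1 y), Pi.mul_apply, hy, mul_comm]
  have hwB : volume.withDensity w B = ∫⁻ y in B, ENNReal.ofReal (ω y) := by
    rw [withDensity_apply _ measurableSet_ball]
    exact lintegral_congr_ae (ae_restrict_of_ae hw)
  rw [hleft] at hHolder
  rw [← hwB] at hRH
  set I := ∫⁻ y in B, ‖h y‖ₑ ^ p ∂(volume.withDensity w)
  calc I = volume B * ((volume B)⁻¹ * I) := by
        rw [← mul_assoc, ENNReal.mul_inv_cancel hV0 hVt, one_mul]
    _ ≤ volume B * (eLpNorm h q₀ ν ^ p * (K * (volume.withDensity w B / volume B))) :=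
        mul_le_mul' le_rfl (hHolder.trans (mul_le_mul' le_rfl hRH))
    _ = K * (eLpNorm h q₀ ν ^ p * (volume.withDensity w B / volume B * volume B)) := by ring
    _ = _ := by rw [ENNReal.div_mul_cancel hV0 hVt]

theorem eLpNorm_ofReal_eq {F : Type*} [NormedAddCommGroup F] {p : ℝ} (hp : 0 < p)
    (μ : Measure (Eucl n)) (h : Eucl n → F) :
    eLpNorm h (ENNReal.ofReal p) μ = (∫⁻ x, ‖h x‖ₑ ^ p ∂μ) ^ (1 / p) := by
  rw [eLpNorm_eq_lintegral_rpow_enorm_toReal (by simpa using hp) ENNReal.ofReal_ne_top,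
    ENNReal.toReal_ofReal hp.le]

end Hypotheses

/-! ### The operator `T` and the conclusion. -/

/-- The hypotheses on `T` and the operators `A r` give the local splitting of `|Tf|^{p₀}`. -/
theorem localSplitting_of_sublinear {𝕜 : Type*} [RCLike 𝕜] {n : ℕ}
    {ρ : EuclideanSpace ℝ (Fin n) → ℝ} (hρ : ∀ x, 0 < ρ x)
    {c₀ : ℝ} (hc₀ : 0 < c₀) {p₀ : ℝ} (hp₀ : 1 ≤ p₀) {q₀ : ℝ≥0∞}
    {T : Lp 𝕜 (ENNReal.ofReal p₀) (volume : Measure (EuclideanSpace ℝ (Fin n))) →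
      Lp 𝕜 (ENNReal.ofReal p₀) (volume : Measure (EuclideanSpace ℝ (Fin n)))}
    (hT : IsSublinearOp T)
    {A : ℝ → LcInfty n 𝕜 (ENNReal.ofReal p₀) →
      Lp 𝕜 (ENNReal.ofReal p₀) (volume : Measure (EuclideanSpace ℝ (Fin n)))}
    {θ : ℝ} {C₁ C₂ : ℝ≥0}
    (h₁ : ∀ (f : LcInfty n 𝕜 (ENNReal.ofReal p₀)) (x : EuclideanSpace ℝ (Fin n)),
      (⨆ (x₀ : EuclideanSpace ℝ (Fin n)) (r : ℝ) (_ : 0 < r) (_ : x ∈ ball x₀ r) (_ : r < ρ x₀),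
          ⨍⁻ y in ball x₀ (c₀ * r), ‖T (f.1 - A (c₀ * r) f) y‖ₑ ^ p₀ ∂volume) +
        (⨆ (x₀ : EuclideanSpace ℝ (Fin n)) (r : ℝ) (_ : 0 < r) (_ : x ∈ ball x₀ r) (_ : ρ x₀ ≤ r),
          (critPsi ρ θ x₀ r)⁻¹ * ⨍⁻ y in ball x₀ r, ‖T f.1 y‖ₑ ^ p₀ ∂volume) ≤
      C₁ * critMaximal ρ θ (fun y => ‖f.1 y‖ₑ ^ p₀) x)
    (h₂ : ∀ (f : LcInfty n 𝕜 (ENNReal.ofReal p₀)) (x₀ : EuclideanSpace ℝ (Fin n)) (r : ℝ),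
      0 < r → r < ρ x₀ → ∀ x ∈ ball x₀ (c₀ * r), ∀ x' ∈ ball x₀ (c₀ * r),
        ballNorm q₀ x₀ (c₀ * r) (T (A (c₀ * r) f)) ≤
          C₂ * (critMaximal ρ θ (fun y => ‖T f.1 y‖ₑ ^ p₀) x ^ (1 / p₀) +
            critMaximal ρ θ (fun y => ‖f.1 y‖ₑ ^ p₀) x' ^ (1 / p₀)))
    {p : ℝ} (hp : 0 < p) {w : EuclideanSpace ℝ (Fin n) → ℝ≥0∞} {K : ℝ≥0}
    (hK : ∀ h : EuclideanSpace ℝ (Fin n) → 𝕜, StronglyMeasurable h → ∀ x r, 0 < r → r < ρ x →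
      ∫⁻ y in ball x r, ‖h y‖ₑ ^ p ∂(volume.withDensity w) ≤
        K * (ballNorm q₀ x r h ^ p * volume.withDensity w (ball x r)))
    {κ b : ℝ} (hκ : 6 ≤ κ) (hκc : 8 ≤ c₀ * κ) (hκb : κ * b < 1) (hκb' : c₀ * κ * b < 1) :
    ∃ K' : ℝ≥0, ∀ f : LcInfty n 𝕜 (ENNReal.ofReal p₀),
      LocalSplitting ρ θ (p / p₀) (c₀ * κ) b w K' (fun y => ‖T f.1 y‖ₑ ^ p₀)
        (critMaximal ρ θ (fun y => ‖f.1 y‖ₑ ^ p₀)) := by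
  have hp₀0 : 0 < p₀ := by linarith
  have hP : 0 < p / p₀ := by positivity
  have hκ0 : 0 < κ := by linarith
  -- The constant in `(s + t)^p₀ ≤ a (s^p₀ + t^p₀)`.
  set a : ℝ≥0∞ := 2 ^ (p₀ - 1) with ha
  have hat : a ≠ ∞ := ENNReal.rpow_ne_top_of_nonneg (by linarith) (by finiteness)
  have haPt : a ^ (p / p₀) ≠ ∞ := ENNReal.rpow_ne_top_of_nonneg hP.le hat
  have hCpt : (C₂ * 2 : ℝ≥0∞) ^ p ≠ ∞ := ENNReal.rpow_ne_top_of_nonneg hp.le (by finiteness)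
  set Kt : ℝ≥0∞ := C₁ + a * C₁ + a ^ (p / p₀) * (K * (C₂ * 2) ^ p) with hKt
  have hKtt : Kt ≠ ∞ := by finiteness
  refine ⟨Kt.toNNReal, fun f => ?_⟩
  have hmeas : ∀ g : Lp 𝕜 (ENNReal.ofReal p₀) (volume : Measure (EuclideanSpace ℝ (Fin n))),
      Measurable fun y => ‖g y‖ₑ ^ p₀ := fun g =>
    (Lp.stronglyMeasurable g).enorm.pow_const p₀
  set F : EuclideanSpace ℝ (Fin n) → ℝ≥0∞ := fun y => ‖T f.1 y‖ₑ ^ p₀ with hF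
  set G : EuclideanSpace ℝ (Fin n) → ℝ≥0∞ := critMaximal ρ θ (fun y => ‖f.1 y‖ₑ ^ p₀) with hG
  refine ⟨hmeas _, measurable_critMaximalOf (μ := volume) θ _, fun z s y hs hy hzs => ?_,
    fun x r hr hrb => ?_⟩ <;> rw [ENNReal.coe_toNNReal hKtt]
  · calc (critPsi ρ θ z s)⁻¹ * ⨍⁻ y in ball z s, F y ∂volume
        ≤ ⨆ (x₀ : EuclideanSpace ℝ (Fin n)) (r : ℝ) (_ : 0 < r) (_ : y ∈ ball x₀ r) (_ : ρ x₀ ≤ r),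
          (critPsi ρ θ x₀ r)⁻¹ * ⨍⁻ y in ball x₀ r, ‖T f.1 y‖ₑ ^ p₀ ∂volume :=
          le_iSup₂_of_le z s (le_iSup₂_of_le hs hy (le_iSup_of_le hzs le_rfl))
      _ ≤ C₁ * G y := le_add_self.trans (h₁ f y)
      _ ≤ Kt * G y := by
          gcongr
          rw [hKt, add_assoc]
          exact le_self_add
  -- The hypotheses are used on `B(x, κ r)`: `κ ≥ 6` places `y` in that ball for `h₁`, `c₀ κ ≥ 8`
  -- places `u` and `y` in its `c₀`-dilate for `h₂`, and `c₀ κ r < ρ x` allows `hK` on the dilate.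
  have hκr : 0 < κ * r := by positivity
  have hρx := hρ x
  have hκρ : κ * r < ρ x := by
    calc κ * r ≤ κ * (b * ρ x) := by gcongr
      _ = (κ * b) * ρ x := by ring
      _ < 1 * ρ x := by gcongr
      _ = ρ x := one_mul _
  have hτρ : c₀ * κ * r < ρ x := by
    calc c₀ * κ * r ≤ c₀ * κ * (b * ρ x) := by gcongr
      _ = (c₀ * κ * b) * ρ x := by ring
      _ < 1 * ρ x := by gcongr
      _ = ρ x := one_mul _
  have hassoc : c₀ * (κ * r) = c₀ * κ * r := by ring
  set t : ℝ := c₀ * κ * r with ht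
  have ht0 : 0 < t := by positivity
  have htr : 8 * r ≤ t := by
    rw [ht]
    gcongr
  have ht6 : ball x (6 * r) ⊆ ball x t := ball_subset_ball (by linarith)
  have ht2 : ball x (2 * r) ⊆ ball x t := ball_subset_ball (by linarith)
  refine ⟨fun y => a * ‖T (f.1 - A t f) y‖ₑ ^ p₀, fun y => a * ‖T (A t f) y‖ₑ ^ p₀,
    (hmeas _).const_mul a, (hmeas _).const_mul a, ?_, fun y hy => ?_, fun u hu y hy => ?_⟩
  · refine ae_restrict_of_ae ?_
    have h := hT.1 (f.1 - A t f) (A t f)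
    rw [sub_add_cancel] at h
    filter_upwards [h] with y hy
    have hy' : ‖T f.1 y‖ₑ ≤ ‖T (f.1 - A t f) y‖ₑ + ‖T (A t f) y‖ₑ := by
      rw [← ofReal_norm, ← ofReal_norm, ← ofReal_norm,
        ← ENNReal.ofReal_add (norm_nonneg _) (norm_nonneg _)]
      exact ENNReal.ofReal_le_ofReal hy
    calc F y ≤ (‖T (f.1 - A t f) y‖ₑ + ‖T (A t f) y‖ₑ) ^ p₀ :=
          ENNReal.rpow_le_rpow hy' hp₀0.le
      _ ≤ a * (‖T (f.1 - A t f) y‖ₑ ^ p₀ + ‖T (A t f) y‖ₑ ^ p₀) :=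
          ENNReal.rpow_add_le_mul_rpow_add_rpow _ _ hp₀
      _ = _ := mul_add _ _ _
  · have hy' : y ∈ ball x (κ * r) := ball_subset_ball (by gcongr) hy
    have h3 : ⨍⁻ y in ball x t, ‖T (f.1 - A t f) y‖ₑ ^ p₀ ∂volume ≤ C₁ * G y := by
      refine le_trans ?_ (le_self_add.trans (h₁ f y))
      refine le_iSup₂_of_le x (κ * r) (le_iSup₂_of_le hκr hy' (le_iSup_of_le hκρ ?_))
      rw [hassoc]
    calc ⨍⁻ y in ball x t, a * ‖T (f.1 - A t f) y‖ₑ ^ p₀ ∂volume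
        = a * ⨍⁻ y in ball x t, ‖T (f.1 - A t f) y‖ₑ ^ p₀ ∂volume :=
          lintegral_const_mul _ (hmeas _)
      _ ≤ a * (C₁ * G y) := by gcongr
      _ = (a * C₁) * G y := by ring
      _ ≤ Kt * G y := by
          gcongr
          rw [hKt]
          exact le_add_right le_add_self
  · have h3 := h₂ f x (κ * r) hκr hκρ u (hassoc ▸ ht2 hu) y (hassoc ▸ ht6 hy)
    rw [hassoc] at h3
    set m := critMaximal ρ θ F u with hm
    have h4 : ballNorm q₀ x t (T (A t f)) ≤ C₂ * 2 * (m + G y) ^ (1 / p₀) := by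
      refine h3.trans ?_
      rw [mul_assoc, two_mul]
      gcongr
      · exact le_self_add
      · exact le_add_self
    have h5 : ballNorm q₀ x t (T (A t f)) ^ p ≤ (C₂ * 2) ^ p * (m + G y) ^ (p / p₀) := by
      refine (ENNReal.rpow_le_rpow h4 hp.le).trans (le_of_eq ?_)
      rw [ENNReal.mul_rpow_of_nonneg _ _ hp.le, ← ENNReal.rpow_mul, one_div_mul_eq_div]
    have h6 : ∀ y, (a * ‖T (A t f) y‖ₑ ^ p₀) ^ (p / p₀) =
        a ^ (p / p₀) * ‖T (A t f) y‖ₑ ^ p := by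
      intro y
      rw [ENNReal.mul_rpow_of_nonneg _ _ hP.le, ← ENNReal.rpow_mul ‖T (A t f) y‖ₑ,
        mul_div_cancel₀ _ hp₀0.ne']
    simp_rw [h6]
    rw [lintegral_const_mul' _ _ haPt]
    calc a ^ (p / p₀) * ∫⁻ y in ball x t, ‖T (A t f) y‖ₑ ^ p ∂(volume.withDensity w)
        ≤ a ^ (p / p₀) * (K * (((C₂ * 2) ^ p * (m + G y) ^ (p / p₀)) *
          volume.withDensity w (ball x t))) := by
          gcongr
          refine (hK _ (Lp.stronglyMeasurable _) x t ht0 hτρ).trans ?_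
          gcongr
      _ = a ^ (p / p₀) * (K * (C₂ * 2) ^ p) *
          ((m + G y) ^ (p / p₀) * volume.withDensity w (ball x t)) := by ring
      _ ≤ _ := by
          gcongr
          rw [hKt]
          exact le_add_self

theorem theorem3p2 {𝕜 : Type*} [RCLike 𝕜] (n : ℕ) (hn : 1 ≤ n)
    (ρ : EuclideanSpace ℝ (Fin n) → ℝ) (hρ : IsCriticalRadius ρ)
    (c₀ : ℝ) (hc₀ : 0 < c₀)
    (p₀ : ℝ) (hp₀ : 1 ≤ p₀) (q₀ : ℝ≥0∞) (hq₀ : ENNReal.ofReal p₀ < q₀)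
    (T : Lp 𝕜 (ENNReal.ofReal p₀) (volume : Measure (EuclideanSpace ℝ (Fin n))) →
      Lp 𝕜 (ENNReal.ofReal p₀) (volume : Measure (EuclideanSpace ℝ (Fin n))))
    (hT : IsSublinearOp T)
    (A : ℝ → LcInfty n 𝕜 (ENNReal.ofReal p₀) →
      Lp 𝕜 (ENNReal.ofReal p₀) (volume : Measure (EuclideanSpace ℝ (Fin n))))
    (h₁ : ∀ θ : ℝ, 0 < θ → ∃ C : ℝ≥0, ∀ (f : LcInfty n 𝕜 (ENNReal.ofReal p₀))
      (x : EuclideanSpace ℝ (Fin n)),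
      (⨆ (x₀ : EuclideanSpace ℝ (Fin n)) (r : ℝ) (_ : 0 < r) (_ : x ∈ ball x₀ r) (_ : r < ρ x₀),
          ⨍⁻ y in ball x₀ (c₀ * r), ‖T (f.1 - A (c₀ * r) f) y‖ₑ ^ p₀ ∂volume) +
        (⨆ (x₀ : EuclideanSpace ℝ (Fin n)) (r : ℝ) (_ : 0 < r) (_ : x ∈ ball x₀ r) (_ : ρ x₀ ≤ r),
          (critPsi ρ θ x₀ r)⁻¹ * ⨍⁻ y in ball x₀ r, ‖T f.1 y‖ₑ ^ p₀ ∂volume) ≤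
      C * critMaximal ρ θ (fun y => ‖f.1 y‖ₑ ^ p₀) x)
    (h₂ : ∀ θ : ℝ, 0 < θ → ∃ C : ℝ≥0, ∀ (f : LcInfty n 𝕜 (ENNReal.ofReal p₀))
      (x₀ : EuclideanSpace ℝ (Fin n)) (r : ℝ), 0 < r → r < ρ x₀ →
      ∀ x ∈ ball x₀ (c₀ * r), ∀ x' ∈ ball x₀ (c₀ * r),
        ballNorm q₀ x₀ (c₀ * r) (T (A (c₀ * r) f)) ≤
          C * (critMaximal ρ θ (fun y => ‖T f.1 y‖ₑ ^ p₀) x ^ (1 / p₀) +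
            critMaximal ρ θ (fun y => ‖f.1 y‖ₑ ^ p₀) x' ^ (1 / p₀)))
    (p : ℝ) (hp₀p : p₀ < p) (hpq₀ : ENNReal.ofReal p ≤ q₀)
    (ω : EuclideanSpace ℝ (Fin n) → ℝ) (hω : IsWeight ω)
    (hωA : IsApCritInfty ρ (p / p₀) ω)
    (hωR : IsRHLoc ρ (ENNReal.conjExponent (q₀ / ENNReal.ofReal p)) ω) :
    ∃ C : ℝ≥0, ∀ f : LcInfty n 𝕜 (ENNReal.ofReal p₀),
      eLpNorm (T f.1) (ENNReal.ofReal p) (weightMeasure ω) ≤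
        C * eLpNorm f.1 (ENNReal.ofReal p) (weightMeasure ω) := by
  -- A weight vanishing almost everywhere gives the zero measure; every other one is positive almost
  -- everywhere by the `A_P` condition.
  by_cases h0 : ∀ᵐ x, ω x = 0
  · have hzero : weightMeasure ω = 0 := by
      unfold weightMeasure
      rw [withDensity_eq_zero_iff hω.aemeasurable.ennreal_ofReal]
      filter_upwards [h0] with x hx
      simp [hx]
    exact ⟨0, fun f => by simp [hzero]⟩
  have hρ0 : ∀ x, 0 < ρ x := hρ.1
  have hp₀0 : 0 < p₀ := by linarith
  have hp : 0 < p := by linarith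
  have hP : 1 < p / p₀ := (one_lt_div hp₀0).2 hp₀p
  have hP0 : 0 < p / p₀ := by linarith
  have hP1 : 0 < p / p₀ - 1 := by linarith
  obtain ⟨C₀, hC₀, hρC⟩ := hρ.exists_le
  obtain ⟨θ₀, hθ₀, hA⟩ := hωA
  obtain ⟨C, w, σ, hw, hwω⟩ := hA.exists_critMuckenhoupt hρ0 hθ₀ hP hω h0
  -- The exponent demanded by the weighted maximal theorem; the added 1 keeps `θ` positive when `θ₀
  -- = 0`.
  set θ : ℝ := 3 * (θ₀ * (p / p₀)) / (p / p₀ - 1) + 1 with hθ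
  have hθ0 : 0 < θ := by positivity
  have hθle : 3 * (θ₀ * (p / p₀)) ≤ θ * (p / p₀ - 1) := by
    rw [hθ, add_mul, div_mul_cancel₀ _ hP1.ne']
    linarith
  have hM := hw.lintegral_critMaximal_rpow_le hρ0 hθle
  obtain ⟨C₁, hC₁⟩ := h₁ θ hθ0
  obtain ⟨C₂, hC₂⟩ := h₂ θ hθ0
  obtain ⟨KR, hKR⟩ := hωR.exists_setLIntegral_le (F := 𝕜) hp hpq₀ hω hw.measurable hwω
  set κ : ℝ := max 6 (8 / c₀) with hκ
  have hκ6 : 6 ≤ κ := le_max_left _ _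
  have hκ8 : 8 ≤ c₀ * κ := by
    have : 8 / c₀ ≤ κ := le_max_right _ _
    rwa [div_le_iff₀ hc₀, mul_comm] at this
  -- With `b = 1 / D` all four smallness conditions on `b` hold at once.
  set D : ℝ := 32 * C₀ ^ 2 * (1 + c₀ * κ + κ) with hD
  have hC2 : C₀ ≤ C₀ ^ 2 := by nlinarith
  have hκ0 : 0 < κ := by linarith
  have hτ0 : 0 < c₀ * κ := by positivity
  have hD0 : 0 < D := by positivity
  have hb1 : 32 * (1 / D) * C₀ ^ 2 ≤ 1 := by
    rw [mul_one_div, div_mul_eq_mul_div, div_le_one hD0, hD]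
    exact le_mul_of_one_le_right (by positivity) (by linarith)
  have hbτ : 4 * C₀ * (c₀ * κ) * (1 / D) ≤ 1 := by
    rw [mul_one_div, div_le_one hD0, hD]
    gcongr
    · norm_num
    · linarith
  have hbκ : κ * (1 / D) < 1 := by
    rw [mul_one_div, div_lt_one hD0, hD]
    nlinarith
  have hbτ' : c₀ * κ * (1 / D) < 1 := by
    rw [mul_one_div, div_lt_one hD0, hD]
    nlinarith
  obtain ⟨KS, hKS⟩ := localSplitting_of_sublinear hρ0 hc₀ hp₀ hT hC₁ hC₂ hp hKR hκ6 hκ8 hbκ hbτ'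
  obtain ⟨KG, hKG⟩ := hw.exists_lintegral_rpow_le hρ0 hC₀ hρC hθ0.le (one_div_pos.2 hD0) hb1 hκ8 hbτ
    hM KS
  obtain ⟨KM, hKM⟩ := hM
  have hμ : weightMeasure ω = volume.withDensity w := (withDensity_congr_ae hwω).symm
  have hpow : ∀ z : ℝ≥0∞, (z ^ p₀) ^ (p / p₀) = z ^ p := fun z => by
    rw [← ENNReal.rpow_mul, mul_div_cancel₀ _ hp₀0.ne']
  refine ⟨(KG * KM) ^ (1 / p), fun f => ?_⟩
  -- Integrability of `F`, from `Tf ∈ L^p₀`, is what Lebesgue differentiation needs to bound `F` by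
  -- its local maximal function.
  have hfin : ∫⁻ x, ‖T f.1 x‖ₑ ^ p₀ ≠ ∞ := by
    have h := lintegral_rpow_enorm_lt_top_of_eLpNorm_lt_top (by simpa using hp₀0)
      ENNReal.ofReal_ne_top (Lp.eLpNorm_lt_top (T f.1))
    rw [ENNReal.toReal_ofReal hp₀0.le] at h
    exact h.ne
  have hmain := (hKG _ _ (hKS f) hfin).trans (mul_le_mul' le_rfl
    (hKM (fun y => ‖f.1 y‖ₑ ^ p₀) ((Lp.stronglyMeasurable f.1).enorm.pow_const p₀)))
  simp_rw [hpow] at hmain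
  rw [eLpNorm_ofReal_eq hp, eLpNorm_ofReal_eq hp, hμ,
    ENNReal.coe_rpow_of_nonneg _ (one_div_pos.2 hp).le,
    ← ENNReal.mul_rpow_of_nonneg _ _ (one_div_pos.2 hp).le]
  refine ENNReal.rpow_le_rpow (hmain.trans (le_of_eq ?_)) (one_div_pos.2 hp).le
  push_cast
  ring
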